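/- Let $\varphi$ be the Gaussian free field on the unit circle, i.e. the centered Gaussian generalized field on $\mathbb{R}/2\pi\mathbb{Z}$ with covariance kernel $\mathbb{E}[\varphi(\theta)\varphi(\theta')]=\ln\frac{1}{|e^{i\theta}-e^{i\theta'}|}$, and for $\epsilon>0$ let $\varphi_\epsilon(\theta)=\frac12\int_{-1}^{1}\varphi(\theta+\epsilon v)\,dv$. For $0\le\gamma<\sqrt2$ let $M_\gamma$ be the Gaussian multiplicative chaos measure of parameter $\gamma$, i.e. the random finite measure on the circle that is the limit in probability, for the weak topology of measures, of $e^{\gamma\varphi_\epsilon(\theta)-\frac{\gamma^2}{2}\mathbb{E}[\varphi_\epsilon(\theta)^2]}\,d\theta$ as $\epsilon\to0$, where $d\theta$ is the Lebesgue measure of total mass $2\pi$. Let $c_n=\int_0^{2\pi}e^{in\theta}\,M_\gamma(d\theta)$ be its Fourier coefficients, and define the Fourier dimension of $M_\gamma$ as the supremum of the $s\ge0$ such that $|c_n|=O(n^{-s/2})$ as $n\to\infty$. **Theorem.** Let $0\le\gamma<\frac{1}{\sqrt2}$. For every $\beta\in\left(0,\frac{1-2\gamma^2}{4}\right)$ there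 is a random (real-valued, finite) constant $C$ such that, almost surely, $$|c_n|\le\frac{C}{n^{\beta}}\qquad\text{for all integers } n\ge1.$$ Consequently, almost surely, the Fourier dimension of $M_\gamma$ is at least $\frac{1-2\gamma^2}{2}$. -/

import Mathlib

open MeasureTheory ProbabilityTheory Filter Topology
open scoped Real ENNReal

namespace CircleGMC

/-- The unit circle, parametrized by the angle modulo `2π`. Its `volume` is the Lebesgue measure
`dθ`, of total mass `2π`, and its distance is the arc length distance. -/
abbrev UnitCircle : Type := AddCircle (2 * π)

/-- The circle carries a Lebesgue measure because its circumference is positive. -/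
instance instFactTwoPiPos : Fact ((0 : ℝ) < 2 * π) := ⟨Real.two_pi_pos⟩

/-- The real Hilbert space `L²` of the circle with respect to `dθ`: the test functions. -/
abbrev TestSpace : Type := Lp ℝ 2 (volume : Measure UnitCircle)

/-- The covariance kernel `ln (1 / |e^{iθ} - e^{iθ'}|)`. -/
noncomputable def covKernel (θ θ' : UnitCircle) : ℝ :=
  Real.log (1 / ‖(AddCircle.toCircle θ : ℂ) - (AddCircle.toCircle θ' : ℂ)‖)

/-- `φ` is a Gaussian free field on the circle: the centered Gaussian generalized field
`f ↦ φ f = "∫ φ(θ) f(θ) dθ"` with covariance kernel `ln (1 / |e^{iθ} - e^{iθ'}|)`. -/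
structure IsCircleGFF {Ω : Type*} [MeasurableSpace Ω] (P : Measure Ω)
    (φ : TestSpace → Ω → ℝ) : Prop where
  isGaussianProcess : IsGaussianProcess φ P
  centered : ∀ f : TestSpace, ∫ ω, φ f ω ∂P = 0
  covariance_eq : ∀ f g : TestSpace,
    ∫ ω, φ f ω * φ g ω ∂P = ∫ θ, ∫ θ', covKernel θ θ' * f θ * g θ'

/-- The normalized indicator `(2ε)⁻¹ 1_{[θ - ε, θ + ε]}` of the arc of center `θ` and half-length
`ε` (for `0 < ε < π`). Testing against it is the averaging `½ ∫_{-1}^{1} φ(θ + ε v) dv`. -/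
noncomputable def arcAverage (ε : ℝ) (θ : UnitCircle) : TestSpace :=
  indicatorConstLp 2 (measurableSet_closedBall (x := θ) (ε := ε))
    (measure_ne_top volume (Metric.closedBall θ ε)) (2 * ε)⁻¹

/-- `φreg ε θ` is the cut-off field `φ_ε(θ) = ½ ∫_{-1}^{1} φ(θ + ε v) dv`, in a version that is
jointly measurable in the angle and the randomness, so that it can be integrated along the
circle. -/
structure IsCutoff {Ω : Type*} [MeasurableSpace Ω] (P : Measure Ω)
    (φ : TestSpace → Ω → ℝ) (φreg : ℝ → UnitCircle → Ω → ℝ) : Prop where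
  measurable : ∀ ε ∈ Set.Ioo (0 : ℝ) π, Measurable fun p : UnitCircle × Ω => φreg ε p.1 p.2
  version : ∀ ε ∈ Set.Ioo (0 : ℝ) π, ∀ θ, φreg ε θ =ᵐ[P] φ (arcAverage ε θ)

/-- The regularized random measure `e^{γ φ_ε(θ) - (γ²/2) E[φ_ε(θ)²]} dθ`. -/
noncomputable def regMeasure {Ω : Type*} [MeasurableSpace Ω] (P : Measure Ω)
    (φreg : ℝ → UnitCircle → Ω → ℝ) (γ ε : ℝ) (ω : Ω) : Measure UnitCircle :=
  (volume : Measure UnitCircle).withDensity fun θ =>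
    ENNReal.ofReal (Real.exp (γ * φreg ε θ ω - γ ^ 2 / 2 * ∫ ω', φreg ε θ ω' ^ 2 ∂P))

/-- `M` is the Gaussian multiplicative chaos of parameter `γ`: the random finite measure that is
the limit in probability, for the weak topology of measures, of the regularized measures as
`ε → 0`. -/
structure IsGMC {Ω : Type*} [MeasurableSpace Ω] (P : Measure Ω)
    (φreg : ℝ → UnitCircle → Ω → ℝ) (γ : ℝ) (M : Ω → Measure UnitCircle) : Prop where
  measurable : Measurable M
  isFiniteMeasure : ∀ ω, IsFiniteMeasure (M ω)
  tendsto : ∀ f : C(UnitCircle, ℝ),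
    TendstoInMeasure P (fun ε ω => ∫ θ, f θ ∂(regMeasure P φreg γ ε ω)) (𝓝[>] (0 : ℝ))
      (fun ω => ∫ θ, f θ ∂(M ω))

/-- The Fourier coefficient `c_n(μ) = ∫ e^{i n θ} μ(dθ)`. -/
noncomputable def coeff (μ : Measure UnitCircle) (n : ℕ) : ℂ :=
  ∫ θ, fourier (n : ℤ) θ ∂μ

/-- The Fourier dimension of `μ`: the supremum of the `s ≥ 0` such that
`|c_n(μ)| = O(n^{-s/2})` as `n → ∞`. -/
noncomputable def fourierDim (μ : Measure UnitCircle) : ℝ≥0∞ :=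
  sSup {t | ∃ s : ℝ, 0 ≤ s ∧ t = ENNReal.ofReal s ∧
    (fun n : ℕ => ‖coeff μ n‖) =O[atTop] fun n : ℕ => (n : ℝ) ^ (-s / 2)}

end CircleGMC

/-! The quantity to bound is the expectation of (∑ n^{4b} |c_n|⁴)^{1/2}, the squared weighted `ℓ⁴`
norm of the coefficients, for 4b < 1 − 2γ². Once it is finite, n^b |c_n| is almost surely bounded in
n, with no union bound over frequencies. The point of `ℓ⁴` is its 2-smoothness: for a martingale
started at zero, the expected squared norm is at most a constant times the sum of the expected
squared norms of the increments (`lintegral_sqNormL4_add_le`,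
`IsGaussianSeq.lintegral_sqNormL4_chaosCoeff_le`).

The martingale comes from writing the field as ∑ g_i k_i with independent standard Gaussians g_i.
The scale N = 2^J carries N directions k_i, the translates by multiples of 2π/N of one trigonometric
polynomial with frequencies in [N/4, N/2). Over one scale, ∑ k_i² ≤ 1 and ∑ k_i'² ≤ N² at every
point, and ∫ |k_i| is at most C_δ N^{δ−1}. Adding the direction k_i multiplies the density f by
exp(γ g_i k_i − γ² k_i²/2), which has mean one. The coefficients of the resulting increment are
bounded by its `L¹` norm, and their weighted `ℓ²` norm by N^{2b} times a Sobolev norm at the scale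
N. Hölder's inequality ‖x‖₄² ≤ ‖x‖_∞ ‖x‖₂, put in quadratic form with a free parameter c, combines
the two bounds, and then only second moments of f (slightly tilted to absorb its derivative) are
needed; they are of order N^{γ²}. Up to factors N^{O(δ)}, the scale N contributes N^{γ²} (c · N ·
N^{−2} + c^{−1} N^{4b}), which for c = N^{1/2+2b} is N^{γ² + 2b − 1/2}. The sum over dyadic scales
is geometric because 4b < 1 − 2γ² (`sqNormL4_densityCoeff_increment_le`,
`IsGaussianSeq.sum_lintegral_chaosIncrement_le`,
`IsGaussianSeq.exists_forall_lintegral_chaosCoeff_le`).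

To reach the given field, expand its covariance as ∑ cos(k(θ − θ'))/k (`integral_covKernel_mul`).
Averaging over arcs of half-length ε multiplies the k-th mode by sinc(kε), of modulus at most one,
so every bound is uniform in ε. Finitely many modes of the averaged field have the law of the
corresponding modes of ∑ g_i k_i (`IsGaussianSeq.map_modes_eq`), hence the bound holds for the chaos
of the truncated averaged field. Fatou's lemma for convergence in measure removes first the
truncation (`IsCircleGFF.lintegral_sqNormL4_regDensity_le`), then ε
(`IsGMC.exists_forall_lintegral_sqNormL4_le`), and monotone convergence removes the restriction to
finitely many frequencies. -/

namespace CircleGMC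

/-! ### Smoothness of the weighted `ℓ⁴` norm and the type 2 inequality. -/

/-- The square of the weighted `ℓ⁴` norm of the coordinates of `x` in `s`. -/
noncomputable def sqNormL4 (s : Finset ℕ) (w : ℕ → ℝ) (x : ℕ → ℂ) : ℝ :=
  √(∑ n ∈ s, w n * ‖x n‖ ^ 4)

section SqNormL4

variable {s : Finset ℕ} {w : ℕ → ℝ}

lemma sqNormL4_nonneg (x : ℕ → ℂ) : 0 ≤ sqNormL4 s w x := Real.sqrt_nonneg _

lemma sq_sqNormL4 (hw : ∀ n, 0 ≤ w n) (x : ℕ → ℂ) :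
    sqNormL4 s w x ^ 2 = ∑ n ∈ s, w n * ‖x n‖ ^ 4 :=
  Real.sq_sqrt (Finset.sum_nonneg fun n _ => mul_nonneg (hw n) (by positivity))

lemma measurable_sqNormL4 : Measurable (sqNormL4 s w) := by
  unfold sqNormL4
  fun_prop

lemma continuous_sqNormL4 : Continuous (sqNormL4 s w) := by
  unfold sqNormL4
  fun_prop

lemma sum_weighted_sq_mul_sq_le (hw : ∀ n, 0 ≤ w n) (x y : ℕ → ℂ) :
    ∑ n ∈ s, w n * (‖x n‖ ^ 2 * ‖y n‖ ^ 2) ≤ sqNormL4 s w x * sqNormL4 s w y := by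
  have h := Real.sum_mul_le_sqrt_mul_sqrt s (fun n => √(w n) * ‖x n‖ ^ 2)
    (fun n => √(w n) * ‖y n‖ ^ 2)
  refine le_trans (le_of_eq ?_) (h.trans (le_of_eq ?_))
  · refine Finset.sum_congr rfl fun n _ => ?_
    have := Real.mul_self_sqrt (hw n)
    linear_combination (-(‖x n‖ ^ 2 * ‖y n‖ ^ 2)) * this
  · unfold sqNormL4
    congr 2 <;> refine Finset.sum_congr rfl fun n _ => ?_
    · rw [mul_pow, Real.sq_sqrt (hw n)]; ring
    · rw [mul_pow, Real.sq_sqrt (hw n)]; ring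

/-- Square |z ± u|² = |z|² + |u|² ± 2 Re⟨z, u⟩ and add: the terms linear in Re⟨z, u⟩ cancel, and 8
(Re⟨z, u⟩)² ≤ 8 |z|²|u|² remains beside 2 (|z|² + |u|²)². -/
lemma norm_add_pow_four_add_norm_sub_pow_four_le (z u : ℂ) :
    ‖z + u‖ ^ 4 + ‖z - u‖ ^ 4 ≤ 2 * ‖z‖ ^ 4 + 12 * (‖z‖ ^ 2 * ‖u‖ ^ 2) + 2 * ‖u‖ ^ 4 := by
  have e1 := norm_add_sq (𝕜 := ℂ) z u
  have e2 := norm_sub_sq (𝕜 := ℂ) z u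
  have e3 : (RCLike.re (inner ℂ z u : ℂ)) ^ 2 ≤ (‖z‖ * ‖u‖) ^ 2 := by
    rw [sq_le_sq, abs_of_nonneg (by positivity : 0 ≤ ‖z‖ * ‖u‖)]
    exact (RCLike.abs_re_le_norm _).trans (norm_inner_le_norm z u)
  have e4 : ‖z + u‖ ^ 4 = (‖z + u‖ ^ 2) ^ 2 := by ring
  have e5 : ‖z - u‖ ^ 4 = (‖z - u‖ ^ 2) ^ 2 := by ring
  rw [e4, e5, e1, e2]
  nlinarith

/-- This is the 2-smoothness of `ℓ⁴`. With X and Y the values at `x` and `y`, the squares of the two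
left-hand terms add up to at most 2X² + 12XY + 2Y², so the square of their sum is at most 4X² + 24XY
+ 4Y² ≤ (2X + 6Y)². The mixed term dictates the constant 6. -/
lemma sqNormL4_add_add_sqNormL4_sub_le (hw : ∀ n, 0 ≤ w n) (x y : ℕ → ℂ) :
    sqNormL4 s w (x + y) + sqNormL4 s w (x - y) ≤ 2 * sqNormL4 s w x + 6 * sqNormL4 s w y := by
  have h1 : sqNormL4 s w (x + y) ^ 2 + sqNormL4 s w (x - y) ^ 2 ≤
      2 * sqNormL4 s w x ^ 2 + 12 * (sqNormL4 s w x * sqNormL4 s w y)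
        + 2 * sqNormL4 s w y ^ 2 := by
    have h2 := sum_weighted_sq_mul_sq_le (s := s) hw x y
    rw [sq_sqNormL4 hw, sq_sqNormL4 hw, sq_sqNormL4 hw, sq_sqNormL4 hw]
    calc _ = ∑ n ∈ s, w n * (‖x n + y n‖ ^ 4 + ‖x n - y n‖ ^ 4) := by
          rw [← Finset.sum_add_distrib]
          exact Finset.sum_congr rfl fun n _ => by simp [mul_add]
      _ ≤ ∑ n ∈ s, w n * (2 * ‖x n‖ ^ 4 + 12 * (‖x n‖ ^ 2 * ‖y n‖ ^ 2) + 2 * ‖y n‖ ^ 4) :=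
          Finset.sum_le_sum fun n _ =>
            mul_le_mul_of_nonneg_left (norm_add_pow_four_add_norm_sub_pow_four_le _ _) (hw n)
      _ = 2 * ∑ n ∈ s, w n * ‖x n‖ ^ 4 + 12 * ∑ n ∈ s, w n * (‖x n‖ ^ 2 * ‖y n‖ ^ 2)
          + 2 * ∑ n ∈ s, w n * ‖y n‖ ^ 4 := by
          simp only [Finset.mul_sum, ← Finset.sum_add_distrib]
          exact Finset.sum_congr rfl fun n _ => by ring
      _ ≤ _ := by linarith
  have a := sqNormL4_nonneg (s := s) (w := w) x
  have b := sqNormL4_nonneg (s := s) (w := w) y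
  refine abs_le_of_sq_le_sq' ?_ (by positivity) |>.2
  nlinarith [sq_nonneg (sqNormL4 s w (x + y) - sqNormL4 s w (x - y))]

/-- The supporting hyperplane of the convex function `sqNormL4` at `x`, multiplied by its value
there so that nothing is divided by zero. Termwise it is |x|² + 2⟨x, z − x⟩ ≤ |z|², followed by
Cauchy–Schwarz. -/
lemma sqNormL4_sq_add_le_mul (hw : ∀ n, 0 ≤ w n) (x z : ℕ → ℂ) :
    sqNormL4 s w x ^ 2 + 2 * ∑ n ∈ s, w n * ‖x n‖ ^ 2 * (inner ℝ (x n) (z n - x n)) ≤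
      sqNormL4 s w x * sqNormL4 s w z := by
  refine le_trans ?_ (sum_weighted_sq_mul_sq_le (s := s) hw x z)
  rw [sq_sqNormL4 hw, Finset.mul_sum, ← Finset.sum_add_distrib]
  refine Finset.sum_le_sum fun n _ => ?_
  have h := norm_sub_sq_real (z n) (x n)
  have h2 : inner ℝ (x n) (z n - x n) = inner ℝ (z n) (x n) - ‖x n‖ ^ 2 := by
    rw [inner_sub_right, real_inner_self_eq_norm_sq, real_inner_comm]
  rw [h2]
  have h3 : 0 ≤ w n * ‖x n‖ ^ 2 := mul_nonneg (hw n) (by positivity)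
  nlinarith [mul_le_mul_of_nonneg_left (sq_nonneg ‖z n - x n‖) h3]

/-- Jensen's inequality for `sqNormL4`. -/
lemma ofReal_sqNormL4_le_lintegral {α : Type*} [MeasurableSpace α] {ν : Measure α}
    [IsProbabilityMeasure ν] (hw : ∀ n, 0 ≤ w n) (x : ℕ → ℂ) (z : α → ℕ → ℂ)
    (hz : ∀ n ∈ s, Integrable (fun t => z t n) ν)
    (hmean : ∀ n ∈ s, ∫ t, z t n ∂ν = x n) (hzm : Measurable z) :
    ENNReal.ofReal (sqNormL4 s w x) ≤ ∫⁻ t, ENNReal.ofReal (sqNormL4 s w (z t)) ∂ν := by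
  by_cases htop : ∫⁻ t, ENNReal.ofReal (sqNormL4 s w (z t)) ∂ν = ∞
  · simp [htop]
  have hint : Integrable (fun t => sqNormL4 s w (z t)) ν := by
    refine (lintegral_ofReal_ne_top_iff_integrable ?_ ?_).1 htop
    · exact (measurable_sqNormL4.comp hzm).aestronglyMeasurable
    · exact .of_forall fun t => sqNormL4_nonneg _
  rw [← ofReal_integral_eq_lintegral_ofReal hint (.of_forall fun t => sqNormL4_nonneg _)]
  refine ENNReal.ofReal_le_ofReal ?_
  rcases (sqNormL4_nonneg (s := s) (w := w) x).eq_or_lt with h0 | h0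
  · rw [← h0]
    exact integral_nonneg fun t => sqNormL4_nonneg _
  have hlin : ∀ n ∈ s, Integrable (fun t => inner ℝ (x n) (z t n - x n)) ν := fun n hn =>
    ((hz n hn).sub (integrable_const _)).const_inner _
  have hsum : ∫ t, (∑ n ∈ s, w n * ‖x n‖ ^ 2 * (inner ℝ (x n) (z t n - x n))) ∂ν = 0 := by
    rw [integral_finsetSum _ fun n hn => (hlin n hn).const_mul _]
    refine Finset.sum_eq_zero fun n hn => ?_
    have hin : ∫ t, inner ℝ (x n) (z t n - x n) ∂ν = inner ℝ (x n) (∫ t, (z t n - x n) ∂ν) :=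
      integral_inner (f := fun t => z t n - x n) ((hz n hn).sub (integrable_const _)) (x n)
    rw [integral_const_mul, hin, integral_sub (hz n hn) (integrable_const _), hmean n hn]
    simp
  have hsumint : Integrable
      (fun t => ∑ n ∈ s, w n * ‖x n‖ ^ 2 * (inner ℝ (x n) (z t n - x n))) ν :=
    integrable_finsetSum _ fun n hn => (hlin n hn).const_mul _
  -- Integrating the supporting hyperplane removes its linear part, since `z` has mean `x`; the
  -- positive factor `sqNormL4 s w x` then cancels.
  have key : sqNormL4 s w x ^ 2 ≤ sqNormL4 s w x * ∫ t, sqNormL4 s w (z t) ∂ν := by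
    rw [← integral_const_mul]
    calc sqNormL4 s w x ^ 2 = ∫ t, (sqNormL4 s w x ^ 2 +
          2 * ∑ n ∈ s, w n * ‖x n‖ ^ 2 * (inner ℝ (x n) (z t n - x n))) ∂ν := by
          rw [integral_add (integrable_const _) (hsumint.const_mul 2), integral_const_mul, hsum]
          simp
      _ ≤ _ := integral_mono ((integrable_const _).add (hsumint.const_mul 2))
          (hint.const_mul _) fun t => sqNormL4_sq_add_le_mul hw x (z t)
  nlinarith

/-- One step of the martingale type `2` inequality for the weighted `ℓ⁴` norm. -/
lemma lintegral_sqNormL4_add_le {α : Type*} [MeasurableSpace α] {ν : Measure α}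
    [IsProbabilityMeasure ν] (hw : ∀ n, 0 ≤ w n) (x : ℕ → ℂ) (d : α → ℕ → ℂ)
    (hd : ∀ n ∈ s, Integrable (fun t => d t n) ν) (hmean : ∀ n ∈ s, ∫ t, d t n ∂ν = 0)
    (hdm : Measurable d) :
    ∫⁻ t, ENNReal.ofReal (sqNormL4 s w (x + d t)) ∂ν ≤ ENNReal.ofReal (sqNormL4 s w x) +
      6 * ∫⁻ t, ENNReal.ofReal (sqNormL4 s w (d t)) ∂ν := by
  -- By Jensen the reflected term `x - d` contributes at least `sqNormL4 s w x`, which is subtracted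
  -- from the averaged two-point inequality. The law of `d` need not be symmetric.
  have hJ := ofReal_sqNormL4_le_lintegral (s := s) (ν := ν) hw x (fun t => x - d t)
    (fun n hn => (integrable_const _).sub (hd n hn))
    (fun n hn => by
      simp only [Pi.sub_apply]
      rw [integral_sub (integrable_const _) (hd n hn), hmean n hn]; simp)
    (measurable_const.sub hdm)
  have hsum : ∫⁻ t, ENNReal.ofReal (sqNormL4 s w (x + d t)) ∂ν +
      ∫⁻ t, ENNReal.ofReal (sqNormL4 s w (x - d t)) ∂ν ≤
      2 * ENNReal.ofReal (sqNormL4 s w x) +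
        6 * ∫⁻ t, ENNReal.ofReal (sqNormL4 s w (d t)) ∂ν := by
    have hm1 : Measurable fun t => ENNReal.ofReal (sqNormL4 s w (x + d t)) :=
      (measurable_sqNormL4.comp (measurable_const.add hdm)).ennreal_ofReal
    have hm2 : Measurable fun t => ENNReal.ofReal (sqNormL4 s w (d t)) :=
      (measurable_sqNormL4.comp hdm).ennreal_ofReal
    rw [← lintegral_add_left hm1, ← lintegral_const_mul _ hm2]
    calc _ ≤ ∫⁻ t, (2 * ENNReal.ofReal (sqNormL4 s w x) +
          6 * ENNReal.ofReal (sqNormL4 s w (d t))) ∂ν := by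
          refine lintegral_mono fun t => ?_
          have h := sqNormL4_add_add_sqNormL4_sub_le (s := s) hw x (d t)
          have e2 : (2 : ℝ≥0∞) = ENNReal.ofReal 2 := by simp
          have e6 : (6 : ℝ≥0∞) = ENNReal.ofReal 6 := by simp
          rw [e2, e6, ← ENNReal.ofReal_mul (by norm_num), ← ENNReal.ofReal_mul (by norm_num),
            ← ENNReal.ofReal_add (sqNormL4_nonneg _) (sqNormL4_nonneg _),
            ← ENNReal.ofReal_add (by have := sqNormL4_nonneg (s := s) (w := w) x; positivity)
              (by have := sqNormL4_nonneg (s := s) (w := w) (d t); positivity)]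
          exact ENNReal.ofReal_le_ofReal h
      _ = _ := by rw [lintegral_add_left measurable_const]; simp
  have h3 : ∫⁻ t, ENNReal.ofReal (sqNormL4 s w (x + d t)) ∂ν + ENNReal.ofReal (sqNormL4 s w x) ≤
      (ENNReal.ofReal (sqNormL4 s w x) + 6 * ∫⁻ t, ENNReal.ofReal (sqNormL4 s w (d t)) ∂ν)
        + ENNReal.ofReal (sqNormL4 s w x) := by
    refine le_trans (by gcongr) (hsum.trans (le_of_eq (by ring)))
  exact (ENNReal.add_le_add_iff_right ENNReal.ofReal_ne_top).1 h3

/-- Hölder's inequality `‖x‖₄² ≤ ‖x‖_∞ ‖x‖₂` in quadratic form. -/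
lemma sqNormL4_le_of_norm_le {x : ℕ → ℂ} {A B c : ℝ} (hw : ∀ n, 0 ≤ w n) (hc : 0 < c)
    (hxA : ∀ n ∈ s, ‖x n‖ ≤ A) (hB : ∑ n ∈ s, w n * ‖x n‖ ^ 2 ≤ B) :
    sqNormL4 s w x ≤ c / 2 * A ^ 2 + (2 * c)⁻¹ * B := by
  have hB0 : 0 ≤ B :=
    (Finset.sum_nonneg fun n _ => mul_nonneg (hw n) (by positivity)).trans hB
  have h1 : ∑ n ∈ s, w n * ‖x n‖ ^ 4 ≤ A ^ 2 * B := by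
    calc ∑ n ∈ s, w n * ‖x n‖ ^ 4 ≤ ∑ n ∈ s, A ^ 2 * (w n * ‖x n‖ ^ 2) := by
          refine Finset.sum_le_sum fun n hn => ?_
          have h2 : ‖x n‖ ^ 2 ≤ A ^ 2 := pow_le_pow_left₀ (norm_nonneg _) (hxA n hn) 2
          have h3 : 0 ≤ w n * ‖x n‖ ^ 2 := mul_nonneg (hw n) (by positivity)
          nlinarith [mul_le_mul_of_nonneg_right h2 h3]
      _ ≤ _ := by rw [← Finset.mul_sum]; gcongr
  refine Real.sqrt_le_iff.2 ⟨by positivity, h1.trans ?_⟩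
  have e : (c / 2 * A ^ 2 + (2 * c)⁻¹ * B) ^ 2 - A ^ 2 * B =
      (c / 2 * A ^ 2 - (2 * c)⁻¹ * B) ^ 2 := by field_simp; ring
  nlinarith [sq_nonneg (c / 2 * A ^ 2 - (2 * c)⁻¹ * B)]

end SqNormL4

/-! ### Fourier coefficients of densities: Bessel, integration by parts, Sobolev bound. -/

/-- The Fourier coefficients over one period of a density `h` on the line. -/
noncomputable def densityCoeff (h : ℝ → ℝ) (n : ℕ) : ℂ :=
  ∫ θ in (0 : ℝ)..2 * π, Complex.exp (n * θ * Complex.I) * h θ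

lemma norm_exp_natCast_mul_I (n : ℕ) (θ : ℝ) : ‖Complex.exp (n * θ * Complex.I)‖ = 1 := by
  have := Complex.norm_exp_ofReal_mul_I (n * θ)
  push_cast at this
  exact this

lemma norm_densityCoeff_le (h : ℝ → ℝ) (n : ℕ) :
    ‖densityCoeff h n‖ ≤ ∫ θ in (0 : ℝ)..2 * π, |h θ| := by
  refine (intervalIntegral.norm_integral_le_integral_norm Real.two_pi_pos.le).trans
    (le_of_eq ?_)
  simp only [norm_mul, norm_exp_natCast_mul_I, one_mul, Complex.norm_real, Real.norm_eq_abs]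

lemma densityCoeff_eq_fourierCoeffOn (h : ℝ → ℝ) (n : ℕ) :
    densityCoeff h n =
      (2 * π : ℝ) * fourierCoeffOn Real.two_pi_pos (fun θ => (h θ : ℂ)) (-(n : ℤ)) := by
  rw [fourierCoeffOn_eq_integral, densityCoeff]
  simp only [sub_zero, neg_neg, Complex.real_smul]
  rw [← mul_assoc, ← Complex.ofReal_mul, mul_one_div_cancel Real.two_pi_pos.ne']
  simp only [Complex.ofReal_one, one_mul]
  refine intervalIntegral.integral_congr fun θ _ => ?_
  simp only [fourier_coe_apply, smul_eq_mul]
  congr 2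
  push_cast
  have : (π : ℂ) ≠ 0 := by exact_mod_cast Real.pi_ne_zero
  field_simp
  ring

/-- Bessel's inequality. -/
lemma sum_sq_norm_densityCoeff_le {h : ℝ → ℝ} (hc : Continuous h) (s : Finset ℕ) :
    ∑ n ∈ s, ‖densityCoeff h n‖ ^ 2 ≤ 2 * π * ∫ θ in (0 : ℝ)..2 * π, h θ ^ 2 := by
  have hL : MemLp (fun θ => (h θ : ℂ)) 2 (volume.restrict (Set.Ioc 0 (2 * π))) := by
    have hcc : Continuous fun θ => (h θ : ℂ) := by fun_prop
    obtain ⟨C, hC⟩ := (isCompact_Icc (a := (0 : ℝ)) (b := 2 * π)).exists_bound_of_continuousOn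
      hcc.continuousOn
    refine MemLp.of_bound hcc.aestronglyMeasurable C ?_
    filter_upwards [ae_restrict_mem measurableSet_Ioc] with θ hθ
    exact hC θ ⟨hθ.1.le, hθ.2⟩
  have hP := hasSum_sq_fourierCoeffOn Real.two_pi_pos hL
  have hinj : Set.InjOn (fun n : ℕ => -(n : ℤ)) s := fun a _ b _ hab => by simpa using hab
  have hle := sum_le_hasSum (s.image fun n : ℕ => -(n : ℤ)) (fun i _ => by positivity) hP
  rw [Finset.sum_image hinj] at hle
  simp only [densityCoeff_eq_fourierCoeffOn, norm_mul, mul_pow, ← Finset.mul_sum]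
  have h2 : ‖((2 * π : ℝ) : ℂ)‖ = 2 * π := by
    rw [Complex.norm_real, Real.norm_eq_abs, abs_of_pos Real.two_pi_pos]
  rw [h2]
  calc _ ≤ (2 * π) ^ 2 * ((2 * π - 0)⁻¹ • ∫ x in (0 : ℝ)..2 * π, ‖(h x : ℂ)‖ ^ 2) := by gcongr
    _ = _ := by
      simp only [sub_zero, smul_eq_mul, Complex.norm_real, Real.norm_eq_abs, sq_abs]
      field_simp

lemma natCast_mul_densityCoeff {h h' : ℝ → ℝ} (hd : ∀ θ, HasDerivAt h (h' θ) θ)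
    (hc : Continuous h') (hper : h (2 * π) = h 0) (n : ℕ) :
    (n : ℂ) * densityCoeff h n = Complex.I * densityCoeff h' n := by
  have hE : ∀ θ : ℝ, HasDerivAt (fun θ : ℝ => Complex.exp (n * θ * Complex.I))
      (Complex.exp (n * θ * Complex.I) * (n * Complex.I)) θ := fun θ => by
    have h1 : HasDerivAt (fun θ : ℝ => (n : ℂ) * θ * Complex.I) (n * Complex.I) θ := by
      simpa using ((Complex.ofRealCLM.hasDerivAt (x := θ)).const_mul (n : ℂ)).mul_const Complex.I
    exact h1.cexp
  have hp : ∀ θ : ℝ, HasDerivAt (fun θ : ℝ => Complex.exp (n * θ * Complex.I) * (h θ : ℂ))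
      (n * Complex.I * (Complex.exp (n * θ * Complex.I) * h θ)
        + Complex.exp (n * θ * Complex.I) * h' θ) θ := fun θ => by
    exact ((hE θ).mul (hd θ).ofReal_comp).congr_deriv (by ring)
  have hch : Continuous h := continuous_iff_continuousAt.2 fun θ => (hd θ).continuousAt
  have h0 := intervalIntegral.integral_eq_sub_of_hasDerivAt (a := 0) (b := 2 * π)
    (fun θ _ => hp θ) (Continuous.intervalIntegrable (by fun_prop) _ _)
  have hend : Complex.exp (n * ((2 * π : ℝ) : ℂ) * Complex.I) = 1 := by
    rw [show (n : ℂ) * ((2 * π : ℝ) : ℂ) * Complex.I = n * (2 * π * Complex.I) by push_cast; ring]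
    exact Complex.exp_nat_mul_two_pi_mul_I n
  rw [intervalIntegral.integral_add (Continuous.intervalIntegrable (by fun_prop) _ _)
    (Continuous.intervalIntegrable (by fun_prop) _ _), intervalIntegral.integral_const_mul,
    hend, hper] at h0
  simp only [Complex.ofReal_zero, mul_zero, zero_mul, Complex.exp_zero, sub_self] at h0
  have hI := Complex.I_mul_I
  unfold densityCoeff
  linear_combination (-Complex.I) * h0 + (n : ℂ) *
    (∫ θ in (0 : ℝ)..2 * π, Complex.exp (n * θ * Complex.I) * h θ) * hI

/-- Since 4b ≤ 2, the ratio (n/N)^{4b} is at most 1 for n ≤ N and at most (n/N)² beyond. This trades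
the weight for one derivative measured at the scale N. -/
lemma rpow_le_mul_one_add_sq {b N : ℝ} (hb : 0 ≤ b) (hb' : 4 * b ≤ 2) (hN : 0 < N) (n : ℕ) :
    (n : ℝ) ^ (4 * b) ≤ N ^ (4 * b) * (1 + n ^ 2 / N ^ 2) := by
  have h1 : (n : ℝ) ^ (4 * b) = N ^ (4 * b) * ((n : ℝ) / N) ^ (4 * b) := by
    rw [← Real.mul_rpow hN.le (by positivity), mul_div_cancel₀ _ hN.ne']
  rw [h1]
  refine mul_le_mul_of_nonneg_left ?_ (by positivity)
  rw [← div_pow]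
  rcases le_total ((n : ℝ) / N) 1 with h | h
  · have := Real.rpow_le_one (by positivity) h (by linarith : 0 ≤ 4 * b)
    nlinarith [sq_nonneg ((n : ℝ) / N)]
  · have := Real.rpow_le_rpow_of_exponent_le h hb'
    rw [Real.rpow_two] at this
    linarith

/-- The weighted `ℓ⁴` norm of Fourier coefficients is controlled at a given frequency scale `N` by
the `L¹` norm of the density and its Sobolev norm. -/
lemma sqNormL4_densityCoeff_le {h h' : ℝ → ℝ} (hd : ∀ θ, HasDerivAt h (h' θ) θ)
    (hc : Continuous h') (hper : h (2 * π) = h 0) {b N c : ℝ} (hb : 0 ≤ b) (hb' : 4 * b ≤ 2)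
    (hN : 0 < N) (hc0 : 0 < c) (s : Finset ℕ) :
    sqNormL4 s (fun n => (n : ℝ) ^ (4 * b)) (densityCoeff h) ≤
      c / 2 * (∫ θ in (0 : ℝ)..2 * π, |h θ|) ^ 2 + (2 * c)⁻¹ *
        (N ^ (4 * b) * (2 * π * ∫ θ in (0 : ℝ)..2 * π, (h θ ^ 2 + h' θ ^ 2 / N ^ 2))) := by
  have hch : Continuous h := continuous_iff_continuousAt.2 fun θ => (hd θ).continuousAt
  refine sqNormL4_le_of_norm_le (fun n => by positivity) hc0
    (fun n _ => norm_densityCoeff_le h n) ?_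
  have hn : ∀ n : ℕ, (n : ℝ) ^ 2 * ‖densityCoeff h n‖ ^ 2 = ‖densityCoeff h' n‖ ^ 2 := fun n => by
    have := congrArg norm (natCast_mul_densityCoeff hd hc hper n)
    simp only [norm_mul, Complex.norm_I, one_mul, Complex.norm_natCast] at this
    rw [← mul_pow, this]
  calc _ ≤ ∑ n ∈ s, N ^ (4 * b) *
        (‖densityCoeff h n‖ ^ 2 + ‖densityCoeff h' n‖ ^ 2 / N ^ 2) := by
        refine Finset.sum_le_sum fun n _ => ?_
        refine (mul_le_mul_of_nonneg_right (rpow_le_mul_one_add_sq hb hb' hN n)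
          (by positivity)).trans (le_of_eq ?_)
        rw [← hn n]
        ring
    _ = N ^ (4 * b) * (∑ n ∈ s, ‖densityCoeff h n‖ ^ 2 +
        (∑ n ∈ s, ‖densityCoeff h' n‖ ^ 2) / N ^ 2) := by
        rw [← Finset.mul_sum, Finset.sum_add_distrib, Finset.sum_div]
    _ ≤ N ^ (4 * b) * (2 * π * (∫ θ in (0 : ℝ)..2 * π, h θ ^ 2) +
        (2 * π * ∫ θ in (0 : ℝ)..2 * π, h' θ ^ 2) / N ^ 2) := by
        gcongr
        · exact sum_sq_norm_densityCoeff_le hch s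
        · exact sum_sq_norm_densityCoeff_le hc s
    _ = _ := by
        rw [intervalIntegral.integral_add (Continuous.intervalIntegrable (by fun_prop) _ _)
          (Continuous.intervalIntegrable (by fun_prop) _ _), intervalIntegral.integral_div]
        ring

/-- Cauchy–Schwarz for the measure p dθ, read off the discriminant of x ↦ ∫ p (x − q)². -/
lemma sq_intervalIntegral_mul_le {p q : ℝ → ℝ} (hp : Continuous p) (hq : Continuous q)
    (hp0 : ∀ θ, 0 ≤ p θ) {a b : ℝ} (hab : a ≤ b) :
    (∫ θ in a..b, p θ * q θ) ^ 2 ≤ (∫ θ in a..b, p θ) * ∫ θ in a..b, p θ * q θ ^ 2 := by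
  set A := ∫ θ in a..b, p θ
  set B := ∫ θ in a..b, p θ * q θ
  set D := ∫ θ in a..b, p θ * q θ ^ 2
  have hquad : ∀ x : ℝ, 0 ≤ A * (x * x) + (-2 * B) * x + D := fun x => by
    have h0 : 0 ≤ ∫ θ in a..b, p θ * (x - q θ) ^ 2 :=
      intervalIntegral.integral_nonneg hab fun θ _ => mul_nonneg (hp0 θ) (sq_nonneg _)
    have h1 : ∫ θ in a..b, p θ * (x - q θ) ^ 2 =
        ∫ θ in a..b, ((x * x) * p θ + (-2 * x) * (p θ * q θ) + p θ * q θ ^ 2) :=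
      intervalIntegral.integral_congr fun θ _ => by ring
    rw [h1, intervalIntegral.integral_add (Continuous.intervalIntegrable (by fun_prop) _ _)
      (Continuous.intervalIntegrable (by fun_prop) _ _),
      intervalIntegral.integral_add (Continuous.intervalIntegrable (by fun_prop) _ _)
      (Continuous.intervalIntegrable (by fun_prop) _ _), intervalIntegral.integral_const_mul,
      intervalIntegral.integral_const_mul] at h0
    linarith
  have := discrim_le_zero hquad
  unfold discrim at this
  nlinarith

/-! ### The effect of one Gaussian factor on the `ℓ⁴` norm. -/

lemma two_add_sq_le_exp_add_exp_neg (y : ℝ) : 2 + y ^ 2 ≤ Real.exp y + Real.exp (-y) := by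
  have h0 : (y / 2) ^ 2 ≤ Real.sinh (y / 2) ^ 2 := by
    rcases le_total 0 (y / 2) with h | h
    · exact pow_le_pow_left₀ h (Real.self_le_sinh_iff.2 h) 2
    · have := Real.sinh_le_self_iff.2 h
      nlinarith
  have h1 : Real.exp (y / 2) ^ 2 = Real.exp y := by rw [← Real.exp_nat_mul]; congr 1; ring
  have h2 : Real.exp (-(y / 2)) ^ 2 = Real.exp (-y) := by
    rw [← Real.exp_nat_mul]; congr 1; ring
  have h3 : Real.exp (y / 2) * Real.exp (-(y / 2)) = 1 := by rw [← Real.exp_add]; simp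
  rw [Real.sinh_eq] at h0
  nlinarith

lemma abs_exp_sub_one_le_mul_exp (u : ℝ) : |Real.exp u - 1| ≤ |u| * Real.exp |u| := by
  have h1 := Real.add_one_le_exp u
  have h2 := Real.add_one_le_exp (-u)
  rw [abs_le]
  rcases le_total 0 u with h | h
  · rw [abs_of_nonneg h]
    have h3 : Real.exp u * Real.exp (-u) = 1 := by rw [← Real.exp_add]; simp
    have h4 := Real.exp_pos u
    constructor <;> nlinarith
  · rw [abs_of_nonpos h]
    have h4 : 1 ≤ Real.exp (-u) := Real.one_le_exp (by linarith)
    have h5 : Real.exp u ≤ 1 := Real.exp_le_one_iff.2 h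
    constructor <;> nlinarith

lemma gaussian_exponent_bound {γ x : ℝ} (hγ : 0 ≤ γ) (hγ1 : γ ≤ 1) (hx : |x| ≤ 1) (t : ℝ) :
    |γ * t * x - γ ^ 2 / 2 * x ^ 2| ≤ |x| * (|t| + 1) := by
  rw [show γ * t * x - γ ^ 2 / 2 * x ^ 2 = x * (γ * t - γ ^ 2 / 2 * x) by ring, abs_mul]
  refine mul_le_mul_of_nonneg_left ((abs_sub _ _).trans ?_) (abs_nonneg _)
  rw [abs_mul, abs_mul, abs_of_nonneg hγ, abs_of_nonneg (by positivity : 0 ≤ γ ^ 2 / 2)]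
  have hγ2 : γ ^ 2 ≤ 1 := pow_le_one₀ hγ hγ1
  nlinarith [abs_nonneg t, abs_nonneg x]

lemma add_one_mul_exp_le (t : ℝ) :
    (|t| + 1) * Real.exp (|t| + 1) ≤ Real.exp (2 * |t| + 2) := by
  rw [show 2 * |t| + 2 = (|t| + 1) + (|t| + 1) by ring, Real.exp_add (|t| + 1)]
  exact mul_le_mul_of_nonneg_right (by linarith [Real.add_one_le_exp (|t| + 1)])
    (Real.exp_pos _).le

/-- The factor |x| is kept so that the localization of a direction passes to the increment it
creates; the dependence on `t` is confined to a factor that is integrable for the Gaussian law. -/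
lemma abs_exp_gaussian_exponent_sub_one_le {γ x : ℝ} (hγ : 0 ≤ γ) (hγ1 : γ ≤ 1) (hx : |x| ≤ 1)
    (t : ℝ) :
    |Real.exp (γ * t * x - γ ^ 2 / 2 * x ^ 2) - 1| ≤ Real.exp (2 * |t| + 2) * |x| := by
  have h1 := gaussian_exponent_bound hγ hγ1 hx t
  have h2 : |γ * t * x - γ ^ 2 / 2 * x ^ 2| ≤ |t| + 1 := h1.trans
    (by nlinarith [abs_nonneg t, abs_nonneg x])
  refine (abs_exp_sub_one_le_mul_exp _).trans ?_
  calc _ ≤ |x| * (|t| + 1) * Real.exp (|t| + 1) :=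
        mul_le_mul h1 (Real.exp_le_exp.2 h2) (Real.exp_pos _).le (by positivity)
    _ = (|t| + 1) * Real.exp (|t| + 1) * |x| := by ring
    _ ≤ _ := mul_le_mul_of_nonneg_right (add_one_mul_exp_le t) (abs_nonneg _)

lemma abs_deriv_gaussian_exponent_mul_exp_le {γ x : ℝ} (hγ : 0 ≤ γ) (hγ1 : γ ≤ 1) (hx : |x| ≤ 1)
    (t x' : ℝ) :
    |(γ * t * x' - γ ^ 2 / 2 * (2 * x * x')) * Real.exp (γ * t * x - γ ^ 2 / 2 * x ^ 2)| ≤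
      Real.exp (2 * |t| + 2) * |x'| := by
  have h1 := gaussian_exponent_bound hγ hγ1 hx t
  have h2 : |γ * t * x - γ ^ 2 / 2 * x ^ 2| ≤ |t| + 1 := h1.trans
    (by nlinarith [abs_nonneg t, abs_nonneg x])
  have hcoef : |γ * t - γ ^ 2 * x| ≤ |t| + 1 := by
    refine (abs_sub _ _).trans ?_
    rw [abs_mul, abs_mul, abs_of_nonneg hγ, abs_of_nonneg (by positivity : 0 ≤ γ ^ 2)]
    have hγ2 : γ ^ 2 ≤ 1 := pow_le_one₀ hγ hγ1
    nlinarith [abs_nonneg t, abs_nonneg x]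
  rw [show γ * t * x' - γ ^ 2 / 2 * (2 * x * x') = x' * (γ * t - γ ^ 2 * x) by ring, abs_mul,
    abs_mul, abs_of_pos (Real.exp_pos _)]
  calc _ ≤ |x'| * (|t| + 1) * Real.exp (|t| + 1) :=
        mul_le_mul (mul_le_mul_of_nonneg_left hcoef (abs_nonneg _))
          (Real.exp_le_exp.2 ((le_abs_self _).trans h2)) (Real.exp_pos _).le (by positivity)
    _ = (|t| + 1) * Real.exp (|t| + 1) * |x'| := by ring
    _ ≤ _ := mul_le_mul_of_nonneg_right (add_one_mul_exp_le t) (abs_nonneg _)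

/-- The pointwise Sobolev estimate behind `sqNormL4_densityCoeff_increment_le`: here `p` and `q`
stand for the perturbation and its derivative, `y` for the rescaled logarithmic derivative. -/
lemma sq_add_sq_le_of_abs_le {p q x x' y C N E : ℝ} (hp : |p| ≤ C * |x|)
    (hq : |q| ≤ C * |x'|) (hE : 2 + y ^ 2 ≤ E) :
    p ^ 2 + (y * p + q / N) ^ 2 ≤ 3 * (E * (C ^ 2 * (x ^ 2 + x' ^ 2 / N ^ 2))) := by
  have hp2 : p ^ 2 ≤ C ^ 2 * x ^ 2 := by
    rw [← sq_abs p, ← sq_abs x, ← mul_pow]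
    exact pow_le_pow_left₀ (abs_nonneg _) hp 2
  have hq2 : (q / N) ^ 2 ≤ C ^ 2 * (x' ^ 2 / N ^ 2) := by
    rw [div_pow, ← mul_div_assoc]
    refine div_le_div_of_nonneg_right ?_ (by positivity)
    rw [← sq_abs q, ← sq_abs x', ← mul_pow]
    exact pow_le_pow_left₀ (abs_nonneg _) hq 2
  have e2 : (y * p + q / N) ^ 2 ≤ 2 * y ^ 2 * p ^ 2 + 2 * (q / N) ^ 2 := by
    nlinarith [sq_nonneg (y * p - q / N)]
  have a1 : p ^ 2 * (1 + 2 * y ^ 2) ≤ C ^ 2 * x ^ 2 * (3 * E) := by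
    apply mul_le_mul hp2 _ (by positivity) (by positivity)
    nlinarith [sq_nonneg y]
  have a2 : 2 * (q / N) ^ 2 ≤ C ^ 2 * (x' ^ 2 / N ^ 2) * (3 * E) := by
    have h0 : 0 ≤ C ^ 2 * (x' ^ 2 / N ^ 2) := by positivity
    have h1 : 2 ≤ 3 * E := by nlinarith [sq_nonneg y]
    nlinarith
  nlinarith

/-- The effect on the weighted `ℓ⁴` norm of multiplying the density `exp v` by one more Gaussian
factor, in the direction `k` and at the frequency scale `N`. -/
lemma sqNormL4_densityCoeff_increment_le {v v' k k' : ℝ → ℝ}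
    (hv : ∀ θ, HasDerivAt v (v' θ) θ) (hv' : Continuous v') (hk : ∀ θ, HasDerivAt k (k' θ) θ)
    (hk' : Continuous k') (hvper : v (2 * π) = v 0) (hkper : k (2 * π) = k 0)
    (hk1 : ∀ θ, |k θ| ≤ 1) {b N c γ : ℝ} (hb : 0 ≤ b) (hb' : 4 * b ≤ 2)
    (hN : 0 < N) (hc0 : 0 < c) (hγ : 0 ≤ γ) (hγ1 : γ ≤ 1) (s : Finset ℕ) (t : ℝ) :
    sqNormL4 s (fun n => (n : ℝ) ^ (4 * b)) (densityCoeff fun θ =>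
      Real.exp (v θ) * (Real.exp (γ * t * k θ - γ ^ 2 / 2 * k θ ^ 2) - 1)) ≤
    Real.exp (4 * |t| + 4) * ∫ θ in (0 : ℝ)..2 * π,
      Real.exp (v θ) ^ 2 * (Real.exp (v' θ / N) + Real.exp (-(v' θ / N))) *
        (c / 2 * (∫ θ in (0 : ℝ)..2 * π, |k θ|) * |k θ| +
          (2 * c)⁻¹ * (N ^ (4 * b) * (6 * π)) * (k θ ^ 2 + k' θ ^ 2 / N ^ 2)) := by
  set C : ℝ := Real.exp (2 * |t| + 2) with hC
  have hC0 : 0 < C := Real.exp_pos _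
  set I : ℝ := ∫ θ in (0 : ℝ)..2 * π, |k θ| with hI
  have hI0 : 0 ≤ I := intervalIntegral.integral_nonneg Real.two_pi_pos.le fun θ _ => abs_nonneg _
  have hvc : Continuous v := continuous_iff_continuousAt.2 fun θ => (hv θ).continuousAt
  have hkc : Continuous k := continuous_iff_continuousAt.2 fun θ => (hk θ).continuousAt
  set p : ℝ → ℝ := fun θ => Real.exp (γ * t * k θ - γ ^ 2 / 2 * k θ ^ 2) - 1 with hp
  set q : ℝ → ℝ := fun θ => (γ * t * k' θ - γ ^ 2 / 2 * (2 * k θ * k' θ)) *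
    Real.exp (γ * t * k θ - γ ^ 2 / 2 * k θ ^ 2) with hq
  have hpd : ∀ θ, HasDerivAt p (q θ) θ := fun θ => by
    have h2 := ((hk θ).const_mul (γ * t)).sub (((hk θ).pow 2).const_mul (γ ^ 2 / 2))
    exact (h2.exp.sub_const 1).congr_deriv (by simp [hq]; ring)
  have hpm : ∀ θ, |p θ| ≤ C * |k θ| := fun θ =>
    abs_exp_gaussian_exponent_sub_one_le hγ hγ1 (hk1 θ) t
  have hqm : ∀ θ, |q θ| ≤ C * |k' θ| := fun θ =>
    abs_deriv_gaussian_exponent_mul_exp_le hγ hγ1 (hk1 θ) t (k' θ)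
  have hp0 : p (2 * π) = p 0 := by simp only [hp, hkper]
  have hpc : Continuous p := by fun_prop
  have hqc : Continuous q := by fun_prop
  set f : ℝ → ℝ := fun θ => Real.exp (v θ) with hf
  have hf0 : ∀ θ, 0 < f θ := fun θ => Real.exp_pos _
  have hfc : Continuous f := by fun_prop
  have hd : ∀ θ, HasDerivAt (fun θ => f θ * p θ) (f θ * (v' θ * p θ + q θ)) θ := fun θ =>
    ((hv θ).exp.mul (hpd θ)).congr_deriv (by simp only [hf]; ring)
  have hfper : f (2 * π) * p (2 * π) = f 0 * p 0 := by simp only [hf, hp0, hvper]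
  set E : ℝ → ℝ := fun θ => Real.exp (v' θ / N) + Real.exp (-(v' θ / N)) with hE
  -- The Sobolev norm produces the square of the logarithmic derivative v'/N. It is replaced by
  -- exponentials of ± v'/N, because the Gaussian expectation of exp(2v ± v'/N) is explicit.
  have hE2 : ∀ θ, 2 + (v' θ / N) ^ 2 ≤ E θ := fun θ => two_add_sq_le_exp_add_exp_neg _
  have hEc : Continuous E := by fun_prop
  change sqNormL4 s (fun n => (n : ℝ) ^ (4 * b)) (densityCoeff fun θ => f θ * p θ) ≤
    Real.exp (4 * |t| + 4) * ∫ θ in (0 : ℝ)..2 * π, f θ ^ 2 * E θ *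
      (c / 2 * I * |k θ| + (2 * c)⁻¹ * (N ^ (4 * b) * (6 * π)) * (k θ ^ 2 + k' θ ^ 2 / N ^ 2))
  clear_value p q f E
  have key := sqNormL4_densityCoeff_le hd (by fun_prop) hfper hb hb' hN hc0 s
  have hC2 : Real.exp (4 * |t| + 4) = C ^ 2 := by
    rw [hC, ← Real.exp_nat_mul]; congr 1; push_cast; ring
  rw [hC2]
  clear_value C I
  refine key.trans ?_
  -- Cauchy–Schwarz for the measure |k| dθ bounds the square of the `L¹` norm by (∫ |k|)(∫ |k| f²).
  -- One factor keeps the smallness of ∫ |k|, and the other is linear in f², so that second moments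
  -- of f suffice.
  have h1 : (∫ θ in (0 : ℝ)..2 * π, |f θ * p θ|) ^ 2 ≤
      C ^ 2 * (I * ∫ θ in (0 : ℝ)..2 * π, |k θ| * f θ ^ 2) := by
    have h2 : ∫ θ in (0 : ℝ)..2 * π, |f θ * p θ| ≤ C * ∫ θ in (0 : ℝ)..2 * π, |k θ| * f θ := by
      rw [← intervalIntegral.integral_const_mul]
      refine intervalIntegral.integral_mono_on Real.two_pi_pos.le
        (Continuous.intervalIntegrable (by fun_prop) _ _)
        (Continuous.intervalIntegrable (by fun_prop) _ _) fun θ _ => ?_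
      rw [abs_mul, abs_of_pos (hf0 θ)]
      nlinarith [hpm θ, hf0 θ]
    have h3 := sq_intervalIntegral_mul_le (p := fun θ => |k θ|) (q := f)
      (by fun_prop) hfc (fun θ => abs_nonneg _) Real.two_pi_pos.le
    calc _ ≤ (C * ∫ θ in (0 : ℝ)..2 * π, |k θ| * f θ) ^ 2 :=
          pow_le_pow_left₀ (intervalIntegral.integral_nonneg Real.two_pi_pos.le
            fun θ _ => abs_nonneg _) h2 2
      _ ≤ _ := by rw [mul_pow, hI]; exact mul_le_mul_of_nonneg_left h3 (sq_nonneg _)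
  have h1' : ∫ θ in (0 : ℝ)..2 * π, |k θ| * f θ ^ 2 ≤
      ∫ θ in (0 : ℝ)..2 * π, f θ ^ 2 * E θ * |k θ| := by
    refine intervalIntegral.integral_mono_on Real.two_pi_pos.le
        (Continuous.intervalIntegrable (by fun_prop) _ _)
        (Continuous.intervalIntegrable (by fun_prop) _ _) fun θ _ => ?_
    have h4 : 0 ≤ |k θ| * f θ ^ 2 := by positivity
    nlinarith [hE2 θ, sq_nonneg (v' θ / N)]
  have h5 : ∫ θ in (0 : ℝ)..2 * π, ((f θ * p θ) ^ 2 +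
      (f θ * (v' θ * p θ + q θ)) ^ 2 / N ^ 2) ≤
      C ^ 2 * (3 * ∫ θ in (0 : ℝ)..2 * π, f θ ^ 2 * E θ * (k θ ^ 2 + k' θ ^ 2 / N ^ 2)) := by
    rw [← intervalIntegral.integral_const_mul, ← intervalIntegral.integral_const_mul]
    refine intervalIntegral.integral_mono_on Real.two_pi_pos.le
        (Continuous.intervalIntegrable (by fun_prop) _ _)
        (Continuous.intervalIntegrable (by fun_prop) _ _) fun θ _ => ?_
    have e1 : (f θ * p θ) ^ 2 + (f θ * (v' θ * p θ + q θ)) ^ 2 / N ^ 2 =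
        f θ ^ 2 * (p θ ^ 2 + (v' θ / N * p θ + q θ / N) ^ 2) := by field_simp
    rw [e1]
    refine (mul_le_mul_of_nonneg_left (sq_add_sq_le_of_abs_le (hpm θ) (hqm θ) (hE2 θ))
      (sq_nonneg (f θ))).trans (le_of_eq (by ring))
  have hNb : 0 ≤ N ^ (4 * b) := by positivity
  calc _ ≤ c / 2 * (C ^ 2 * (I * ∫ θ in (0 : ℝ)..2 * π, f θ ^ 2 * E θ * |k θ|)) +
        (2 * c)⁻¹ * (N ^ (4 * b) * (2 * π * (C ^ 2 * (3 * ∫ θ in (0 : ℝ)..2 * π,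
        f θ ^ 2 * E θ * (k θ ^ 2 + k' θ ^ 2 / N ^ 2))))) := by
        refine add_le_add (mul_le_mul_of_nonneg_left (h1.trans ?_) (by positivity))
          (mul_le_mul_of_nonneg_left (mul_le_mul_of_nonneg_left
            (mul_le_mul_of_nonneg_left h5 Real.two_pi_pos.le) hNb) (by positivity))
        exact mul_le_mul_of_nonneg_left (mul_le_mul_of_nonneg_left h1' hI0) (sq_nonneg _)
    _ = C ^ 2 * ((c / 2 * I) * (∫ θ in (0 : ℝ)..2 * π, f θ ^ 2 * E θ * |k θ|) +
        ((2 * c)⁻¹ * (N ^ (4 * b) * (6 * π))) * ∫ θ in (0 : ℝ)..2 * π,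
        f θ ^ 2 * E θ * (k θ ^ 2 + k' θ ^ 2 / N ^ 2)) := by ring
    _ = _ := by
        rw [← intervalIntegral.integral_const_mul, ← intervalIntegral.integral_const_mul,
          ← intervalIntegral.integral_add (Continuous.intervalIntegrable (by fun_prop) _ _)
          (Continuous.intervalIntegrable (by fun_prop) _ _)]
        congr 1
        refine intervalIntegral.integral_congr fun θ _ => ?_
        ring

/-! ### The frame of translated trigonometric polynomials. -/

lemma sum_cos_sub_eq_zero {N : ℕ} (hN : 0 < N) {m : ℤ} (hm : ¬ (N : ℤ) ∣ m) (a : ℝ) :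
    ∑ i ∈ Finset.Ico N (2 * N), Real.cos (a - m * (2 * π * i / N)) = 0 := by
  have hN' : (N : ℂ) ≠ 0 := by exact_mod_cast hN.ne'
  set z : ℂ := Complex.exp (-(2 * π * Complex.I * (m / N))) with hz
  have hzN : z ^ N = 1 := by
    rw [hz, ← Complex.exp_nat_mul, Complex.exp_eq_one_iff]
    exact ⟨-m, by push_cast; field_simp⟩
  have hz1 : z ≠ 1 := by
    intro h
    obtain ⟨n, hn⟩ := Complex.exp_eq_one_iff.1 h
    apply hm
    have hpi : (2 * π * Complex.I : ℂ) ≠ 0 := Complex.two_pi_I_ne_zero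
    have h2 : (2 * π * Complex.I : ℂ) * (-(m / N)) = (2 * π * Complex.I) * n := by
      rw [mul_neg, hn]; ring
    have h3 := mul_left_cancel₀ hpi h2
    refine ⟨-n, ?_⟩
    have h4 : (m : ℂ) = N * -n := by rw [← h3]; field_simp
    exact_mod_cast h4
  have hsum : ∑ i ∈ Finset.Ico N (2 * N), z ^ i = 0 := by
    rw [geom_sum_Ico hz1 (by omega), mul_comm 2 N, pow_mul, hzN]
    simp
  have hre : ∀ i : ℕ, Real.cos (a - m * (2 * π * i / N)) =
      (Complex.exp (a * Complex.I) * z ^ i).re := fun i => by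
    rw [hz, ← Complex.exp_nat_mul, ← Complex.exp_add, ← Complex.exp_ofReal_mul_I_re]
    congr 2
    push_cast
    field_simp
    ring
  rw [Finset.sum_congr rfl fun i _ => hre i, ← Complex.re_sum, ← Finset.mul_sum, hsum]
  simp

/-- The product formula leaves the frequencies k − l and k + l. The condition k + l < N prevents
aliasing: k + l is never a multiple of N, and k − l only if it vanishes. -/
lemma sum_cos_mul_cos_eq {N k l : ℕ} (hk : 0 < k) (hl : 0 < l) (hkl : k + l < N) (a b : ℝ) :
    ∑ i ∈ Finset.Ico N (2 * N), Real.cos (a - k * (2 * π * i / N)) *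
      Real.cos (b - l * (2 * π * i / N)) = if k = l then N / 2 * Real.cos (a - b) else 0 := by
  have hN : 0 < N := by omega
  have hprod : ∀ i : ℕ, Real.cos (a - k * (2 * π * i / N)) * Real.cos (b - l * (2 * π * i / N)) =
      1 / 2 * Real.cos (a - b - ((k : ℤ) - l : ℤ) * (2 * π * i / N)) +
      1 / 2 * Real.cos (a + b - ((k : ℤ) + l : ℤ) * (2 * π * i / N)) := fun i => by
    have h := Real.two_mul_cos_mul_cos (a - k * (2 * π * i / N)) (b - l * (2 * π * i / N))
    rw [show a - k * (2 * π * i / N) - (b - l * (2 * π * i / N)) =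
      a - b - ((k : ℤ) - l : ℤ) * (2 * π * i / N) by push_cast; ring,
      show a - k * (2 * π * i / N) + (b - l * (2 * π * i / N)) =
      a + b - ((k : ℤ) + l : ℤ) * (2 * π * i / N) by push_cast; ring] at h
    linarith
  rw [Finset.sum_congr rfl fun i _ => hprod i, Finset.sum_add_distrib, ← Finset.mul_sum,
    ← Finset.mul_sum, sum_cos_sub_eq_zero hN (m := (k : ℤ) + l)]
  · split_ifs with h
    · subst h
      simp
      rw [two_mul, Nat.add_sub_cancel]
      ring
    · rw [sum_cos_sub_eq_zero hN]
      · simp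
      · intro hd
        have := Int.eq_zero_of_abs_lt_dvd hd (by rw [abs_lt]; constructor <;> omega)
        omega
  · intro hd
    have := Int.le_of_dvd (by omega) hd
    omega

/-- The dyadic frequency band at the scale `2 ^ J`. -/
def band (J : ℕ) : Finset ℕ := Finset.Ico (2 ^ J / 4) (2 ^ J / 2)

/-- The `i`-th element of the frame of trigonometric polynomials at the scale `2 ^ J`: the
translate by `2π i / 2 ^ J` of a polynomial with coefficients `b` in the frequency band. -/
noncomputable def frameFun (b : ℕ → ℝ) (φ : ℝ) (J i : ℕ) (θ : ℝ) : ℝ :=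
  √(2 / 2 ^ J) * ∑ k ∈ band J, b k * Real.cos (k * (θ - 2 * π * i / 2 ^ J) + φ)

/-- Sampling at 2^J equally spaced translates diagonalizes the double sum over frequencies, because
the whole band lies below 2^J/2. The normalization √(2/2^J) compensates the factor N/2 of discrete
orthogonality. Free phases and coefficients let the same identity serve for the field, its
derivative and single modes. -/
lemma sum_frameFun_mul_frameFun {b c : ℕ → ℝ} (hb : b 0 = 0) (hc : c 0 = 0) (φ ψ : ℝ) (J : ℕ)
    (x y : ℝ) :
    ∑ i ∈ Finset.Ico (2 ^ J) (2 ^ (J + 1)), frameFun b φ J i x * frameFun c ψ J i y =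
      ∑ k ∈ band J, b k * c k * Real.cos (k * (x - y) + (φ - ψ)) := by
  have h1 : ∀ i : ℕ, frameFun b φ J i x * frameFun c ψ J i y = ∑ k ∈ band J, ∑ l ∈ band J,
      2 / 2 ^ J * (b k * c l) * (Real.cos ((k * x + φ) - k * (2 * π * i / (2 ^ J : ℕ))) *
        Real.cos ((l * y + ψ) - l * (2 * π * i / (2 ^ J : ℕ)))) := fun i => by
    have hs : √(2 / 2 ^ J : ℝ) * √(2 / 2 ^ J) = 2 / 2 ^ J := Real.mul_self_sqrt (by positivity)
    unfold frameFun
    rw [mul_mul_mul_comm, hs, Finset.sum_mul_sum, Finset.mul_sum]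
    refine Finset.sum_congr rfl fun k _ => ?_
    rw [Finset.mul_sum]
    refine Finset.sum_congr rfl fun l _ => ?_
    rw [show (k : ℝ) * (x - 2 * π * i / 2 ^ J) + φ =
      (k * x + φ) - k * (2 * π * i / (2 ^ J : ℕ)) by push_cast; ring,
      show (l : ℝ) * (y - 2 * π * i / 2 ^ J) + ψ =
      (l * y + ψ) - l * (2 * π * i / (2 ^ J : ℕ)) by push_cast; ring]
    ring
  rw [Finset.sum_congr rfl fun i _ => h1 i, Finset.sum_comm]
  refine Finset.sum_congr rfl fun k hk => ?_
  rw [Finset.sum_comm]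
  have h2 : ∀ l ∈ band J, ∑ i ∈ Finset.Ico (2 ^ J : ℕ) (2 ^ (J + 1)),
      2 / 2 ^ J * (b k * c l) * (Real.cos ((k * x + φ) - k * (2 * π * i / (2 ^ J : ℕ))) *
        Real.cos ((l * y + ψ) - l * (2 * π * i / (2 ^ J : ℕ)))) =
      if k = l then b k * c k * Real.cos (k * (x - y) + (φ - ψ)) else 0 := fun l hl => by
    rcases Nat.eq_zero_or_pos k with rfl | hk0
    · simp [hb]
    rcases Nat.eq_zero_or_pos l with rfl | hl0
    · simp [hc, hk0.ne']
    rw [← Finset.mul_sum, pow_succ, mul_comm (2 ^ J) 2, sum_cos_mul_cos_eq hk0 hl0]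
    · split_ifs with h
      · subst h
        push_cast
        rw [show (k : ℝ) * x + φ - (k * y + ψ) = k * (x - y) + (φ - ψ) by ring]
        field_simp
      · simp
    · simp only [band, Finset.mem_Ico] at hk hl
      omega
  rw [Finset.sum_congr rfl h2, Finset.sum_ite_eq, if_pos hk]

lemma sum_frameFun_sq {b : ℕ → ℝ} (hb : b 0 = 0) (φ : ℝ) (J : ℕ) (x : ℝ) :
    ∑ i ∈ Finset.Ico (2 ^ J) (2 ^ (J + 1)), frameFun b φ J i x ^ 2 = ∑ k ∈ band J, b k ^ 2 := by
  simpa [sq] using sum_frameFun_mul_frameFun hb hb φ φ J x x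

/-- The coefficients of the field in its band decomposition. -/
noncomputable def fieldCoeff (σ : ℕ → ℝ) (k : ℕ) : ℝ := σ k * (√k)⁻¹

/-- The coefficients of the derivative of the field in its band decomposition. -/
noncomputable def derivCoeff (σ : ℕ → ℝ) (k : ℕ) : ℝ := σ k * √k

lemma fieldCoeff_zero (σ : ℕ → ℝ) : fieldCoeff σ 0 = 0 := by simp [fieldCoeff]

lemma derivCoeff_zero (σ : ℕ → ℝ) : derivCoeff σ 0 = 0 := by simp [derivCoeff]

/-- The directions `k_i` of the Gaussian field `∑ g_i k_i`. -/
noncomputable def dir (σ : ℕ → ℝ) (i : ℕ) : ℝ → ℝ := frameFun (fieldCoeff σ) 0 (Nat.log 2 i) i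

/-- The derivatives of the directions. -/
noncomputable def dirDeriv (σ : ℕ → ℝ) (i : ℕ) : ℝ → ℝ :=
  frameFun (derivCoeff σ) (π / 2) (Nat.log 2 i) i

lemma hasDerivAt_dir (σ : ℕ → ℝ) (i : ℕ) (θ : ℝ) :
    HasDerivAt (dir σ i) (dirDeriv σ i θ) θ := by
  unfold dir dirDeriv frameFun
  refine HasDerivAt.const_mul _ (HasDerivAt.fun_sum fun k _ => ?_)
  have h1 : HasDerivAt (fun θ : ℝ => (k : ℝ) * (θ - 2 * π * i / 2 ^ Nat.log 2 i) + 0) (k : ℝ) θ := by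
    simpa using (((hasDerivAt_id θ).sub_const _).const_mul (k : ℝ)).add_const (0 : ℝ)
  refine (h1.cos.const_mul (fieldCoeff σ k)).congr_deriv ?_
  rw [Real.cos_add_pi_div_two, add_zero, fieldCoeff, derivCoeff]
  rcases Nat.eq_zero_or_pos k with rfl | hk
  · simp
  have hk' : (0 : ℝ) < k := by exact_mod_cast hk
  have hs := Real.mul_self_sqrt hk'.le
  have hs0 : √(k : ℝ) ≠ 0 := (Real.sqrt_pos.2 hk').ne'
  field_simp
  rw [sq, hs]

lemma continuous_frameFun (b : ℕ → ℝ) (φ : ℝ) (J i : ℕ) : Continuous (frameFun b φ J i) := by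
  unfold frameFun
  fun_prop

lemma continuous_dir (σ : ℕ → ℝ) (i : ℕ) : Continuous (dir σ i) := continuous_frameFun _ _ _ _

lemma continuous_dirDeriv (σ : ℕ → ℝ) (i : ℕ) : Continuous (dirDeriv σ i) :=
  continuous_frameFun _ _ _ _

lemma frameFun_periodic (b : ℕ → ℝ) (φ : ℝ) (J i : ℕ) :
    Function.Periodic (frameFun b φ J i) (2 * π) := fun θ => by
  unfold frameFun
  congr 1
  refine Finset.sum_congr rfl fun k _ => ?_
  rw [show (k : ℝ) * (θ + 2 * π - 2 * π * i / 2 ^ J) + φ =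
    (k * (θ - 2 * π * i / 2 ^ J) + φ) + k * (2 * π) by ring, Real.cos_add_nat_mul_two_pi]

lemma le_of_mem_band {J k : ℕ} (hJ : 2 ≤ J) (hk : k ∈ band J) :
    (2 : ℝ) ^ J / 4 ≤ k ∧ (k : ℝ) ≤ 2 ^ J / 2 ∧ 0 < k := by
  obtain ⟨J, rfl⟩ := Nat.exists_eq_add_of_le' hJ
  simp only [band, Finset.mem_Ico, pow_add] at hk
  norm_num at hk
  have h1 : 0 < 2 ^ J := by positivity
  have h2 : 2 ^ J ≤ k := by omega
  have h3 : k ≤ 2 ^ J * 2 := by omega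
  refine ⟨?_, ?_, by omega⟩
  · rw [pow_add]; norm_num; exact_mod_cast h2
  · rw [pow_add]; norm_num
    have : (k : ℝ) ≤ 2 ^ J * 2 := by exact_mod_cast h3
    linarith

lemma card_band {J : ℕ} (hJ : 2 ≤ J) : ((band J).card : ℝ) = 2 ^ J / 4 := by
  obtain ⟨J, rfl⟩ := Nat.exists_eq_add_of_le' hJ
  have h : (band (J + 2)).card = 2 ^ J := by
    simp only [band, Nat.card_Ico, pow_add]; norm_num; omega
  rw [h, pow_add]; push_cast; norm_num

lemma band_zero : band 0 = ∅ := by decide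

lemma band_one : band 1 = {0} := by decide

/-- The scales 0 and 1 are empty or contain only the frequency 0, where the coefficient vanishes;
the estimates can therefore assume J ≥ 2. -/
lemma frameFun_eq_zero_of_lt {b : ℕ → ℝ} (hb : b 0 = 0) (φ : ℝ) {J : ℕ} (hJ : J < 2) (i : ℕ)
    (θ : ℝ) : frameFun b φ J i θ = 0 := by
  interval_cases J <;> simp [frameFun, band_zero, band_one, hb]

variable {σ : ℕ → ℝ}

lemma sum_band_inv_le {J : ℕ} (hJ : 2 ≤ J) : ∑ k ∈ band J, ((k : ℝ))⁻¹ ≤ 1 := by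
  calc ∑ k ∈ band J, ((k : ℝ))⁻¹ ≤ ∑ _k ∈ band J, (2 ^ J / 4 : ℝ)⁻¹ := by
        refine Finset.sum_le_sum fun k hk => ?_
        exact inv_anti₀ (by positivity) (le_of_mem_band hJ hk).1
    _ = 1 := by
        rw [Finset.sum_const, nsmul_eq_mul, card_band hJ]
        field_simp

lemma fieldCoeff_sq_le (hσ : ∀ k, |σ k| ≤ 1) (k : ℕ) : fieldCoeff σ k ^ 2 ≤ (k : ℝ)⁻¹ := by
  rw [fieldCoeff, mul_pow, inv_pow, Real.sq_sqrt (by positivity)]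
  have : σ k ^ 2 ≤ 1 := (sq_le_one_iff_abs_le_one _).2 (hσ k)
  exact mul_le_of_le_one_left (by positivity) this

lemma derivCoeff_sq_le (hσ : ∀ k, |σ k| ≤ 1) (k : ℕ) : derivCoeff σ k ^ 2 ≤ k := by
  rw [derivCoeff, mul_pow, Real.sq_sqrt (by positivity)]
  have : σ k ^ 2 ≤ 1 := (sq_le_one_iff_abs_le_one _).2 (hσ k)
  exact mul_le_of_le_one_left (by positivity) this

lemma log_eq_of_mem_Ico {J i : ℕ} (hi : i ∈ Finset.Ico (2 ^ J) (2 ^ (J + 1))) :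
    Nat.log 2 i = J := by
  rw [Finset.mem_Ico] at hi
  exact Nat.log_eq_of_pow_le_of_lt_pow hi.1 hi.2

lemma sum_Ico_dir_mul_dir (J : ℕ) (x y : ℝ) :
    ∑ i ∈ Finset.Ico (2 ^ J) (2 ^ (J + 1)), dir σ i x * dir σ i y =
      ∑ k ∈ band J, fieldCoeff σ k ^ 2 * Real.cos (k * (x - y)) := by
  have h := sum_frameFun_mul_frameFun (fieldCoeff_zero σ) (fieldCoeff_zero σ) 0 0 J x y
  simp only [sub_self, add_zero, ← sq] at h
  rw [← h]
  refine Finset.sum_congr rfl fun i hi => ?_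
  rw [dir, log_eq_of_mem_Ico hi]

lemma dir_zero (θ : ℝ) : dir σ 0 θ = 0 := by
  rw [dir]; exact frameFun_eq_zero_of_lt (fieldCoeff_zero σ) _ (by simp) _ _

lemma dirDeriv_zero (θ : ℝ) : dirDeriv σ 0 θ = 0 := by
  rw [dirDeriv]; exact frameFun_eq_zero_of_lt (derivCoeff_zero σ) _ (by simp) _ _

/-- The bands are consecutive, as 2^(J+1)/4 = 2^J/2, so the scales up to J exhaust exactly the
frequencies below 2^J/2. -/
lemma sum_range_two_pow_eq (F : ℕ → ℝ) (G : ℕ → ℝ) (h0 : F 0 = 0)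
    (h : ∀ J, ∑ i ∈ Finset.Ico (2 ^ J) (2 ^ (J + 1)), F i = ∑ k ∈ band J, G k) (J : ℕ) :
    ∑ i ∈ Finset.range (2 ^ (J + 1)), F i = ∑ k ∈ Finset.range (2 ^ J / 2), G k := by
  induction J with
  | zero =>
    have := h 0
    simp only [band_zero, Finset.sum_empty] at this
    rw [Finset.range_eq_Ico, ← Finset.sum_Ico_consecutive F (Nat.zero_le (2 ^ 0))
      (by norm_num : 2 ^ 0 ≤ 2 ^ (0 + 1)), this]
    simp [h0]
  | succ J ih =>
    rw [Finset.range_eq_Ico, ← Finset.sum_Ico_consecutive F (Nat.zero_le (2 ^ (J + 1)))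
      (Nat.pow_le_pow_right (by norm_num) (by omega)), ← Finset.range_eq_Ico, ih, h (J + 1), band,
      Finset.range_eq_Ico, Finset.range_eq_Ico]
    have h4 : 2 ^ (J + 1) / 4 = 2 ^ J / 2 := by rw [pow_succ]; omega
    rw [h4]
    exact Finset.sum_Ico_consecutive G (Nat.zero_le _)
      (Nat.div_le_div_right (Nat.pow_le_pow_right (by norm_num) (by omega)))

/-- The covariance of the field built from all scales up to `2 ^ J`. -/
lemma sum_range_dir_mul_dir (J : ℕ) (x y : ℝ) :
    ∑ i ∈ Finset.range (2 ^ (J + 1)), dir σ i x * dir σ i y =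
      ∑ k ∈ Finset.range (2 ^ J / 2), fieldCoeff σ k ^ 2 * Real.cos (k * (x - y)) :=
  sum_range_two_pow_eq _ _ (by simp [dir_zero]) (fun J => sum_Ico_dir_mul_dir J x y) J

lemma sum_Ico_dir_sq (J : ℕ) (x : ℝ) :
    ∑ i ∈ Finset.Ico (2 ^ J) (2 ^ (J + 1)), dir σ i x ^ 2 =
      ∑ k ∈ band J, fieldCoeff σ k ^ 2 := by
  simpa [sq] using sum_Ico_dir_mul_dir (σ := σ) J x x

lemma sum_Ico_dirDeriv_sq (J : ℕ) (x : ℝ) :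
    ∑ i ∈ Finset.Ico (2 ^ J) (2 ^ (J + 1)), dirDeriv σ i x ^ 2 =
      ∑ k ∈ band J, derivCoeff σ k ^ 2 := by
  rw [← sum_frameFun_sq (derivCoeff_zero σ) (π / 2) J x]
  refine Finset.sum_congr rfl fun i hi => ?_
  rw [dirDeriv, log_eq_of_mem_Ico hi]

lemma sum_Ico_dir_sq_le (hσ : ∀ k, |σ k| ≤ 1) {J : ℕ} (hJ : 2 ≤ J) (x : ℝ) :
    ∑ i ∈ Finset.Ico (2 ^ J) (2 ^ (J + 1)), dir σ i x ^ 2 ≤ 1 := by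
  rw [sum_Ico_dir_sq]
  exact (Finset.sum_le_sum fun k _ => fieldCoeff_sq_le hσ k).trans (sum_band_inv_le hJ)

lemma sum_Ico_dirDeriv_sq_le (hσ : ∀ k, |σ k| ≤ 1) {J : ℕ} (hJ : 2 ≤ J) (x : ℝ) :
    ∑ i ∈ Finset.Ico (2 ^ J) (2 ^ (J + 1)), dirDeriv σ i x ^ 2 ≤ (2 ^ J) ^ 2 := by
  rw [sum_Ico_dirDeriv_sq]
  calc ∑ k ∈ band J, derivCoeff σ k ^ 2 ≤ ∑ _k ∈ band J, (2 ^ J / 2 : ℝ) :=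
        Finset.sum_le_sum fun k hk => (derivCoeff_sq_le hσ k).trans (le_of_mem_band hJ hk).2.1
    _ ≤ _ := by
        rw [Finset.sum_const, nsmul_eq_mul, card_band hJ]
        nlinarith [sq_nonneg ((2 : ℝ) ^ J)]

/-- The variance is dominated by a harmonic sum. The coefficient 1 of the logarithm is what makes
the second moment of the density of order N^{γ²}. -/
lemma sum_range_dir_sq_le (hσ : ∀ k, |σ k| ≤ 1) {J l : ℕ} (hl : l ≤ 2 ^ (J + 1)) (x : ℝ) :
    ∑ i ∈ Finset.range l, dir σ i x ^ 2 ≤ 1 + Real.log (2 ^ J) := by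
  calc ∑ i ∈ Finset.range l, dir σ i x ^ 2 ≤ ∑ i ∈ Finset.range (2 ^ (J + 1)), dir σ i x ^ 2 :=
        Finset.sum_le_sum_of_subset_of_nonneg (Finset.range_mono hl) fun _ _ _ => sq_nonneg _
    _ = ∑ k ∈ Finset.range (2 ^ J / 2), fieldCoeff σ k ^ 2 :=
        sum_range_two_pow_eq _ _ (by simp [dir_zero]) (fun J => sum_Ico_dir_sq J x) J
    _ ≤ ∑ k ∈ Finset.range (2 ^ J + 1), ((k : ℝ))⁻¹ := by
        refine (Finset.sum_le_sum fun k _ => fieldCoeff_sq_le hσ k).trans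
          (Finset.sum_le_sum_of_subset_of_nonneg (Finset.range_mono (by omega))
            fun _ _ _ => by positivity)
    _ = (harmonic (2 ^ J) : ℝ) := by
        rw [Finset.sum_range_succ', harmonic]
        push_cast
        simp
    _ ≤ _ := by
        have := harmonic_le_one_add_log (2 ^ J)
        push_cast at this
        exact this

lemma sum_range_dirDeriv_sq_le (hσ : ∀ k, |σ k| ≤ 1) {J l : ℕ} (hl : l ≤ 2 ^ (J + 1)) (x : ℝ) :
    ∑ i ∈ Finset.range l, dirDeriv σ i x ^ 2 ≤ (2 ^ J) ^ 2 := by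
  calc ∑ i ∈ Finset.range l, dirDeriv σ i x ^ 2
      ≤ ∑ i ∈ Finset.range (2 ^ (J + 1)), dirDeriv σ i x ^ 2 :=
        Finset.sum_le_sum_of_subset_of_nonneg (Finset.range_mono hl) fun _ _ _ => sq_nonneg _
    _ = ∑ k ∈ Finset.range (2 ^ J / 2), derivCoeff σ k ^ 2 :=
        sum_range_two_pow_eq _ _ (by simp [dirDeriv_zero]) (fun J => sum_Ico_dirDeriv_sq J x) J
    _ ≤ ∑ _k ∈ Finset.range (2 ^ J / 2), (2 ^ J : ℝ) := by
        refine Finset.sum_le_sum fun k hk => (derivCoeff_sq_le hσ k).trans ?_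
        have : k ≤ 2 ^ J := by have := Finset.mem_range.1 hk; omega
        exact_mod_cast this
    _ ≤ _ := by
        rw [Finset.sum_const, Finset.card_range, nsmul_eq_mul, sq]
        have : 2 ^ J / 2 ≤ 2 ^ J := by omega
        gcongr
        exact_mod_cast this

/-- A single square is at most the sum of squares over its scale. -/
lemma abs_dir_le_one (hσ : ∀ k, |σ k| ≤ 1) (i : ℕ) (θ : ℝ) : |dir σ i θ| ≤ 1 := by
  set J := Nat.log 2 i with hJ
  rcases lt_or_ge J 2 with h | h
  · rw [dir, frameFun_eq_zero_of_lt (fieldCoeff_zero σ) _ h]; simp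
  · have hi : i ≠ 0 := by rintro rfl; simp at hJ; omega
    have hmem : i ∈ Finset.Ico (2 ^ J) (2 ^ (J + 1)) := by
      rw [Finset.mem_Ico]
      exact ⟨Nat.pow_log_le_self 2 hi, Nat.lt_pow_succ_log_self (by norm_num) i⟩
    have h1 := (Finset.single_le_sum (f := fun i => dir σ i θ ^ 2) (fun _ _ => sq_nonneg _)
      hmem).trans (sum_Ico_dir_sq_le hσ h θ)
    exact (sq_le_one_iff_abs_le_one _).1 h1

/-! ### Localization of the directions in `L¹`. -/

/-- Summation by parts for a power series with nonincreasing coefficients on the unit circle. -/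
lemma norm_one_sub_mul_sum_Ico_le {b : ℕ → ℝ} {A : ℕ} (hb0 : ∀ k, 0 ≤ b k)
    (hb : ∀ k, A ≤ k → b (k + 1) ≤ b k) {z : ℂ} (hz : ‖z‖ = 1) {B : ℕ} (hAB : A ≤ B) :
    ‖(1 - z) * ∑ k ∈ Finset.Ico A B, (b k : ℂ) * z ^ k‖ ≤ 2 * b A := by
  -- With the boundary term b_B z^B included, one more summand changes the expression only by (b_B −
  -- b_{B+1}) z^{B+1}, so the bound telescopes.
  have h1 : ‖(1 - z) * ∑ k ∈ Finset.Ico A B, (b k : ℂ) * z ^ k + b B * z ^ B‖ ≤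
      2 * b A - b B := by
    induction B, hAB using Nat.le_induction with
    | base =>
      simp [hz, abs_of_nonneg (hb0 A)]
      linarith
    | succ B hB ih =>
      rw [Finset.sum_Ico_succ_top hB]
      have e : (1 - z) * (∑ k ∈ Finset.Ico A B, (b k : ℂ) * z ^ k + b B * z ^ B) +
          (b (B + 1) : ℂ) * z ^ (B + 1) =
          ((1 - z) * ∑ k ∈ Finset.Ico A B, (b k : ℂ) * z ^ k + b B * z ^ B) -
          ((b B - b (B + 1) : ℝ) : ℂ) * z ^ (B + 1) := by push_cast; ring
      rw [e]
      refine (norm_sub_le _ _).trans ?_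
      rw [norm_mul, norm_pow, hz, one_pow, mul_one, Complex.norm_real, Real.norm_eq_abs,
        abs_of_nonneg (sub_nonneg.2 (hb B hB))]
      linarith
  have h2 : ‖(b B : ℂ) * z ^ B‖ = b B := by
    rw [norm_mul, norm_pow, hz, one_pow, mul_one, Complex.norm_real, Real.norm_eq_abs,
        abs_of_nonneg (hb0 B)]
  have h3 := norm_sub_le ((1 - z) * ∑ k ∈ Finset.Ico A B, (b k : ℂ) * z ^ k + b B * z ^ B)
    (b B * z ^ B)
  rw [add_sub_cancel_right] at h3
  linarith

/-- The profile at the scale `2 ^ J`, of which the directions are smoothed translates. -/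
noncomputable def profile (J : ℕ) (t : ℝ) : ℝ :=
  √(2 / 2 ^ J) * ∑ k ∈ band J, (√k)⁻¹ * Real.cos (k * t)

lemma norm_one_sub_exp_mul_I (t : ℝ) :
    ‖1 - Complex.exp (t * Complex.I)‖ = 2 * |Real.sin (t / 2)| := by
  have h1 : ‖1 - Complex.exp (t * Complex.I)‖ ^ 2 = (2 * |Real.sin (t / 2)|) ^ 2 := by
    rw [← Complex.normSq_eq_norm_sq, Complex.normSq_apply, mul_pow, sq_abs]
    simp only [Complex.sub_re, Complex.sub_im, Complex.one_re, Complex.one_im,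
      Complex.exp_ofReal_mul_I_re, Complex.exp_ofReal_mul_I_im]
    have h2 := Real.sin_sq_eq_half_sub (t / 2)
    rw [show 2 * (t / 2) = t by ring] at h2
    have h3 := Real.sin_sq_add_cos_sq t
    nlinarith
  exact (pow_left_inj₀ (norm_nonneg _) (by positivity) two_ne_zero).1 h1

/-- Summation by parts, divided by |1 − e^{it}| = 2 sin(t/2) ≥ 2t/π. The largest coefficient is
(2^J/4)^{−1/2}, and the resulting constant 2√2 π is below 9. -/
lemma abs_profile_le {J : ℕ} (hJ : 2 ≤ J) {t : ℝ} (ht : 0 < t) (htπ : t ≤ π) :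
    |profile J t| ≤ 9 / (2 ^ J * t) := by
  have hsin : t / π ≤ Real.sin (t / 2) := by
    have := Real.mul_le_sin (x := t / 2) (by positivity) (by linarith)
    refine le_trans (le_of_eq ?_) this
    field_simp
  have htp : 0 < t / π := by positivity
  set z := Complex.exp (t * Complex.I) with hz
  have hz1 : ‖z‖ = 1 := Complex.norm_exp_ofReal_mul_I t
  have hA : 0 < 2 ^ J / 4 := by
    obtain ⟨J, rfl⟩ := Nat.exists_eq_add_of_le' hJ
    have : 0 < 2 ^ J := by positivity
    rw [pow_add]; omega
  have hAr : ((2 ^ J / 4 : ℕ) : ℝ) = 2 ^ J / 4 := by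
    obtain ⟨J, rfl⟩ := Nat.exists_eq_add_of_le' hJ
    have : 2 ^ (J + 2) / 4 = 2 ^ J := by rw [pow_add]; omega
    rw [this, pow_add]; push_cast; norm_num
  have h1 := norm_one_sub_mul_sum_Ico_le (b := fun k => (√(k : ℝ))⁻¹) (A := 2 ^ J / 4)
    (B := 2 ^ J / 2) (fun k => by positivity) (fun k hk => by
      have : (0 : ℝ) < k := by exact_mod_cast hA.trans_le hk
      refine inv_anti₀ (Real.sqrt_pos.2 this) (Real.sqrt_le_sqrt ?_)
      push_cast; linarith) hz1 (by omega)
  rw [norm_mul, hz, norm_one_sub_exp_mul_I, ← hz] at h1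
  have hre : ∑ k ∈ band J, (√(k : ℝ))⁻¹ * Real.cos (k * t) =
      (∑ k ∈ Finset.Ico (2 ^ J / 4 : ℕ) (2 ^ J / 2), (((√(k : ℝ))⁻¹ : ℝ) : ℂ) * z ^ k).re := by
    rw [Complex.re_sum]
    refine Finset.sum_congr rfl fun k _ => ?_
    rw [Complex.re_ofReal_mul, hz, ← Complex.exp_nat_mul, ← Complex.exp_ofReal_mul_I_re]
    congr 3
    push_cast; ring
  set S := ∑ k ∈ Finset.Ico (2 ^ J / 4 : ℕ) (2 ^ J / 2), (((√(k : ℝ))⁻¹ : ℝ) : ℂ) * z ^ k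
  have h2 : |∑ k ∈ band J, (√(k : ℝ))⁻¹ * Real.cos (k * t)| ≤ ‖S‖ := by
    rw [hre]; exact Complex.abs_re_le_norm _
  rw [hAr] at h1
  have hN : (0 : ℝ) < 2 ^ J := by positivity
  have hsq : √((2 : ℝ) ^ J / 4) = √(2 ^ J) / 2 := by
    rw [Real.sqrt_div' _ (by norm_num), show (4 : ℝ) = 2 ^ 2 by norm_num,
      Real.sqrt_sq (by norm_num)]
  rw [hsq] at h1
  have h3 : ‖S‖ ≤ 2 * π / (√(2 ^ J) * t) := by
    have h4 : 2 * (t / π) * ‖S‖ ≤ 2 * (√(2 ^ J) / 2)⁻¹ := by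
      refine le_trans ?_ h1
      gcongr
      exact hsin.trans (le_abs_self _)
    rw [le_div_iff₀ (by positivity)]
    have hs : 0 < √((2 : ℝ) ^ J) := Real.sqrt_pos.2 hN
    have h5 : 2 * (t / π) * ‖S‖ * (√(2 ^ J) * π / 2) ≤
        2 * (√(2 ^ J) / 2)⁻¹ * (√(2 ^ J) * π / 2) := by gcongr
    have e1 : 2 * (t / π) * ‖S‖ * (√(2 ^ J) * π / 2) = ‖S‖ * (√(2 ^ J) * t) := by
      field_simp
    have e2 : 2 * (√((2 : ℝ) ^ J) / 2)⁻¹ * (√(2 ^ J) * π / 2) = 2 * π := by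
      field_simp
    rw [e1, e2] at h5
    exact h5
  have h6 : √((2 : ℝ) / 2 ^ J) = √2 / √(2 ^ J) := Real.sqrt_div (by norm_num) _
  rw [profile, abs_mul, abs_of_nonneg (Real.sqrt_nonneg _), h6]
  calc √2 / √(2 ^ J) * |∑ k ∈ band J, (√(k : ℝ))⁻¹ * Real.cos (k * t)|
      ≤ √2 / √(2 ^ J) * (2 * π / (√(2 ^ J) * t)) := by gcongr; exact h2.trans h3
    _ = 2 * √2 * π / (2 ^ J * t) := by
        have := Real.mul_self_sqrt hN.le
        field_simp
        rw [sq, this]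
    _ ≤ _ := by
        gcongr
        have h7 : √2 ≤ 1.4143 := by
          rw [Real.sqrt_le_left (by norm_num)]; norm_num
        nlinarith [Real.pi_lt_d2, Real.pi_pos]

lemma continuous_profile (J : ℕ) : Continuous (profile J) := by
  unfold profile; fun_prop

lemma profile_periodic (J : ℕ) : Function.Periodic (profile J) (2 * π) := fun θ => by
  unfold profile
  congr 1
  refine Finset.sum_congr rfl fun k _ => ?_
  rw [mul_add, Real.cos_add_nat_mul_two_pi]

lemma profile_neg (J : ℕ) (t : ℝ) : profile J (-t) = profile J t := by
  unfold profile
  simp only [mul_neg, Real.cos_neg]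

lemma dir_one_eq_profile (i : ℕ) (θ : ℝ) :
    dir (fun _ => 1) i θ = profile (Nat.log 2 i) (θ - 2 * π * i / 2 ^ Nat.log 2 i) := by
  simp [dir, frameFun, profile, fieldCoeff]

/-- The bound 9/(2^J t) is not integrable at 0. Since the profile is at most 1 in absolute value, it
is also at most the power 1 − δ of that bound, which is integrable at the price of N^δ and 1/δ. The
constant is 72 = 2 · 9 · 4: two half-periods, 9^{1−δ} ≤ 9 and π^δ ≤ 4. -/
lemma intervalIntegral_abs_profile_le {J i : ℕ} (hi : Nat.log 2 i = J) (hJ : 2 ≤ J) {δ : ℝ}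
    (hδ : 0 < δ) (hδ1 : δ ≤ 1) :
    ∫ t in (0 : ℝ)..2 * π, |profile J t| ≤ 72 / δ * (2 ^ J : ℝ) ^ (δ - 1) := by
  have hle1 : ∀ t, |profile J t| ≤ 1 := fun t => by
    have h := abs_dir_le_one (σ := fun _ => 1) (by simp) i (t + 2 * π * i / 2 ^ Nat.log 2 i)
    rwa [dir_one_eq_profile, add_sub_cancel_right, hi] at h
  have hc := continuous_profile J
  have h1 : ∫ t in (0 : ℝ)..2 * π, |profile J t| = 2 * ∫ t in (0 : ℝ)..π, |profile J t| := by
    rw [← intervalIntegral.integral_add_adjacent_intervals (b := π)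
      (Continuous.intervalIntegrable (by fun_prop) _ _)
      (Continuous.intervalIntegrable (by fun_prop) _ _)]
    have h2 : ∫ t in π..2 * π, |profile J t| = ∫ t in (0 : ℝ)..π, |profile J t| := by
      have h3 := intervalIntegral.integral_comp_sub_left (a := 0) (b := π)
        (fun t => |profile J t|) (2 * π)
      rw [sub_zero, show 2 * π - π = π by ring] at h3
      rw [← h3]
      refine intervalIntegral.integral_congr fun t _ => ?_
      rw [← profile_neg, show -(2 * π - t) = t - 2 * π by ring, (profile_periodic J).sub_eq]
    rw [h2]; ring
  have h4 : ∫ t in (0 : ℝ)..π, |profile J t| ≤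
      ∫ t in (0 : ℝ)..π, 9 * (2 ^ J : ℝ) ^ (δ - 1) * t ^ (δ - 1) := by
    refine intervalIntegral.integral_mono_on_of_le_Ioo Real.pi_pos.le
      (Continuous.intervalIntegrable (by fun_prop) _ _)
      ((intervalIntegral.intervalIntegrable_rpow' (by linarith)).const_mul _) fun t ht => ?_
    have hy : 0 ≤ |profile J t| := abs_nonneg _
    calc |profile J t| = |profile J t| ^ (1 : ℝ) := (Real.rpow_one _).symm
      _ ≤ |profile J t| ^ (1 - δ) := Real.rpow_le_rpow_of_exponent_ge_of_imp hy (hle1 t)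
          (by linarith) (by
            intro h0 hd
            exact absurd hd (by norm_num))
      _ ≤ (9 / (2 ^ J * t)) ^ (1 - δ) :=
          Real.rpow_le_rpow hy (abs_profile_le hJ ht.1 ht.2.le) (by linarith)
      _ = 9 ^ (1 - δ) * (2 ^ J : ℝ) ^ (δ - 1) * t ^ (δ - 1) := by
          have ht0 := ht.1
          rw [Real.div_rpow (by norm_num) (by positivity), Real.mul_rpow (by positivity) ht0.le,
            div_eq_mul_inv, mul_inv, ← Real.rpow_neg (by positivity), ← Real.rpow_neg ht0.le,
            neg_sub, mul_assoc]
      _ ≤ _ := by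
          have ht0 := ht.1
          have : (9 : ℝ) ^ (1 - δ) ≤ 9 ^ (1 : ℝ) :=
            Real.rpow_le_rpow_of_exponent_le (by norm_num) (by linarith)
          rw [Real.rpow_one] at this
          gcongr
  rw [intervalIntegral.integral_const_mul, integral_rpow (Or.inl (by linarith)),
    sub_add_cancel, Real.zero_rpow hδ.ne', sub_zero] at h4
  have hpi : π ^ δ ≤ 4 := by
    calc π ^ δ ≤ π ^ (1 : ℝ) :=
          Real.rpow_le_rpow_of_exponent_le (by linarith [Real.pi_gt_three]) hδ1
      _ ≤ 4 := by rw [Real.rpow_one]; exact Real.pi_le_four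
  rw [h1]
  calc _ ≤ 2 * (9 * (2 ^ J : ℝ) ^ (δ - 1) * (4 / δ)) := by
        refine mul_le_mul_of_nonneg_left (h4.trans ?_) (by norm_num)
        gcongr
    _ = _ := by ring

lemma intervalIntegral_cos_add (k : ℕ) (x : ℝ) {ε : ℝ} (hε : 0 < ε) :
    ∫ v in -ε..ε, Real.cos (k * (x + v)) = 2 * ε * (Real.sinc (k * ε) * Real.cos (k * x)) := by
  rcases Nat.eq_zero_or_pos k with rfl | hk
  · simp; ring
  have hk' : (0 : ℝ) < k := by exact_mod_cast hk
  have h1 : ∫ v in -ε..ε, Real.cos (k * (x + v)) =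
      (k : ℝ)⁻¹ • ∫ u in (k * x + k * -ε)..(k * x + k * ε), Real.cos u := by
    rw [← intervalIntegral.integral_comp_add_mul _ hk'.ne']
    refine intervalIntegral.integral_congr fun v _ => ?_
    congr 1; ring
  rw [h1, integral_cos, Real.sinc_of_ne_zero (by positivity), mul_neg, Real.sin_add, Real.sin_add,
    Real.sin_neg, Real.cos_neg, smul_eq_mul]
  field_simp
  ring

/-- The damping of the Fourier modes by the averaging over arcs of half-length `ε`. -/
noncomputable def damping (ε : ℝ) (k : ℕ) : ℝ := Real.sinc (k * ε)

lemma abs_damping_le_one (ε : ℝ) (k : ℕ) : |damping ε k| ≤ 1 := Real.abs_sinc_le_one _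

/-- Damping the modes by sinc(kε) is averaging over an arc in space, which does not increase `L¹`
norms. This is how localization becomes uniform in ε. -/
lemma dir_damping_eq {ε : ℝ} (hε : 0 < ε) (i : ℕ) (θ : ℝ) :
    dir (damping ε) i θ = (2 * ε)⁻¹ *
      ∫ v in -ε..ε, profile (Nat.log 2 i) (θ - 2 * π * i / 2 ^ Nat.log 2 i + v) := by
  simp only [profile, dir, frameFun]
  rw [intervalIntegral.integral_const_mul, intervalIntegral.integral_finsetSum fun k _ =>
    Continuous.intervalIntegrable (by fun_prop) _ _]
  rw [mul_left_comm, Finset.mul_sum _ _ (2 * ε)⁻¹]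
  congr 1
  refine Finset.sum_congr rfl fun k _ => ?_
  rw [intervalIntegral.integral_const_mul, intervalIntegral_cos_add k _ hε, fieldCoeff, damping,
    add_zero]
  field_simp

/-- The directions are localized at their scale, up to an arbitrarily small power. -/
lemma intervalIntegral_abs_dir_le {ε : ℝ} (hε : 0 < ε) {J i : ℕ} (hi : Nat.log 2 i = J)
    (hJ : 2 ≤ J) {δ : ℝ} (hδ : 0 < δ) (hδ1 : δ ≤ 1) :
    ∫ θ in (0 : ℝ)..2 * π, |dir (damping ε) i θ| ≤ 72 / δ * (2 ^ J : ℝ) ^ (δ - 1) := by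
  have hc := continuous_profile J
  set x : ℝ := 2 * π * i / 2 ^ J with hx
  have h0 : ∀ θ, |dir (damping ε) i θ| ≤ (2 * ε)⁻¹ * ∫ v in -ε..ε, |profile J (θ - x + v)| :=
    fun θ => by
    rw [dir_damping_eq hε, hi, abs_mul, abs_of_nonneg (by positivity : (0 : ℝ) ≤ (2 * ε)⁻¹)]
    refine mul_le_mul_of_nonneg_left ?_ (by positivity)
    exact intervalIntegral.norm_integral_le_integral_norm
      (f := fun v => profile J (θ - x + v)) (μ := volume) (by linarith)
  have hcc : Continuous fun θ => ∫ v in -ε..ε, |profile J (θ - x + v)| :=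
    intervalIntegral.continuous_parametric_intervalIntegral_of_continuous' (by fun_prop) _ _
  calc ∫ θ in (0 : ℝ)..2 * π, |dir (damping ε) i θ|
      ≤ ∫ θ in (0 : ℝ)..2 * π, (2 * ε)⁻¹ * ∫ v in -ε..ε, |profile J (θ - x + v)| := by
        refine intervalIntegral.integral_mono_on Real.two_pi_pos.le
          ((continuous_dir _ _).abs.intervalIntegrable _ _)
          ((continuous_const.mul hcc).intervalIntegrable _ _) fun θ _ => h0 θ
    _ = (2 * ε)⁻¹ * ∫ v in -ε..ε, ∫ θ in (0 : ℝ)..2 * π, |profile J (θ - x + v)| := by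
        rw [intervalIntegral.integral_const_mul, intervalIntegral_intervalIntegral_swap]
        rw [Set.uIoc_of_le Real.two_pi_pos.le, Set.uIoc_of_le (by linarith : -ε ≤ ε)]
        refine (Continuous.continuousOn (by fun_prop)).integrableOn_compact
          (isCompact_Icc.prod isCompact_Icc) |>.mono_set
          (Set.prod_mono Set.Ioc_subset_Icc_self Set.Ioc_subset_Icc_self)
    _ = (2 * ε)⁻¹ * ∫ _v in -ε..ε, ∫ θ in (0 : ℝ)..2 * π, |profile J θ| := by
        congr 1
        refine intervalIntegral.integral_congr fun v _ => ?_
        have hp : Function.Periodic (fun θ => |profile J θ|) (2 * π) := fun θ => by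
          simp only [(profile_periodic J) θ]
        have e1 : ∀ θ, |profile J (θ - x + v)| = |profile J (θ + (v - x))| := fun θ => by
          congr 2; ring
        simp only [e1]
        rw [intervalIntegral.integral_comp_add_right (fun θ => |profile J θ|) (v - x), zero_add,
          add_comm (2 * π), hp.intervalIntegral_add_eq (v - x) 0, zero_add]
    _ = ∫ θ in (0 : ℝ)..2 * π, |profile J θ| := by
        rw [intervalIntegral.integral_const, smul_eq_mul]
        field_simp
        ring
    _ ≤ _ := intervalIntegral_abs_profile_le hi hJ hδ hδ1

/-! ### Independent Gaussian sequences and their exponential moments. -/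

/-- A sequence of independent standard Gaussian variables. -/
structure IsGaussianSeq {Ω : Type*} [MeasurableSpace Ω] (Q : Measure Ω) (g : ℕ → Ω → ℝ) :
    Prop where
  measurable : ∀ i, Measurable (g i)
  law : ∀ i, Q.map (g i) = gaussianReal 0 1
  indep : iIndepFun g Q

section GaussianSeq

variable {Ω : Type*} [MeasurableSpace Ω] {Q : Measure Ω} [IsProbabilityMeasure Q]
  {g : ℕ → Ω → ℝ}

/-- Integrating out one variable of an independent sequence, given the previous ones. -/
lemma IsGaussianSeq.lintegral_eq (hg : IsGaussianSeq Q g) (l : ℕ) {Φ : (ℕ → ℝ) → ℝ → ℝ≥0∞}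
    (hΦ : Measurable (Function.uncurry Φ))
    (hdep : ∀ y y' : ℕ → ℝ, (∀ i < l, y i = y' i) → Φ y = Φ y') :
    ∫⁻ ω, Φ (fun i => g i ω) (g l ω) ∂Q =
      ∫⁻ ω, ∫⁻ t, Φ (fun i => g i ω) t ∂(gaussianReal 0 1) ∂Q := by
  -- `Y` sets the coordinates from `l` on to zero. By `hdep` this does not affect `Φ`, and it turns
  -- the first argument into a function of finitely many variables independent of `g l`.
  set Y : Ω → ℕ → ℝ := fun ω i => if i < l then g i ω else 0 with hY
  have hYm : Measurable Y := by
    refine measurable_pi_lambda _ fun i => ?_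
    by_cases h : i < l
    · simpa [hY, h] using hg.measurable i
    · simp [hY, h]
  have hYeq : ∀ ω, Φ (fun i => g i ω) = Φ (Y ω) := fun ω =>
    hdep _ _ fun i hi => by simp [hY, hi]
  have hind : IndepFun Y (g l) Q := by
    have h0 := hg.indep.indepFun_finset (Finset.range l) {l} (by simp) hg.measurable
    have h1 : Measurable fun (y : Finset.range l → ℝ) (i : ℕ) =>
        if h : i ∈ Finset.range l then y ⟨i, h⟩ else 0 := by
      refine measurable_pi_lambda _ fun i => ?_
      by_cases h : i ∈ Finset.range l
      · simpa [h] using measurable_pi_apply (⟨i, h⟩ : Finset.range l)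
      · simp [h]
    have h2 : Measurable fun y : ({l} : Finset ℕ) → ℝ => y ⟨l, by simp⟩ := measurable_pi_apply _
    have h3 := h0.comp h1 h2
    convert h3 using 1
    · ext ω i
      simp [hY]
    · rfl
  have hprod := (indepFun_iff_map_prod_eq_prod_map_map hYm.aemeasurable
    (hg.measurable l).aemeasurable).1 hind
  calc ∫⁻ ω, Φ (fun i => g i ω) (g l ω) ∂Q
      = ∫⁻ ω, Function.uncurry Φ (Y ω, g l ω) ∂Q := by simp only [hYeq, Function.uncurry]
    _ = ∫⁻ p, Function.uncurry Φ p ∂((Q.map Y).prod (gaussianReal 0 1)) := by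
        rw [← hg.law l, ← hprod, lintegral_map hΦ (hYm.prodMk (hg.measurable l))]
    _ = ∫⁻ y, ∫⁻ t, Φ y t ∂(gaussianReal 0 1) ∂(Q.map Y) := by
        rw [lintegral_prod _ hΦ.aemeasurable]; rfl
    _ = _ := by
        have hm : Measurable fun y => ∫⁻ t, Φ y t ∂(gaussianReal 0 1) :=
          hΦ.lintegral_prod_right'
        rw [lintegral_map hm hYm]
        simp only [hYeq]

lemma lintegral_ofReal_exp_mul_gaussianReal (c : ℝ) :
    ∫⁻ t, ENNReal.ofReal (Real.exp (c * t)) ∂(gaussianReal 0 1) =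
      ENNReal.ofReal (Real.exp (c ^ 2 / 2)) := by
  rw [← ofReal_integral_eq_lintegral_ofReal (integrable_exp_mul_gaussianReal c)
    (.of_forall fun t => (Real.exp_pos _).le)]
  have h := congrFun (mgf_fun_id_gaussianReal (μ := 0) (v := 1)) c
  rw [mgf] at h
  rw [h]
  simp

lemma IsGaussianSeq.lintegral_exp_sum (hg : IsGaussianSeq Q g) (c : ℕ → ℝ) (l : ℕ) :
    ∫⁻ ω, ENNReal.ofReal (Real.exp (∑ i ∈ Finset.range l, c i * g i ω)) ∂Q =
      ENNReal.ofReal (Real.exp (∑ i ∈ Finset.range l, c i ^ 2 / 2)) := by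
  induction l with
  | zero => simp
  | succ l ih =>
    have h := hg.lintegral_eq l
      (Φ := fun y t => ENNReal.ofReal (Real.exp (∑ i ∈ Finset.range l, c i * y i)) *
        ENNReal.ofReal (Real.exp (c l * t))) (by unfold Function.uncurry; fun_prop) (by
        intro y y' hy
        funext t
        rw [Finset.sum_congr rfl fun i hi => by rw [hy i (Finset.mem_range.1 hi)]])
    have e1 : ∀ ω, ENNReal.ofReal (Real.exp (∑ i ∈ Finset.range (l + 1), c i * g i ω)) =
        ENNReal.ofReal (Real.exp (∑ i ∈ Finset.range l, c i * g i ω)) *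
        ENNReal.ofReal (Real.exp (c l * g l ω)) := fun ω => by
      rw [Finset.sum_range_succ, Real.exp_add, ENNReal.ofReal_mul (Real.exp_pos _).le]
    simp only [e1]
    rw [h]
    have hm : Measurable fun t => ENNReal.ofReal (Real.exp (c l * t)) := by fun_prop
    simp only [lintegral_const_mul _ hm, lintegral_ofReal_exp_mul_gaussianReal]
    have hm2 : Measurable fun ω =>
        ENNReal.ofReal (Real.exp (∑ i ∈ Finset.range l, c i * g i ω)) := by
      have := hg.measurable
      fun_prop
    rw [lintegral_mul_const _ hm2, ih, Finset.sum_range_succ, Real.exp_add,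
      ENNReal.ofReal_mul (Real.exp_pos _).le]

lemma IsGaussianSeq.lintegral_exp_sum_add (hg : IsGaussianSeq Q g) (c d : ℕ → ℝ) (l : ℕ) :
    ∫⁻ ω, ENNReal.ofReal (Real.exp (∑ i ∈ Finset.range l, (c i * g i ω + d i))) ∂Q =
      ENNReal.ofReal (Real.exp (∑ i ∈ Finset.range l, (c i ^ 2 / 2 + d i))) := by
  have e1 : ∀ ω, ENNReal.ofReal (Real.exp (∑ i ∈ Finset.range l, (c i * g i ω + d i))) =
      ENNReal.ofReal (Real.exp (∑ i ∈ Finset.range l, d i)) *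
      ENNReal.ofReal (Real.exp (∑ i ∈ Finset.range l, c i * g i ω)) := fun ω => by
    rw [Finset.sum_add_distrib, add_comm, Real.exp_add, ENNReal.ofReal_mul (Real.exp_pos _).le]
  have hm2 : Measurable fun ω =>
      ENNReal.ofReal (Real.exp (∑ i ∈ Finset.range l, c i * g i ω)) := by
    have := hg.measurable
    fun_prop
  simp only [e1]
  rw [lintegral_const_mul _ hm2, hg.lintegral_exp_sum, Finset.sum_add_distrib,
    add_comm (∑ i ∈ Finset.range l, c i ^ 2 / 2), Real.exp_add,
    ENNReal.ofReal_mul (Real.exp_pos _).le]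

lemma exp_mul_abs_le (c t : ℝ) :
    Real.exp (c * |t|) ≤ Real.exp (c * t) + Real.exp (-c * t) := by
  rcases abs_choice t with h | h <;> rw [h]
  · linarith [Real.exp_pos (-c * t)]
  · rw [show c * -t = -c * t by ring]; linarith [Real.exp_pos (c * t)]

lemma integrable_exp_mul_abs_gaussianReal (c : ℝ) :
    Integrable (fun t => Real.exp (c * |t|)) (gaussianReal 0 1) :=
  ((integrable_exp_mul_gaussianReal c).add (integrable_exp_mul_gaussianReal (-c))).mono'
    (by fun_prop) (.of_forall fun t => by
      rw [Real.norm_eq_abs, abs_of_pos (Real.exp_pos _)]; exact exp_mul_abs_le c t)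

lemma integral_exp_mul_sub_gaussianReal (c : ℝ) :
    ∫ t, Real.exp (c * t - c ^ 2 / 2) ∂(gaussianReal 0 1) = 1 := by
  have h := congrFun (mgf_fun_id_gaussianReal (μ := 0) (v := 1)) c
  rw [mgf] at h
  simp only [Real.exp_sub]
  rw [integral_div, h, div_eq_one_iff_eq (Real.exp_pos _).ne']
  simp

end GaussianSeq

/-! ### The chaos as a martingale, and the moments of its increments. -/

/-- The logarithm of the density of the chaos built from the first `l` directions. -/
noncomputable def logDensity (γ : ℝ) (σ : ℕ → ℝ) (l : ℕ) (y : ℕ → ℝ) (θ : ℝ) : ℝ :=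
  ∑ i ∈ Finset.range l, (γ * y i * dir σ i θ - γ ^ 2 / 2 * dir σ i θ ^ 2)

/-- The derivative of `logDensity` in the angle. -/
noncomputable def logDensityDeriv (γ : ℝ) (σ : ℕ → ℝ) (l : ℕ) (y : ℕ → ℝ) (θ : ℝ) : ℝ :=
  ∑ i ∈ Finset.range l, (γ * y i * dirDeriv σ i θ - γ ^ 2 * (dir σ i θ * dirDeriv σ i θ))

/-- The Fourier coefficients of the chaos built from the first `l` directions. -/
noncomputable def chaosCoeff (γ : ℝ) (σ : ℕ → ℝ) (l : ℕ) (y : ℕ → ℝ) : ℕ → ℂ :=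
  densityCoeff fun θ => Real.exp (logDensity γ σ l y θ)

/-- The increment of the Fourier coefficients when the direction `l` is added with amplitude
`t`. -/
noncomputable def chaosIncrement (γ : ℝ) (σ : ℕ → ℝ) (l : ℕ) (y : ℕ → ℝ) (t : ℝ) : ℕ → ℂ :=
  densityCoeff fun θ => Real.exp (logDensity γ σ l y θ) *
    (Real.exp (γ * t * dir σ l θ - γ ^ 2 / 2 * dir σ l θ ^ 2) - 1)

section Chaos

lemma _root_.Measurable.ofReal_sqNormL4 {α : Type*} [MeasurableSpace α] {s : Finset ℕ}
    {w : ℕ → ℝ} {f : α → ℕ → ℂ} (hf : Measurable f) :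
    Measurable fun a => ENNReal.ofReal (sqNormL4 s w (f a)) :=
  (measurable_sqNormL4.comp hf).ennreal_ofReal

variable {γ : ℝ} {σ : ℕ → ℝ}

lemma hasDerivAt_logDensity (l : ℕ) (y : ℕ → ℝ) (θ : ℝ) :
    HasDerivAt (logDensity γ σ l y) (logDensityDeriv γ σ l y θ) θ := by
  unfold logDensity logDensityDeriv
  refine HasDerivAt.fun_sum fun i _ => ?_
  have h := ((hasDerivAt_dir σ i θ).const_mul (γ * y i)).sub
    (((hasDerivAt_dir σ i θ).pow 2).const_mul (γ ^ 2 / 2))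
  exact h.congr_deriv (by simp; ring)

lemma continuous_logDensity (l : ℕ) (y : ℕ → ℝ) : Continuous (logDensity γ σ l y) := by
  have := continuous_dir σ
  unfold logDensity
  fun_prop

lemma continuous_logDensityDeriv (l : ℕ) (y : ℕ → ℝ) : Continuous (logDensityDeriv γ σ l y) := by
  have := continuous_dir σ
  have := continuous_dirDeriv σ
  unfold logDensityDeriv
  fun_prop

lemma dir_two_pi (i : ℕ) : dir σ i (2 * π) = dir σ i 0 := by
  have := frameFun_periodic (fieldCoeff σ) 0 (Nat.log 2 i) i 0
  rwa [zero_add] at this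

lemma logDensity_two_pi (l : ℕ) (y : ℕ → ℝ) :
    logDensity γ σ l y (2 * π) = logDensity γ σ l y 0 := by
  simp only [logDensity, dir_two_pi]

lemma logDensity_congr {l : ℕ} {y y' : ℕ → ℝ} (h : ∀ i < l, y i = y' i) :
    logDensity γ σ l y = logDensity γ σ l y' := by
  funext θ
  exact Finset.sum_congr rfl fun i hi => by rw [h i (Finset.mem_range.1 hi)]

lemma measurable_logDensity {α : Type*} [MeasurableSpace α] (l : ℕ) {Y : α → ℕ → ℝ} {T : α → ℝ}
    (hY : Measurable Y) (hT : Measurable T) :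
    Measurable fun a => logDensity γ σ l (Y a) (T a) := by
  have := fun i => (continuous_dir σ i).measurable
  unfold logDensity
  fun_prop

lemma measurable_logDensityDeriv {α : Type*} [MeasurableSpace α] (l : ℕ) {Y : α → ℕ → ℝ}
    {T : α → ℝ} (hY : Measurable Y) (hT : Measurable T) :
    Measurable fun a => logDensityDeriv γ σ l (Y a) (T a) := by
  have := fun i => (continuous_dir σ i).measurable
  have := fun i => (continuous_dirDeriv σ i).measurable
  unfold logDensityDeriv
  fun_prop

lemma measurable_densityCoeff {α : Type*} [MeasurableSpace α] {h : α → ℝ → ℝ}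
    (hh : Measurable fun p : α × ℝ => h p.1 p.2) : Measurable fun a => densityCoeff (h a) := by
  refine measurable_pi_lambda _ fun n => ?_
  simp only [densityCoeff, intervalIntegral.integral_of_le Real.two_pi_pos.le]
  have hm : Measurable fun p : α × ℝ => Complex.exp (n * p.2 * Complex.I) * (h p.1 p.2 : ℂ) := by
    fun_prop
  exact (hm.stronglyMeasurable.integral_prod_right' (ν := volume.restrict
    (Set.Ioc (0 : ℝ) (2 * π)))).measurable

lemma measurable_chaosCoeff {α : Type*} [MeasurableSpace α] (l : ℕ) {Y : α → ℕ → ℝ}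
    (hY : Measurable Y) : Measurable fun a => chaosCoeff γ σ l (Y a) :=
  measurable_densityCoeff (h := fun a θ => Real.exp (logDensity γ σ l (Y a) θ))
    (measurable_logDensity l (hY.comp measurable_fst) measurable_snd).exp

lemma measurable_chaosIncrement {α : Type*} [MeasurableSpace α] (l : ℕ) {Y : α → ℕ → ℝ}
    {T : α → ℝ} (hY : Measurable Y) (hT : Measurable T) :
    Measurable fun a => chaosIncrement γ σ l (Y a) (T a) := by
  have h1 : Measurable fun p : α × ℝ => logDensity γ σ l (Y p.1) p.2 :=
    measurable_logDensity l (hY.comp measurable_fst) measurable_snd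
  have h2 : Measurable fun p : α × ℝ => dir σ l p.2 :=
    (continuous_dir σ l).measurable.comp measurable_snd
  have h3 : Measurable fun p : α × ℝ => T p.1 := hT.comp measurable_fst
  have h4 : Measurable fun p : α × ℝ => Real.exp (logDensity γ σ l (Y p.1) p.2) *
      (Real.exp (γ * T p.1 * dir σ l p.2 - γ ^ 2 / 2 * dir σ l p.2 ^ 2) - 1) := by
    fun_prop
  exact measurable_densityCoeff (h := fun a θ => Real.exp (logDensity γ σ l (Y a) θ) *
    (Real.exp (γ * T a * dir σ l θ - γ ^ 2 / 2 * dir σ l θ ^ 2) - 1)) h4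

lemma chaosCoeff_succ (l : ℕ) (y : ℕ → ℝ) :
    chaosCoeff γ σ (l + 1) y = chaosCoeff γ σ l y + chaosIncrement γ σ l y (y l) := by
  funext n
  have := continuous_logDensity (γ := γ) (σ := σ) l y
  have := continuous_dir σ l
  simp only [chaosCoeff, chaosIncrement, densityCoeff, Pi.add_apply]
  rw [← intervalIntegral.integral_add (Continuous.intervalIntegrable (by fun_prop) _ _)
    (Continuous.intervalIntegrable (by fun_prop) _ _)]
  refine intervalIntegral.integral_congr fun θ _ => ?_
  simp only [logDensity, Finset.sum_range_succ, Real.exp_add]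
  push_cast
  ring

/-- The initial density is the constant 1, so the martingale starts at zero away from the frequency
0; hence that frequency is excluded in the bounds below. -/
lemma chaosCoeff_zero (y : ℕ → ℝ) {n : ℕ} (hn : n ≠ 0) : chaosCoeff γ σ 0 y n = 0 := by
  have h := natCast_mul_densityCoeff (h := fun _ => 1) (h' := fun _ => 0)
    (fun θ => hasDerivAt_const θ 1) continuous_const rfl n
  have h0 : densityCoeff (fun _ => 0) n = 0 := by simp [densityCoeff]
  rw [h0, mul_zero] at h
  have h1 : chaosCoeff γ σ 0 y n = densityCoeff (fun _ => 1) n := by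
    simp [chaosCoeff, logDensity]
  rw [h1]
  exact (mul_eq_zero.1 h).resolve_left (by exact_mod_cast hn)

/-- The dominating function is the product of exp(2|t| + 2) and the density; this licenses Fubini
between the Gaussian amplitude and the angle. -/
lemma integrable_chaosIncrement_kernel (hγ : 0 ≤ γ) (hγ1 : γ ≤ 1) (hσ : ∀ k, |σ k| ≤ 1) (l : ℕ)
    (y : ℕ → ℝ) (n : ℕ) :
    Integrable (fun p : ℝ × ℝ => Complex.exp (n * p.2 * Complex.I) *
      ((Real.exp (logDensity γ σ l y p.2) *
        (Real.exp (γ * p.1 * dir σ l p.2 - γ ^ 2 / 2 * dir σ l p.2 ^ 2) - 1) : ℝ) : ℂ))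
      ((gaussianReal 0 1).prod (volume.restrict (Set.Ioc (0 : ℝ) (2 * π)))) := by
  have hc := continuous_logDensity (γ := γ) (σ := σ) l y
  have hd := continuous_dir σ l
  have hf : Integrable (fun θ => Real.exp (logDensity γ σ l y θ))
      (volume.restrict (Set.Ioc (0 : ℝ) (2 * π))) :=
    (Continuous.integrableOn_Icc (by fun_prop)).mono_set Set.Ioc_subset_Icc_self
  have hE : Integrable (fun t => Real.exp (2 * |t| + 2)) (gaussianReal 0 1) := by
    simp only [Real.exp_add]
    exact (integrable_exp_mul_abs_gaussianReal 2).mul_const _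
  refine (hE.mul_prod hf).mono' (Continuous.aestronglyMeasurable (by fun_prop))
    (.of_forall fun p => ?_)
  rw [norm_mul, norm_exp_natCast_mul_I, one_mul, Complex.norm_real, Real.norm_eq_abs, abs_mul,
    abs_of_pos (Real.exp_pos _), mul_comm]
  refine mul_le_mul_of_nonneg_right ?_ (Real.exp_pos _).le
  refine (abs_exp_gaussian_exponent_sub_one_le hγ hγ1 (abs_dir_le_one hσ l p.2) p.1).trans ?_
  exact mul_le_of_le_one_right (Real.exp_pos _).le (abs_dir_le_one hσ l p.2)

lemma integrable_chaosIncrement (hγ : 0 ≤ γ) (hγ1 : γ ≤ 1) (hσ : ∀ k, |σ k| ≤ 1) (l : ℕ)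
    (y : ℕ → ℝ) (n : ℕ) :
    Integrable (fun t => chaosIncrement γ σ l y t n) (gaussianReal 0 1) := by
  simp only [chaosIncrement, densityCoeff, intervalIntegral.integral_of_le Real.two_pi_pos.le]
  exact (integrable_chaosIncrement_kernel hγ hγ1 hσ l y n).integral_prod_left

/-- The martingale property: after Fubini, exp(γtk − γ²k²/2) has Gaussian mean one at each angle. -/
lemma integral_chaosIncrement (hγ : 0 ≤ γ) (hγ1 : γ ≤ 1) (hσ : ∀ k, |σ k| ≤ 1) (l : ℕ)
    (y : ℕ → ℝ) (n : ℕ) :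
    ∫ t, chaosIncrement γ σ l y t n ∂(gaussianReal 0 1) = 0 := by
  simp only [chaosIncrement, densityCoeff, intervalIntegral.integral_of_le Real.two_pi_pos.le]
  rw [integral_integral_swap (integrable_chaosIncrement_kernel hγ hγ1 hσ l y n)]
  have h0 : ∀ θ : ℝ, ∫ t, Complex.exp (n * θ * Complex.I) *
      ((Real.exp (logDensity γ σ l y θ) *
        (Real.exp (γ * t * dir σ l θ - γ ^ 2 / 2 * dir σ l θ ^ 2) - 1) : ℝ) : ℂ)
      ∂(gaussianReal 0 1) = 0 := fun θ => by
    rw [integral_const_mul, integral_complex_ofReal, integral_const_mul, integral_sub _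
      (integrable_const _)]
    · have e : ∀ t, γ * t * dir σ l θ - γ ^ 2 / 2 * dir σ l θ ^ 2 =
          (γ * dir σ l θ) * t - (γ * dir σ l θ) ^ 2 / 2 := fun t => by ring
      simp only [e, integral_exp_mul_sub_gaussianReal]
      simp
    · have e : ∀ t, γ * t * dir σ l θ - γ ^ 2 / 2 * dir σ l θ ^ 2 =
          (γ * dir σ l θ) * t - (γ * dir σ l θ) ^ 2 / 2 := fun t => by ring
      simp only [e, Real.exp_sub]
      exact (integrable_exp_mul_gaussianReal _).div_const _
  simp only [h0, integral_zero]

variable {Ω : Type*} [MeasurableSpace Ω] {Q : Measure Ω} [IsProbabilityMeasure Q]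
  {g : ℕ → Ω → ℝ}

/-- Given the variables before `g l`, the new coefficients are a fixed vector plus a centered
increment driven by `g l`, so the one-step type 2 inequality applies inside the expectation. -/
lemma IsGaussianSeq.lintegral_sqNormL4_chaosCoeff_succ_le (hg : IsGaussianSeq Q g)
    (hγ : 0 ≤ γ) (hγ1 : γ ≤ 1) (hσ : ∀ k, |σ k| ≤ 1) {s : Finset ℕ} {w : ℕ → ℝ}
    (hw : ∀ n, 0 ≤ w n) (l : ℕ) :
    ∫⁻ ω, ENNReal.ofReal (sqNormL4 s w (chaosCoeff γ σ (l + 1) fun i => g i ω)) ∂Q ≤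
      ∫⁻ ω, ENNReal.ofReal (sqNormL4 s w (chaosCoeff γ σ l fun i => g i ω)) ∂Q +
      6 * ∫⁻ ω, ∫⁻ t, ENNReal.ofReal (sqNormL4 s w (chaosIncrement γ σ l (fun i => g i ω) t))
        ∂(gaussianReal 0 1) ∂Q := by
  have hgm : Measurable fun ω => fun i => g i ω := measurable_pi_lambda _ hg.measurable
  have h1 := hg.lintegral_eq l
    (Φ := fun y t => ENNReal.ofReal (sqNormL4 s w (chaosCoeff γ σ l y + chaosIncrement γ σ l y t)))
    ((measurable_chaosCoeff l measurable_fst).add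
      (measurable_chaosIncrement l measurable_fst measurable_snd)).ofReal_sqNormL4 (by
      intro y y' hy
      simp only [chaosCoeff, chaosIncrement, logDensity_congr hy])
  simp only [chaosCoeff_succ]
  rw [h1]
  have hm1 : Measurable fun ω =>
      ENNReal.ofReal (sqNormL4 s w (chaosCoeff γ σ l fun i => g i ω)) :=
    (measurable_chaosCoeff l hgm).ofReal_sqNormL4
  have hm2 : Measurable fun ω => ∫⁻ t, ENNReal.ofReal (sqNormL4 s w
      (chaosIncrement γ σ l (fun i => g i ω) t)) ∂(gaussianReal 0 1) := by
    have h2 : Measurable fun p : (ℕ → ℝ) × ℝ =>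
        ENNReal.ofReal (sqNormL4 s w (chaosIncrement γ σ l p.1 p.2)) :=
      (measurable_chaosIncrement l measurable_fst measurable_snd).ofReal_sqNormL4
    exact h2.lintegral_prod_right'.comp hgm
  rw [← lintegral_const_mul _ hm2, ← lintegral_add_left hm1]
  refine lintegral_mono fun ω => ?_
  refine lintegral_sqNormL4_add_le hw _ _ (fun n _ => integrable_chaosIncrement hγ hγ1 hσ l _ n)
    (fun n _ => integral_chaosIncrement hγ hγ1 hσ l _ n) ?_
  exact measurable_chaosIncrement l measurable_const measurable_id

/-- The martingale type `2` inequality for the chaos. -/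
lemma IsGaussianSeq.lintegral_sqNormL4_chaosCoeff_le (hg : IsGaussianSeq Q g)
    (hγ : 0 ≤ γ) (hγ1 : γ ≤ 1) (hσ : ∀ k, |σ k| ≤ 1) {s : Finset ℕ} (hs : 0 ∉ s) {w : ℕ → ℝ}
    (hw : ∀ n, 0 ≤ w n) (l : ℕ) :
    ∫⁻ ω, ENNReal.ofReal (sqNormL4 s w (chaosCoeff γ σ l fun i => g i ω)) ∂Q ≤
      6 * ∑ i ∈ Finset.range l, ∫⁻ ω, ∫⁻ t, ENNReal.ofReal (sqNormL4 s w
        (chaosIncrement γ σ i (fun i => g i ω) t)) ∂(gaussianReal 0 1) ∂Q := by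
  induction l with
  | zero =>
    have h0 : ∀ y, sqNormL4 s w (chaosCoeff γ σ 0 y) = 0 := fun y => by
      rw [sqNormL4, Finset.sum_eq_zero, Real.sqrt_zero]
      intro n hn
      rw [chaosCoeff_zero y fun h => hs (h ▸ hn)]
      simp
    simp [h0]
  | succ l ih =>
    rw [Finset.sum_range_succ, mul_add]
    exact (hg.lintegral_sqNormL4_chaosCoeff_succ_le hγ hγ1 hσ hw l).trans (by gcongr)

/-- The second moment of the density, tilted by its rescaled logarithmic derivative. -/
lemma IsGaussianSeq.lintegral_exp_sq_mul_exp_le (hg : IsGaussianSeq Q g)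
    (hγ : 0 ≤ γ) (hγ1 : γ ≤ 1) (hσ : ∀ k, |σ k| ≤ 1) {J l : ℕ} (hl : l ≤ 2 ^ (J + 1)) {δ : ℝ}
    (hδ : 0 < δ) (θ : ℝ) {r : ℝ} (hr : r = 1 ∨ r = -1) :
    ∫⁻ ω, ENNReal.ofReal (Real.exp (logDensity γ σ l (fun i => g i ω) θ) ^ 2 *
      Real.exp (r * (logDensityDeriv γ σ l (fun i => g i ω) θ / 2 ^ J))) ∂Q ≤
      ENNReal.ofReal (Real.exp (2 + δ + δ⁻¹) * (2 ^ J : ℝ) ^ (γ ^ 2 + δ)) := by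
  set N : ℝ := 2 ^ J with hN
  have hN0 : 0 < N := by positivity
  have hN1 : 1 ≤ N := one_le_pow₀ (by norm_num)
  have hr2 : r ^ 2 = 1 := by rcases hr with rfl | rfl <;> norm_num
  -- `c` collects the coefficients of the Gaussians in the exponent, twice the log-density plus r/N
  -- times its derivative; `d` collects the deterministic part.
  set c : ℕ → ℝ := fun i => 2 * γ * dir σ i θ + r * γ * dirDeriv σ i θ / N with hc
  set d : ℕ → ℝ := fun i => -(γ ^ 2 * dir σ i θ ^ 2) - r * γ ^ 2 * (dir σ i θ * dirDeriv σ i θ) / N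
    with hd
  have e1 : ∀ ω, Real.exp (logDensity γ σ l (fun i => g i ω) θ) ^ 2 *
      Real.exp (r * (logDensityDeriv γ σ l (fun i => g i ω) θ / N)) =
      Real.exp (∑ i ∈ Finset.range l, (c i * g i ω + d i)) := fun ω => by
    rw [← Real.exp_nat_mul, ← Real.exp_add, logDensity, logDensityDeriv, Finset.mul_sum,
      Finset.sum_div, Finset.mul_sum, ← Finset.sum_add_distrib]
    congr 1
    refine Finset.sum_congr rfl fun i _ => ?_
    simp only [hc, hd]
    push_cast
    ring
  simp only [e1]
  rw [hg.lintegral_exp_sum_add]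
  refine ENNReal.ofReal_le_ofReal ?_
  have hγ2 : γ ^ 2 ≤ 1 := pow_le_one₀ hγ hγ1
  have h1 : ∀ i, c i ^ 2 / 2 + d i ≤
      (γ ^ 2 + δ) * dir σ i θ ^ 2 + (1 / 2 + δ⁻¹ / 4) * (dirDeriv σ i θ ^ 2 / N ^ 2) := fun i => by
    set k := dir σ i θ
    set k' := dirDeriv σ i θ / N with hk'
    have e2 : c i ^ 2 / 2 + d i = γ ^ 2 * k ^ 2 + r * γ ^ 2 * (k * k') + γ ^ 2 * k' ^ 2 / 2 := by
      simp only [hc, hd, hk']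
      have : (r * γ * dirDeriv σ i θ / N) ^ 2 = γ ^ 2 * (dirDeriv σ i θ / N) ^ 2 := by
        rw [mul_div_assoc, mul_pow, mul_pow, hr2, one_mul]
      have e3 : (2 * γ * k + r * γ * dirDeriv σ i θ / N) ^ 2 = 4 * γ ^ 2 * k ^ 2 +
        4 * r * γ ^ 2 * k * (dirDeriv σ i θ / N) + (r * γ * dirDeriv σ i θ / N) ^ 2 := by ring
      rw [e3, this]
      ring
    rw [e2, ← div_pow, ← hk']
    -- The cross terms need not cancel over an incomplete scale. The weighted arithmetic-geometric
    -- inequality charges only δ to k², whose sum is logarithmic in N, and the rest to the rescaled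
    -- k'², whose sum is bounded.
    have e4 : r * γ ^ 2 * (k * k') ≤ δ * k ^ 2 + δ⁻¹ / 4 * k' ^ 2 := by
      have h2 : 0 ≤ δ * (k - r * γ ^ 2 * k' / (2 * δ)) ^ 2 := by positivity
      have h3 : δ * (k - r * γ ^ 2 * k' / (2 * δ)) ^ 2 =
          δ * k ^ 2 - r * γ ^ 2 * (k * k') + δ⁻¹ / 4 * (γ ^ 2 * γ ^ 2) * k' ^ 2 * r ^ 2 := by
        field_simp
        ring
      rw [h3, hr2, mul_one] at h2
      have h4 : δ⁻¹ / 4 * (γ ^ 2 * γ ^ 2) * k' ^ 2 ≤ δ⁻¹ / 4 * 1 * k' ^ 2 := by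
        gcongr
        nlinarith [sq_nonneg γ]
      linarith
    nlinarith [sq_nonneg k']
  have h5 : ∑ i ∈ Finset.range l, (c i ^ 2 / 2 + d i) ≤
      (γ ^ 2 + δ) * (1 + Real.log N) + (1 / 2 + δ⁻¹ / 4) * 1 := by
    calc _ ≤ ∑ i ∈ Finset.range l, ((γ ^ 2 + δ) * dir σ i θ ^ 2 +
          (1 / 2 + δ⁻¹ / 4) * (dirDeriv σ i θ ^ 2 / N ^ 2)) := Finset.sum_le_sum fun i _ => h1 i
      _ = (γ ^ 2 + δ) * ∑ i ∈ Finset.range l, dir σ i θ ^ 2 +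
          (1 / 2 + δ⁻¹ / 4) * ((∑ i ∈ Finset.range l, dirDeriv σ i θ ^ 2) / N ^ 2) := by
          rw [Finset.sum_add_distrib, ← Finset.mul_sum, ← Finset.mul_sum, Finset.sum_div]
      _ ≤ _ := by
          have := sum_range_dir_sq_le hσ hl θ
          have h6 := sum_range_dirDeriv_sq_le hσ hl θ
          have h7 : (∑ i ∈ Finset.range l, dirDeriv σ i θ ^ 2) / N ^ 2 ≤ 1 := by
            rw [div_le_one (by positivity)]; exact h6
          gcongr
  calc _ ≤ Real.exp ((2 + δ + δ⁻¹) + Real.log N * (γ ^ 2 + δ)) := by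
        refine Real.exp_le_exp.2 (h5.trans ?_)
        have : 0 ≤ δ⁻¹ := by positivity
        nlinarith
    _ = _ := by rw [Real.exp_add, Real.rpow_def_of_pos hN0]

/-- The weight with which the second moment of the density at the scale `N` enters the estimate of
an increment. -/
noncomputable def incrementWeight (σ : ℕ → ℝ) (b N c : ℝ) (i : ℕ) (θ : ℝ) : ℝ :=
  c / 2 * (∫ θ in (0 : ℝ)..2 * π, |dir σ i θ|) * |dir σ i θ| +
    (2 * c)⁻¹ * (N ^ (4 * b) * (6 * π)) * (dir σ i θ ^ 2 + dirDeriv σ i θ ^ 2 / N ^ 2)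

lemma continuous_incrementWeight (b N c : ℝ) (i : ℕ) : Continuous (incrementWeight σ b N c i) := by
  have := continuous_dir σ i
  have := continuous_dirDeriv σ i
  unfold incrementWeight
  fun_prop

lemma incrementWeight_nonneg {b N c : ℝ} (hN : 0 < N) (hc : 0 < c) (i : ℕ) (θ : ℝ) :
    0 ≤ incrementWeight σ b N c i θ := by
  have : 0 ≤ ∫ θ in (0 : ℝ)..2 * π, |dir σ i θ| :=
    intervalIntegral.integral_nonneg Real.two_pi_pos.le fun θ _ => abs_nonneg _
  unfold incrementWeight
  positivity

/-- The square of the density, tilted by its rescaled logarithmic derivative. -/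
noncomputable def tiltedSq (γ : ℝ) (σ : ℕ → ℝ) (i : ℕ) (N : ℝ) (y : ℕ → ℝ) (θ : ℝ) : ℝ :=
  Real.exp (logDensity γ σ i y θ) ^ 2 *
    (Real.exp (logDensityDeriv γ σ i y θ / N) + Real.exp (-(logDensityDeriv γ σ i y θ / N)))

lemma tiltedSq_nonneg (i : ℕ) (N : ℝ) (y : ℕ → ℝ) (θ : ℝ) : 0 ≤ tiltedSq γ σ i N y θ := by
  unfold tiltedSq; positivity

lemma continuous_tiltedSq (i : ℕ) (N : ℝ) (y : ℕ → ℝ) : Continuous (tiltedSq γ σ i N y) := by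
  have h1 := continuous_logDensity (γ := γ) (σ := σ) i y
  have h2 := continuous_logDensityDeriv (γ := γ) (σ := σ) i y
  unfold tiltedSq
  fun_prop

lemma measurable_tiltedSq {α : Type*} [MeasurableSpace α] (i : ℕ) (N : ℝ) {Y : α → ℕ → ℝ}
    {T : α → ℝ} (hY : Measurable Y) (hT : Measurable T) :
    Measurable fun a => tiltedSq γ σ i N (Y a) (T a) := by
  have h1 : Measurable fun a => logDensity γ σ i (Y a) (T a) := measurable_logDensity i hY hT
  have h2 : Measurable fun a => logDensityDeriv γ σ i (Y a) (T a) :=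
    measurable_logDensityDeriv i hY hT
  unfold tiltedSq
  fun_prop

lemma IsGaussianSeq.lintegral_tiltedSq_le (hg : IsGaussianSeq Q g)
    (hγ : 0 ≤ γ) (hγ1 : γ ≤ 1) (hσ : ∀ k, |σ k| ≤ 1) {J i : ℕ} (hi : i ≤ 2 ^ (J + 1)) {δ : ℝ}
    (hδ : 0 < δ) (θ : ℝ) :
    ∫⁻ ω, ENNReal.ofReal (tiltedSq γ σ i (2 ^ J) (fun i => g i ω) θ) ∂Q ≤
      ENNReal.ofReal (2 * (Real.exp (2 + δ + δ⁻¹) * (2 ^ J : ℝ) ^ (γ ^ 2 + δ))) := by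
  have hgm : Measurable fun ω => fun i => g i ω := measurable_pi_lambda _ hg.measurable
  have e1 : ∀ ω, ENNReal.ofReal (tiltedSq γ σ i (2 ^ J) (fun i => g i ω) θ) =
      ENNReal.ofReal (Real.exp (logDensity γ σ i (fun i => g i ω) θ) ^ 2 *
        Real.exp (1 * (logDensityDeriv γ σ i (fun i => g i ω) θ / 2 ^ J))) +
      ENNReal.ofReal (Real.exp (logDensity γ σ i (fun i => g i ω) θ) ^ 2 *
        Real.exp (-1 * (logDensityDeriv γ σ i (fun i => g i ω) θ / 2 ^ J))) := fun ω => by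
    rw [← ENNReal.ofReal_add (by positivity) (by positivity)]
    simp only [tiltedSq, one_mul, neg_one_mul, mul_add]
  simp only [e1]
  have hm : Measurable fun ω => ENNReal.ofReal
      (Real.exp (logDensity γ σ i (fun i => g i ω) θ) ^ 2 *
        Real.exp (1 * (logDensityDeriv γ σ i (fun i => g i ω) θ / 2 ^ J))) := by
    have h1 : Measurable fun ω => logDensity γ σ i (fun i => g i ω) θ :=
      measurable_logDensity i hgm measurable_const
    have h2 : Measurable fun ω => logDensityDeriv γ σ i (fun i => g i ω) θ :=
      measurable_logDensityDeriv i hgm measurable_const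
    fun_prop
  rw [lintegral_add_left hm, two_mul, ENNReal.ofReal_add (by positivity) (by positivity)]
  exact add_le_add (hg.lintegral_exp_sq_mul_exp_le hγ hγ1 hσ hi hδ θ (Or.inl rfl))
    (hg.lintegral_exp_sq_mul_exp_le hγ hγ1 hσ hi hδ θ (Or.inr rfl))

/-- The amplitude of the new direction contributes only a constant factor. Fubini then moves the
expectation inside the integral over the angle, where the tilted second moment has a bound
independent of θ; what remains is deterministic. -/
lemma IsGaussianSeq.lintegral_sqNormL4_chaosIncrement_le (hg : IsGaussianSeq Q g)
    (hγ : 0 ≤ γ) (hγ1 : γ ≤ 1) (hσ : ∀ k, |σ k| ≤ 1) {b c δ : ℝ} (hb : 0 ≤ b) (hb' : 4 * b ≤ 2)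
    (hc : 0 < c) (hδ : 0 < δ) (s : Finset ℕ) {J i : ℕ} (hi : i ≤ 2 ^ (J + 1)) :
    ∫⁻ ω, ∫⁻ t, ENNReal.ofReal (sqNormL4 s (fun n => (n : ℝ) ^ (4 * b))
        (chaosIncrement γ σ i (fun i => g i ω) t)) ∂(gaussianReal 0 1) ∂Q ≤
      ENNReal.ofReal ((∫ t, Real.exp (4 * |t| + 4) ∂(gaussianReal 0 1)) *
        (2 * (Real.exp (2 + δ + δ⁻¹) * (2 ^ J : ℝ) ^ (γ ^ 2 + δ)) *
          ∫ θ in (0 : ℝ)..2 * π, incrementWeight σ b (2 ^ J) c i θ)) := by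
  set N : ℝ := 2 ^ J with hN
  have hN0 : 0 < N := by positivity
  set A : ℝ := Real.exp (2 + δ + δ⁻¹) * N ^ (γ ^ 2 + δ) with hA
  have hA0 : 0 ≤ A := by positivity
  set K : ℝ := ∫ t, Real.exp (4 * |t| + 4) ∂(gaussianReal 0 1) with hK
  have hKint : Integrable (fun t => Real.exp (4 * |t| + 4)) (gaussianReal 0 1) := by
    simp only [Real.exp_add]
    exact (integrable_exp_mul_abs_gaussianReal 4).mul_const _
  have hK0 : 0 ≤ K := integral_nonneg fun t => (Real.exp_pos _).le
  have hgm : Measurable fun ω => fun i => g i ω := measurable_pi_lambda _ hg.measurable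
  have hRc := continuous_incrementWeight (σ := σ) b N c i
  have hR0 := incrementWeight_nonneg (σ := σ) (b := b) hN0 hc i
  set μ₀ := volume.restrict (Set.Ioc (0 : ℝ) (2 * π)) with hμ₀
  have hstep : ∀ y t, ENNReal.ofReal (sqNormL4 s (fun n => (n : ℝ) ^ (4 * b))
      (chaosIncrement γ σ i y t)) ≤ ENNReal.ofReal (Real.exp (4 * |t| + 4)) *
      ∫⁻ θ, ENNReal.ofReal (tiltedSq γ σ i N y θ * incrementWeight σ b N c i θ) ∂μ₀ := fun y t => by
    have h := sqNormL4_densityCoeff_increment_le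
      (hasDerivAt_logDensity (γ := γ) (σ := σ) i y) (continuous_logDensityDeriv i y)
      (hasDerivAt_dir σ i) (continuous_dirDeriv σ i) (logDensity_two_pi i y) (dir_two_pi i)
      (abs_dir_le_one hσ i) hb hb' hN0 hc hγ hγ1 s t
    refine (ENNReal.ofReal_le_ofReal h).trans ?_
    rw [ENNReal.ofReal_mul (Real.exp_pos _).le, intervalIntegral.integral_of_le
      Real.two_pi_pos.le, ofReal_integral_eq_lintegral_ofReal]
    · rfl
    · exact (Continuous.integrableOn_Icc ((continuous_tiltedSq i N y).mul hRc)).mono_set Set.Ioc_subset_Icc_self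
    · exact .of_forall fun θ => mul_nonneg (tiltedSq_nonneg i N y θ) (hR0 θ)
  have hKl : ∫⁻ t, ENNReal.ofReal (Real.exp (4 * |t| + 4)) ∂(gaussianReal 0 1) =
      ENNReal.ofReal K :=
    (ofReal_integral_eq_lintegral_ofReal hKint (.of_forall fun t => (Real.exp_pos _).le)).symm
  have hm3 : Measurable fun p : Ω × ℝ =>
      ENNReal.ofReal (tiltedSq γ σ i N (fun i => g i p.1) p.2 * incrementWeight σ b N c i p.2) := by
    have h3 : Measurable fun p : Ω × ℝ => tiltedSq γ σ i N (fun i => g i p.1) p.2 :=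
      measurable_tiltedSq i N (hgm.comp measurable_fst) measurable_snd
    exact (h3.mul (hRc.measurable.comp measurable_snd)).ennreal_ofReal
  calc _ ≤ ∫⁻ ω, ∫⁻ t, ENNReal.ofReal (Real.exp (4 * |t| + 4)) *
        ∫⁻ θ, ENNReal.ofReal (tiltedSq γ σ i N (fun i => g i ω) θ * incrementWeight σ b N c i θ) ∂μ₀
          ∂(gaussianReal 0 1) ∂Q :=
        lintegral_mono fun ω => lintegral_mono fun t => hstep _ t
    _ = ENNReal.ofReal K * ∫⁻ ω, ∫⁻ θ, ENNReal.ofReal (tiltedSq γ σ i N (fun i => g i ω) θ *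
          incrementWeight σ b N c i θ) ∂μ₀ ∂Q := by
        have h4 : Measurable fun t : ℝ => ENNReal.ofReal (Real.exp (4 * |t| + 4)) := by fun_prop
        simp only [lintegral_mul_const _ h4, hKl]
        rw [lintegral_const_mul _ hm3.lintegral_prod_right']
    _ = ENNReal.ofReal K * ∫⁻ θ, ∫⁻ ω, ENNReal.ofReal (tiltedSq γ σ i N (fun i => g i ω) θ *
          incrementWeight σ b N c i θ) ∂Q ∂μ₀ := by
        rw [lintegral_lintegral_swap hm3.aemeasurable]
    _ ≤ ENNReal.ofReal K * ∫⁻ θ, ENNReal.ofReal (2 * A) *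
          ENNReal.ofReal (incrementWeight σ b N c i θ) ∂μ₀ := by
        gcongr with θ
        simp only [ENNReal.ofReal_mul (tiltedSq_nonneg _ _ _ _)]
        have h5 : Measurable fun ω => ENNReal.ofReal (tiltedSq γ σ i N (fun i => g i ω) θ) :=
          (measurable_tiltedSq i N hgm measurable_const).ennreal_ofReal
        rw [lintegral_mul_const _ h5]
        gcongr
        exact hg.lintegral_tiltedSq_le hγ hγ1 hσ hi hδ θ
    _ = _ := by
        have h6 : ENNReal.ofReal (∫ θ, incrementWeight σ b N c i θ ∂μ₀) =
            ∫⁻ θ, ENNReal.ofReal (incrementWeight σ b N c i θ) ∂μ₀ :=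
          ofReal_integral_eq_lintegral_ofReal
            ((Continuous.integrableOn_Icc hRc).mono_set Set.Ioc_subset_Icc_self)
            (.of_forall hR0)
        rw [lintegral_const_mul _ hRc.measurable.ennreal_ofReal, ← h6,
          ← ENNReal.ofReal_mul (by positivity), ← ENNReal.ofReal_mul hK0,
          intervalIntegral.integral_of_le Real.two_pi_pos.le]

end Chaos

/-! ### Summation over the directions of a scale and over all scales. -/

lemma intervalIntegral_incrementWeight {σ : ℕ → ℝ} (b N c : ℝ) (i : ℕ) :
    ∫ θ in (0 : ℝ)..2 * π, incrementWeight σ b N c i θ =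
      c / 2 * (∫ θ in (0 : ℝ)..2 * π, |dir σ i θ|) ^ 2 +
      (2 * c)⁻¹ * (N ^ (4 * b) * (6 * π)) *
        ∫ θ in (0 : ℝ)..2 * π, (dir σ i θ ^ 2 + dirDeriv σ i θ ^ 2 / N ^ 2) := by
  have h1 := continuous_dir σ i
  have h2 := continuous_dirDeriv σ i
  unfold incrementWeight
  rw [intervalIntegral.integral_add (Continuous.intervalIntegrable (by fun_prop) _ _)
    (Continuous.intervalIntegrable (by fun_prop) _ _), intervalIntegral.integral_const_mul,
    intervalIntegral.integral_const_mul]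
  ring

/-- The `L¹` term uses localization of each of the N directions. The Sobolev term uses the frame
bounds ∑ k² ≤ 1 and ∑ k'² ≤ N², and so does not pay a factor N. -/
lemma sum_intervalIntegral_incrementWeight_le {ε : ℝ} (hε : 0 < ε) {J : ℕ} (hJ : 2 ≤ J)
    {b c δ : ℝ} (hc : 0 < c) (hδ : 0 < δ) (hδ1 : δ ≤ 1) :
    ∑ i ∈ Finset.Ico (2 ^ J) (2 ^ (J + 1)),
        ∫ θ in (0 : ℝ)..2 * π, incrementWeight (damping ε) b (2 ^ J) c i θ ≤
      c / 2 * (2 ^ J * (72 / δ * (2 ^ J : ℝ) ^ (δ - 1)) ^ 2) +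
      (2 * c)⁻¹ * ((2 ^ J : ℝ) ^ (4 * b) * (6 * π)) * (4 * π) := by
  set N : ℝ := 2 ^ J with hN
  have hN0 : 0 < N := by positivity
  simp only [intervalIntegral_incrementWeight]
  rw [Finset.sum_add_distrib, ← Finset.mul_sum, ← Finset.mul_sum]
  have h1 : ∑ i ∈ Finset.Ico (2 ^ J) (2 ^ (J + 1)),
      (∫ θ in (0 : ℝ)..2 * π, |dir (damping ε) i θ|) ^ 2 ≤
      2 ^ J * (72 / δ * (2 ^ J : ℝ) ^ (δ - 1)) ^ 2 := by
    calc _ ≤ ∑ _i ∈ Finset.Ico (2 ^ J) (2 ^ (J + 1)), (72 / δ * (2 ^ J : ℝ) ^ (δ - 1)) ^ 2 := by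
          refine Finset.sum_le_sum fun i hi => pow_le_pow_left₀ ?_
            (intervalIntegral_abs_dir_le hε (log_eq_of_mem_Ico hi) hJ hδ hδ1) 2
          exact intervalIntegral.integral_nonneg Real.two_pi_pos.le fun θ _ => abs_nonneg _
      _ = _ := by
          rw [Finset.sum_const, Nat.card_Ico, nsmul_eq_mul, pow_succ, mul_two,
            Nat.add_sub_cancel]
          push_cast
          rfl
  have h2 : ∑ i ∈ Finset.Ico (2 ^ J) (2 ^ (J + 1)), ∫ θ in (0 : ℝ)..2 * π,
      (dir (damping ε) i θ ^ 2 + dirDeriv (damping ε) i θ ^ 2 / N ^ 2) ≤ 4 * π := by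
    have hc1 := continuous_dir (damping ε)
    have hc2 := continuous_dirDeriv (damping ε)
    rw [← intervalIntegral.integral_finsetSum fun i _ =>
      Continuous.intervalIntegrable (by fun_prop) _ _]
    calc _ ≤ ∫ _θ in (0 : ℝ)..2 * π, (2 : ℝ) := by
          refine intervalIntegral.integral_mono_on Real.two_pi_pos.le
            (Continuous.intervalIntegrable (by fun_prop) _ _)
            (Continuous.intervalIntegrable (by fun_prop) _ _) fun θ _ => ?_
          rw [Finset.sum_add_distrib, ← Finset.sum_div]
          have h3 := sum_Ico_dir_sq_le (abs_damping_le_one ε) hJ θ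
          have h4 := sum_Ico_dirDeriv_sq_le (abs_damping_le_one ε) hJ θ
          have h5 : (∑ i ∈ Finset.Ico (2 ^ J) (2 ^ (J + 1)), dirDeriv (damping ε) i θ ^ 2) / N ^ 2
              ≤ 1 := by
            rw [div_le_one (by positivity)]; exact h4
          linarith
      _ = _ := by rw [intervalIntegral.integral_const, smul_eq_mul]; ring
  gcongr

variable {Ω : Type*} [MeasurableSpace Ω] {Q : Measure Ω} [IsProbabilityMeasure Q]
  {g : ℕ → Ω → ℝ} {γ : ℝ}

lemma chaosIncrement_of_log_lt_two {σ : ℕ → ℝ} {i : ℕ} (hi : Nat.log 2 i < 2) (y : ℕ → ℝ)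
    (t : ℝ) (n : ℕ) : chaosIncrement γ σ i y t n = 0 := by
  have h : ∀ θ, dir σ i θ = 0 := fun θ => frameFun_eq_zero_of_lt (fieldCoeff_zero σ) _ hi _ _
  simp [chaosIncrement, densityCoeff, h]

/-- The contribution of the directions of one scale to the `ℓ⁴` norm. -/
lemma IsGaussianSeq.sum_lintegral_chaosIncrement_le (hg : IsGaussianSeq Q g)
    (hγ : 0 ≤ γ) (hγ1 : γ ≤ 1) {b δ : ℝ} (hb : 0 ≤ b) (hb' : 4 * b ≤ 2)
    (hδ : 0 < δ) (hδ1 : δ ≤ 1) (s : Finset ℕ) {ε : ℝ} (hε : 0 < ε) (J : ℕ) :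
    ∑ i ∈ Finset.Ico (2 ^ J) (2 ^ (J + 1)), ∫⁻ ω, ∫⁻ t, ENNReal.ofReal
      (sqNormL4 s (fun n => (n : ℝ) ^ (4 * b)) (chaosIncrement γ (damping ε) i (fun i => g i ω) t))
        ∂(gaussianReal 0 1) ∂Q ≤
      ENNReal.ofReal ((∫ t, Real.exp (4 * |t| + 4) ∂(gaussianReal 0 1)) *
        (2 * Real.exp (2 + δ + δ⁻¹)) * ((72 / δ) ^ 2 / 2 + 12 * π ^ 2) *
        ((2 : ℝ) ^ (γ ^ 2 + 3 * δ + 2 * b - 1 / 2)) ^ J) := by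
  rcases lt_or_ge J 2 with hJ | hJ
  · rw [Finset.sum_eq_zero]
    · exact zero_le
    intro i hi
    have h0 : ∀ y t, sqNormL4 s (fun n => (n : ℝ) ^ (4 * b))
        (chaosIncrement γ (damping ε) i y t) = 0 := fun y t => by
      rw [sqNormL4, Finset.sum_eq_zero, Real.sqrt_zero]
      intro n _
      rw [chaosIncrement_of_log_lt_two (by rw [log_eq_of_mem_Ico hi]; exact hJ)]
      simp
    simp [h0]
  set N : ℝ := 2 ^ J with hN
  have hN0 : 0 < N := by positivity
  have hN1 : 1 ≤ N := one_le_pow₀ (by norm_num)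
  set K : ℝ := ∫ t, Real.exp (4 * |t| + 4) ∂(gaussianReal 0 1) with hK
  have hK0 : 0 ≤ K := integral_nonneg fun t => (Real.exp_pos _).le
  -- Apart from powers N^{O(δ)}, the two terms to balance are c N^{−1} and c^{−1} N^{4b}; this value
  -- of c makes both N^{2b − 1/2}.
  set c : ℝ := N ^ (1 / 2 + 2 * b) with hc
  have hc0 : 0 < c := by positivity
  have hint0 : ∀ i, 0 ≤ ∫ θ in (0 : ℝ)..2 * π, incrementWeight (damping ε) b N c i θ := fun i =>
    intervalIntegral.integral_nonneg Real.two_pi_pos.le fun θ _ =>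
      incrementWeight_nonneg hN0 hc0 i θ
  calc _ ≤ ∑ i ∈ Finset.Ico (2 ^ J) (2 ^ (J + 1)), ENNReal.ofReal (K *
        (2 * (Real.exp (2 + δ + δ⁻¹) * N ^ (γ ^ 2 + δ)) *
          ∫ θ in (0 : ℝ)..2 * π, incrementWeight (damping ε) b N c i θ)) :=
        Finset.sum_le_sum fun i hi => hg.lintegral_sqNormL4_chaosIncrement_le hγ hγ1
          (abs_damping_le_one ε) hb hb' hc0 hδ s (Finset.mem_Ico.1 hi).2.le
    _ = ENNReal.ofReal (K * (2 * (Real.exp (2 + δ + δ⁻¹) * N ^ (γ ^ 2 + δ)) *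
          ∑ i ∈ Finset.Ico (2 ^ J) (2 ^ (J + 1)),
          ∫ θ in (0 : ℝ)..2 * π, incrementWeight (damping ε) b N c i θ)) := by
        rw [← ENNReal.ofReal_sum_of_nonneg fun i _ => by have := hint0 i; positivity,
          Finset.mul_sum, Finset.mul_sum]
    _ ≤ _ := by
        refine ENNReal.ofReal_le_ofReal ?_
        have h1 := sum_intervalIntegral_incrementWeight_le (b := b) hε hJ hc0 hδ hδ1
        rw [← hN] at h1
        have e1 : N ^ (γ ^ 2 + δ) * (c / 2 * (N * (72 / δ * N ^ (δ - 1)) ^ 2)) =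
            (72 / δ) ^ 2 / 2 * N ^ (γ ^ 2 + 3 * δ + 2 * b - 1 / 2) := by
          have h2 : N ^ (γ ^ 2 + 3 * δ + 2 * b - 1 / 2) =
              N ^ (γ ^ 2 + δ) * (c * (N * (N ^ (δ - 1) * N ^ (δ - 1)))) := by
            nth_rw 3 [← Real.rpow_one N]
            rw [hc, ← Real.rpow_add hN0, ← Real.rpow_add hN0, ← Real.rpow_add hN0,
              ← Real.rpow_add hN0]
            congr 1; ring
          rw [h2]; ring
        have e2 : N ^ (γ ^ 2 + δ) * ((2 * c)⁻¹ * (N ^ (4 * b) * (6 * π)) * (4 * π)) =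
            12 * π ^ 2 * N ^ (γ ^ 2 + δ + 2 * b - 1 / 2) := by
          have h2 : N ^ (γ ^ 2 + δ + 2 * b - 1 / 2) = N ^ (γ ^ 2 + δ) * (c⁻¹ * N ^ (4 * b)) := by
            rw [hc, ← Real.rpow_neg hN0.le, ← Real.rpow_add hN0, ← Real.rpow_add hN0]
            congr 1; ring
          rw [h2, mul_inv]; ring
        have e3 : N ^ (γ ^ 2 + δ + 2 * b - 1 / 2) ≤ N ^ (γ ^ 2 + 3 * δ + 2 * b - 1 / 2) :=
          Real.rpow_le_rpow_of_exponent_le hN1 (by linarith)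
        have e4 : ((2 : ℝ) ^ (γ ^ 2 + 3 * δ + 2 * b - 1 / 2)) ^ J =
            N ^ (γ ^ 2 + 3 * δ + 2 * b - 1 / 2) := by
          rw [hN]; exact Real.rpow_pow_comm (by norm_num) _ J
        rw [e4]
        have h3 := mul_le_mul_of_nonneg_left h1 (by positivity : 0 ≤ N ^ (γ ^ 2 + δ))
        rw [mul_add, e1, e2] at h3
        have h4 : N ^ (γ ^ 2 + δ) * ∑ i ∈ Finset.Ico (2 ^ J) (2 ^ (J + 1)),
          ∫ θ in (0 : ℝ)..2 * π, incrementWeight (damping ε) b N c i θ ≤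
          ((72 / δ) ^ 2 / 2 + 12 * π ^ 2) * N ^ (γ ^ 2 + 3 * δ + 2 * b - 1 / 2) := by
          refine h3.trans ?_
          rw [add_mul]
          gcongr
        calc _ = K * (2 * Real.exp (2 + δ + δ⁻¹)) * (N ^ (γ ^ 2 + δ) *
              ∑ i ∈ Finset.Ico (2 ^ J) (2 ^ (J + 1)),
              ∫ θ in (0 : ℝ)..2 * π, incrementWeight (damping ε) b N c i θ) := by ring
          _ ≤ K * (2 * Real.exp (2 + δ + δ⁻¹)) * (((72 / δ) ^ 2 / 2 + 12 * π ^ 2) *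
              N ^ (γ ^ 2 + 3 * δ + 2 * b - 1 / 2)) := by gcongr
          _ = _ := by ring

lemma sum_range_two_pow_eq_sum_Ico {M : Type*} [AddCommMonoid M] (F : ℕ → M) (J : ℕ) :
    ∑ i ∈ Finset.range (2 ^ J), F i =
      F 0 + ∑ j ∈ Finset.range J, ∑ i ∈ Finset.Ico (2 ^ j) (2 ^ (j + 1)), F i := by
  induction J with
  | zero => simp
  | succ J ih =>
    rw [Finset.sum_range_succ, ← add_assoc, ← ih]
    simp only [Finset.range_eq_Ico]
    exact (Finset.sum_Ico_consecutive F (Nat.zero_le (2 ^ J))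
      (Nat.pow_le_pow_right (by norm_num) (by omega))).symm

/-- The weighted `ℓ⁴` norm of the Fourier coefficients of the chaos is bounded uniformly in the
truncation of the field, in its cut-off and in the frequencies considered. -/
lemma IsGaussianSeq.exists_forall_lintegral_chaosCoeff_le (hg : IsGaussianSeq Q g)
    (hγ : 0 ≤ γ) (hγ1 : γ ≤ 1) {b : ℝ} (hb : 0 ≤ b) (hb' : 4 * b < 1 - 2 * γ ^ 2) :
    ∃ C : ℝ, ∀ ε > 0, ∀ s : Finset ℕ, 0 ∉ s → ∀ J : ℕ,
      ∫⁻ ω, ENNReal.ofReal (sqNormL4 s (fun n => (n : ℝ) ^ (4 * b))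
        (chaosCoeff γ (damping ε) (2 ^ J) fun i => g i ω)) ∂Q ≤ ENNReal.ofReal C := by
  -- Then γ² + 2b − 1/2 = −6δ, so the exponent of the geometric ratio `r` is −3δ: the losses of
  -- localization (2δ) and of the second moment (δ) leave half the margin.
  set δ : ℝ := (1 - 2 * γ ^ 2 - 4 * b) / 12 with hδ
  have hδ0 : 0 < δ := by rw [hδ]; linarith
  have hδ1 : δ ≤ 1 := by rw [hδ]; nlinarith [sq_nonneg γ]
  set B : ℝ := (∫ t, Real.exp (4 * |t| + 4) ∂(gaussianReal 0 1)) *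
        (2 * Real.exp (2 + δ + δ⁻¹)) * ((72 / δ) ^ 2 / 2 + 12 * π ^ 2) with hB
  have hB0 : 0 ≤ B := by
    have : 0 ≤ ∫ t, Real.exp (4 * |t| + 4) ∂(gaussianReal 0 1) :=
      integral_nonneg fun t => (Real.exp_pos _).le
    positivity
  set r : ℝ := (2 : ℝ) ^ (γ ^ 2 + 3 * δ + 2 * b - 1 / 2) with hr
  have hr0 : 0 ≤ r := by positivity
  have hr1 : r < 1 := Real.rpow_lt_one_of_one_lt_of_neg (by norm_num) (by rw [hδ]; linarith)
  refine ⟨6 * (B * (1 - r)⁻¹), fun ε hε s hs J => ?_⟩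
  refine (hg.lintegral_sqNormL4_chaosCoeff_le hγ hγ1 (abs_damping_le_one ε) hs
    (fun n => by positivity) (2 ^ J)).trans ?_
  rw [sum_range_two_pow_eq_sum_Ico]
  have h0 : ∀ y t, sqNormL4 s (fun n => (n : ℝ) ^ (4 * b))
      (chaosIncrement γ (damping ε) 0 y t) = 0 := fun y t => by
    rw [sqNormL4, Finset.sum_eq_zero, Real.sqrt_zero]
    intro n _
    rw [chaosIncrement_of_log_lt_two (by simp)]
    simp
  simp only [h0, ENNReal.ofReal_zero, lintegral_zero, zero_add]
  rw [ENNReal.ofReal_mul (by norm_num), show ENNReal.ofReal 6 = 6 by simp]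
  gcongr
  calc _ ≤ ∑ j ∈ Finset.range J, ENNReal.ofReal (B * r ^ j) :=
        Finset.sum_le_sum fun j _ =>
          hg.sum_lintegral_chaosIncrement_le hγ hγ1 hb (by nlinarith [sq_nonneg γ]) hδ0 hδ1 s hε j
    _ = ENNReal.ofReal (B * ∑ j ∈ Finset.range J, r ^ j) := by
        rw [Finset.mul_sum, ENNReal.ofReal_sum_of_nonneg fun j _ => by positivity]
    _ ≤ _ := by
        refine ENNReal.ofReal_le_ofReal (mul_le_mul_of_nonneg_left ?_ hB0)
        rw [← tsum_geometric_of_lt_one hr0 hr1]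
        exact (summable_geometric_of_lt_one hr0 hr1).sum_le_tsum _ fun _ _ => by positivity

/-! ### Fourier expansion of the logarithmic kernel. -/

section LogKernel

/-- Both |1 − w| ≤ |1 − rw| + (1 − r) and 1 − r ≤ |1 − rw|. The resulting lower bound for |1 − rw|
is uniform in r and dominates the damped kernels as r tends to 1. -/
lemma norm_one_sub_le_two_mul {w : ℂ} (hw : ‖w‖ = 1) {r : ℝ} (h0 : 0 ≤ r) (hr : r ≤ 1) :
    ‖1 - w‖ ≤ 2 * ‖1 - r * w‖ := by
  have h1 : 1 - r ≤ ‖1 - r * w‖ := by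
    have := norm_sub_norm_le (1 : ℂ) (r * w)
    rwa [norm_one, norm_mul, hw, mul_one, Complex.norm_real, Real.norm_of_nonneg h0] at this
  have h2 : ‖1 - w‖ ≤ ‖1 - r * w‖ + ‖(r - 1 : ℂ) * w‖ := by
    refine le_trans (le_of_eq ?_) (norm_add_le _ _)
    congr 1; ring
  have h3 : ‖(r - 1 : ℂ) * w‖ = 1 - r := by
    rw [norm_mul, hw, mul_one, ← Complex.ofReal_one, ← Complex.ofReal_sub, Complex.norm_real,
      Real.norm_eq_abs, abs_of_nonpos (by linarith)]
    ring
  linarith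

lemma abs_log_norm_one_sub_le {w : ℂ} (hw : ‖w‖ = 1) (hw1 : w ≠ 1) {r : ℝ} (h0 : 0 ≤ r)
    (hr : r ≤ 1) :
    |Real.log ‖1 - r * w‖| ≤ |Real.log ‖1 - w‖| + Real.log 2 := by
  have h1 : 0 < ‖1 - w‖ := norm_pos_iff.2 (sub_ne_zero.2 hw1.symm)
  have h2 := norm_one_sub_le_two_mul hw h0 hr
  have h3 : 0 < ‖1 - r * w‖ := by linarith
  have h4 : ‖1 - r * w‖ ≤ 2 := by
    refine (norm_sub_le _ _).trans ?_
    rw [norm_one, norm_mul, hw, mul_one, Complex.norm_real, Real.norm_of_nonneg h0]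
    linarith
  have h5 := Real.log_le_log h3 h4
  have h6 := Real.log_le_log h1 h2
  rw [Real.log_mul (by norm_num) h3.ne'] at h6
  rw [abs_le]
  constructor
  · linarith [neg_abs_le (Real.log ‖1 - w‖)]
  · linarith [abs_nonneg (Real.log ‖1 - w‖)]

lemma hasSum_pow_mul_re_pow_div {w : ℂ} (hw : ‖w‖ = 1) {r : ℝ} (h0 : 0 ≤ r) (hr : r < 1) :
    HasSum (fun k : ℕ => r ^ k * ((w ^ k).re / k)) (-Real.log ‖1 - r * w‖) := by
  have h := Complex.hasSum_taylorSeries_neg_log (z := r * w)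
    (by rwa [norm_mul, hw, mul_one, Complex.norm_real, Real.norm_of_nonneg h0])
  have h2 := Complex.hasSum_re h
  rw [Complex.neg_re, Complex.log_re] at h2
  convert h2 using 2 with k
  rw [mul_pow, ← Complex.ofReal_pow, ← Complex.ofReal_natCast, mul_div_assoc,
    Complex.re_ofReal_mul, Complex.div_ofReal_re]

/-- The covariance kernel as a function of the difference of the angles. -/
noncomputable def logKernel (t : UnitCircle) : ℝ := -Real.log ‖1 - (AddCircle.toCircle t : ℂ)‖

lemma covKernel_eq (θ θ' : UnitCircle) : covKernel θ θ' = logKernel (θ - θ') := by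
  rw [covKernel, logKernel, one_div, Real.log_inv]
  congr 2
  have h : (AddCircle.toCircle θ' : ℂ) ≠ 0 := Circle.coe_ne_zero _
  rw [← mul_one ‖(AddCircle.toCircle θ : ℂ) - _‖, ← Circle.norm_coe (AddCircle.toCircle (-θ')),
    ← norm_mul, sub_mul, ← Circle.coe_mul, ← Circle.coe_mul, ← AddCircle.toCircle_add,
    ← AddCircle.toCircle_add, ← sub_eq_add_neg, add_neg_cancel, AddCircle.toCircle_zero,
    Circle.coe_one, norm_sub_rev]

lemma measurable_logKernel : Measurable logKernel := by
  unfold logKernel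
  have : Continuous fun t : UnitCircle => (AddCircle.toCircle t : ℂ) :=
    continuous_induced_dom.comp AddCircle.continuous_toCircle
  fun_prop

lemma toCircle_coe (t : ℝ) :
    (AddCircle.toCircle (t : UnitCircle) : ℂ) = Complex.exp (t * Complex.I) := by
  rw [AddCircle.toCircle_apply_mk, Circle.coe_exp]
  congr 2
  push_cast
  field_simp

lemma integrable_logKernel : Integrable logKernel := by
  have h := circleIntegrable_log_norm_sub_const (a := 1) (c := 0) 1
  rw [CircleIntegrable, intervalIntegrable_iff_integrableOn_Ioc_of_le Real.two_pi_pos.le] at h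
  have h2 : IntegrableOn (fun t : ℝ => logKernel (t : UnitCircle)) (Set.Ioc 0 (0 + 2 * π)) := by
    rw [zero_add]
    refine (h.neg).congr (ae_of_all _ fun t => ?_)
    simp only [Pi.neg_apply, logKernel, toCircle_coe, circleMap, zero_add, Complex.ofReal_one,
      one_mul]
    rw [norm_sub_rev]
  exact ((AddCircle.measurePreserving_mk (2 * π) 0).integrable_comp
    measurable_logKernel.aestronglyMeasurable).1 h2

/-- `cos (kθ)` and `sin (kθ)` on the circle. -/
noncomputable def trig (b : Bool) (k : ℕ) : C(UnitCircle, ℝ) where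
  toFun θ := if b then (fourier (k : ℤ) θ).im else (fourier (k : ℤ) θ).re
  continuous_toFun := by
    cases b
    · exact Complex.continuous_re.comp (fourier (k : ℤ)).continuous
    · exact Complex.continuous_im.comp (fourier (k : ℤ)).continuous

lemma trig_false_coe (k : ℕ) (t : ℝ) : trig false k (t : UnitCircle) = Real.cos (k * t) := by
  simp only [trig, ContinuousMap.coe_mk, Bool.false_eq_true, if_false, fourier_coe_apply]
  rw [← Complex.exp_ofReal_mul_I_re]
  congr 2
  push_cast
  field_simp

lemma trig_true_coe (k : ℕ) (t : ℝ) : trig true k (t : UnitCircle) = Real.sin (k * t) := by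
  simp only [trig, ContinuousMap.coe_mk, if_true, fourier_coe_apply]
  rw [← Complex.exp_ofReal_mul_I_im]
  congr 2
  push_cast
  field_simp

lemma abs_trig_le_one (b : Bool) (k : ℕ) (θ : UnitCircle) : |trig b k θ| ≤ 1 := by
  induction θ using QuotientAddGroup.induction_on with
  | H t =>
    cases b
    · rw [trig_false_coe]; exact Real.abs_cos_le_one _
    · rw [trig_true_coe]; exact Real.abs_sin_le_one _

lemma re_toCircle_sub_pow (k : ℕ) (θ θ' : UnitCircle) :
    ((AddCircle.toCircle (θ - θ') : ℂ) ^ k).re = ∑ b, trig b k θ * trig b k θ' := by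
  induction θ using QuotientAddGroup.induction_on with
  | H t =>
    induction θ' using QuotientAddGroup.induction_on with
    | H t' =>
      rw [Fintype.sum_bool, trig_true_coe, trig_true_coe, trig_false_coe, trig_false_coe]
      rw [← QuotientAddGroup.mk_sub, toCircle_coe, ← Complex.exp_nat_mul, ← mul_assoc,
        ← Complex.ofReal_natCast, ← Complex.ofReal_mul, Complex.exp_ofReal_mul_I_re, mul_sub,
        Real.cos_sub]
      ring

/-- The integral of `f` against `cos (kθ)` or `sin (kθ)`. -/
noncomputable def trigCoeff (b : Bool) (k : ℕ) (f : UnitCircle → ℝ) : ℝ :=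
  ∫ θ, trig b k θ * f θ

lemma ae_prod_sub_ne_zero :
    ∀ᵐ p : UnitCircle × UnitCircle ∂(volume.prod volume), p.1 - p.2 ≠ 0 := by
  rw [Measure.ae_prod_iff_ae_ae]
  · refine ae_of_all _ fun x => ?_
    simp only [ne_eq, sub_eq_zero]
    refine measure_mono_null (t := {x}) (fun y hy => ?_) ?_
    · simpa [eq_comm] using hy
    · rw [← Metric.closedBall_zero, AddCircle.volume_closedBall]
      simp [Real.two_pi_pos.le]
  · exact (measurableSet_eq_fun (measurable_fst.sub measurable_snd) measurable_const).compl

/-- For r < 1 the factor r^k makes the expansion absolutely convergent, so it can be integrated term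
by term. -/
lemma hasSum_integral_dampedKernel {f g : UnitCircle → ℝ} (hf : Integrable f) (hg : Integrable g)
    {r : ℝ} (h0 : 0 ≤ r) (hr : r < 1) :
    HasSum (fun k : ℕ => (∑ b, trigCoeff b k f * trigCoeff b k g) / k * r ^ k)
      (∫ p : UnitCircle × UnitCircle,
        -Real.log ‖1 - r * (AddCircle.toCircle (p.1 - p.2) : ℂ)‖ * f p.1 * g p.2
          ∂(volume.prod volume)) := by
  have hti : ∀ b k (h : UnitCircle → ℝ), Integrable h → Integrable fun θ => trig b k θ * h θ :=
    fun b k h hh => hh.bdd_mul (trig b k).continuous.aestronglyMeasurable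
      (ae_of_all _ fun θ => abs_trig_le_one b k θ)
  set F : ℕ → UnitCircle × UnitCircle → ℝ := fun k p =>
    r ^ k / k * ∑ b, (trig b k p.1 * f p.1) * (trig b k p.2 * g p.2) with hF
  have hFi : ∀ k, Integrable (F k) (volume.prod volume) := fun k =>
    (integrable_finsetSum _ fun b _ => (hti b k f hf).mul_prod (hti b k g hg)).const_mul _
  have hFint : ∀ k, ∫ p, F k p ∂(volume.prod volume) =
      (∑ b, trigCoeff b k f * trigCoeff b k g) / k * r ^ k := fun k => by
    simp only [hF]
    rw [integral_const_mul, integral_finsetSum _ fun b _ =>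
      (hti b k f hf).mul_prod (hti b k g hg)]
    rw [Finset.sum_congr rfl fun b _ => integral_prod_mul (fun θ => trig b k θ * f θ)
      (fun θ => trig b k θ * g θ)]
    simp only [trigCoeff]
    ring
  have hFsum : ∀ p, ∑' k, F k p =
      -Real.log ‖1 - r * (AddCircle.toCircle (p.1 - p.2) : ℂ)‖ * f p.1 * g p.2 := fun p => by
    have := ((hasSum_pow_mul_re_pow_div (Circle.norm_coe (AddCircle.toCircle (p.1 - p.2))) h0
      hr).mul_right (f p.1)).mul_right (g p.2)
    rw [← this.tsum_eq]
    refine tsum_congr fun k => ?_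
    simp only [hF]
    rw [re_toCircle_sub_pow, Finset.mul_sum]
    simp only [Fintype.sum_bool]
    ring
  have hn : ∀ k, ∫ p, ‖F k p‖ ∂(volume.prod volume) ≤
      2 * (∫ p : UnitCircle × UnitCircle, ‖f p.1‖ * ‖g p.2‖ ∂(volume.prod volume)) * r ^ k := by
    intro k
    rw [mul_right_comm, ← integral_const_mul]
    refine integral_mono (hFi k).norm ((hf.norm.mul_prod hg.norm).const_mul _) fun p => ?_
    have h1 : |∑ b, (trig b k p.1 * f p.1) * (trig b k p.2 * g p.2)| ≤ 2 * (|f p.1| * |g p.2|) := by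
      refine (Finset.abs_sum_le_sum_abs _ _).trans ?_
      rw [Fintype.sum_bool, two_mul (|f p.1| * |g p.2|)]
      refine add_le_add ?_ ?_ <;>
      · rw [abs_mul, abs_mul, abs_mul]
        refine mul_le_mul ?_ ?_ (by positivity) (by positivity) <;>
        exact mul_le_of_le_one_left (abs_nonneg _) (abs_trig_le_one _ _ _)
    have h2 : r ^ k / k ≤ r ^ k := by
      rcases Nat.eq_zero_or_pos k with rfl | hk
      · simp
      · exact div_le_self (by positivity) (by exact_mod_cast hk)
    simp only [hF, Real.norm_eq_abs, abs_mul (r ^ k / k)]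
    rw [abs_of_nonneg (by positivity)]
    calc _ ≤ r ^ k * (2 * (|f p.1| * |g p.2|)) := by gcongr
      _ = _ := by ring
  have h := hasSum_integral_of_summable_integral_norm hFi
    (Summable.of_nonneg_of_le (fun k => integral_nonneg fun _ => norm_nonneg _) hn
      ((summable_geometric_of_lt_one h0 hr).mul_left _))
  simp only [hFsum, hFint] at h
  exact h

/-- Expansion of the energy of the kernel `ln (1 / |e^{iθ} - e^{iθ'}|)` along the Fourier basis. -/
lemma integral_covKernel_mul {f g : UnitCircle → ℝ} (hf : Measurable f) (hg : Measurable g)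
    {A B : ℝ} (hA : ∀ θ, |f θ| ≤ A) (hB : ∀ θ, |g θ| ≤ B)
    (hs : Summable fun k : ℕ => (∑ b, trigCoeff b k f * trigCoeff b k g) / k) :
    ∫ θ, ∫ θ', covKernel θ θ' * f θ * g θ' =
      ∑' k : ℕ, (∑ b, trigCoeff b k f * trigCoeff b k g) / k := by
  have hfi : Integrable f := .of_bound hf.aestronglyMeasurable A (ae_of_all _ hA)
  have hgi : Integrable g := .of_bound hg.aestronglyMeasurable B (ae_of_all _ hB)
  have hA0 : 0 ≤ A := (abs_nonneg _).trans (hA 0)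
  have hK : Integrable (fun p : UnitCircle × UnitCircle => logKernel (p.1 - p.2))
      (volume.prod volume) := by
    have := Integrable.convolution_integrand (ContinuousLinearMap.mul ℝ ℝ)
      (integrable_const (1 : ℝ) : Integrable (fun _ : UnitCircle => (1 : ℝ))) integrable_logKernel
    simpa using this
  have hbd : Integrable (fun p : UnitCircle × UnitCircle =>
      (|logKernel (p.1 - p.2)| + Real.log 2) * (A * B)) (volume.prod volume) :=
    (hK.abs.add (integrable_const _)).mul_const _
  have hfg : ∀ p : UnitCircle × UnitCircle, |f p.1| * |g p.2| ≤ A * B := fun p =>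
    mul_le_mul (hA _) (hB _) (abs_nonneg _) hA0
  have hint : Integrable (fun p : UnitCircle × UnitCircle => covKernel p.1 p.2 * f p.1 * g p.2)
      (volume.prod volume) := by
    refine hbd.mono' ?_ (ae_of_all _ fun p => ?_)
    · simp only [covKernel_eq]
      exact (((measurable_logKernel.comp (measurable_fst.sub measurable_snd)).mul
        (hf.comp measurable_fst)).mul (hg.comp measurable_snd)).aestronglyMeasurable
    · rw [covKernel_eq, Real.norm_eq_abs, abs_mul, abs_mul, mul_assoc]
      exact mul_le_mul (le_add_of_nonneg_right (Real.log_nonneg (by norm_num))) (hfg p)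
        (by positivity) (by have := Real.log_nonneg (x := 2) (by norm_num); positivity)
  rw [← integral_prod _ hint]
  -- The identity is available for the damped kernels only. As r tends to 1, the integrals converge
  -- by domination and the series by Abel's theorem, which needs only the convergence of the
  -- undamped series.
  have hlim1 : Tendsto (fun r : ℝ => ∫ p : UnitCircle × UnitCircle,
      -Real.log ‖1 - r * (AddCircle.toCircle (p.1 - p.2) : ℂ)‖ * f p.1 * g p.2
        ∂(volume.prod volume)) (𝓝[<] 1)
      (𝓝 (∫ p : UnitCircle × UnitCircle, covKernel p.1 p.2 * f p.1 * g p.2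
        ∂(volume.prod volume))) := by
    have hev : ∀ᶠ r : ℝ in 𝓝[<] 1, 0 ≤ r ∧ r ≤ 1 := by
      filter_upwards [Ioo_mem_nhdsLT (show (0 : ℝ) < 1 by norm_num)] with r hr
      exact ⟨hr.1.le, hr.2.le⟩
    have hne : ∀ᵐ p : UnitCircle × UnitCircle ∂(volume.prod volume),
        (AddCircle.toCircle (p.1 - p.2) : ℂ) ≠ 1 := by
      filter_upwards [ae_prod_sub_ne_zero] with p hp h
      refine hp (AddCircle.injective_toCircle Real.two_pi_pos.ne' ?_)
      rw [AddCircle.toCircle_zero]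
      exact Circle.ext h
    refine tendsto_integral_filter_of_dominated_convergence _ ?_ ?_ hbd ?_
    · refine Eventually.of_forall fun r => Measurable.aestronglyMeasurable ?_
      have hc : Continuous fun t : UnitCircle => (AddCircle.toCircle t : ℂ) :=
        continuous_induced_dom.comp AddCircle.continuous_toCircle
      have hm : Measurable fun t : UnitCircle =>
        -Real.log ‖1 - r * (AddCircle.toCircle t : ℂ)‖ := by fun_prop
      exact ((hm.comp (measurable_fst.sub measurable_snd)).mul
        (hf.comp measurable_fst)).mul (hg.comp measurable_snd)
    · filter_upwards [hev] with r hr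
      filter_upwards [hne] with p hp
      rw [Real.norm_eq_abs, abs_mul, abs_mul, abs_neg, mul_assoc]
      refine mul_le_mul ?_ (hfg p) (by positivity)
        (by have := Real.log_nonneg (x := 2) (by norm_num); positivity)
      rw [logKernel, abs_neg]
      exact abs_log_norm_one_sub_le (Circle.norm_coe _) hp hr.1 hr.2
    · filter_upwards [hne] with p hp
      have h1 : ‖1 - ((1 : ℝ) : ℂ) * (AddCircle.toCircle (p.1 - p.2) : ℂ)‖ ≠ 0 := by
        rw [Complex.ofReal_one, one_mul]
        exact norm_ne_zero_iff.2 (sub_ne_zero.2 hp.symm)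
      have h2 : ContinuousAt (fun r : ℝ =>
          -Real.log ‖1 - r * (AddCircle.toCircle (p.1 - p.2) : ℂ)‖ * f p.1 * g p.2) 1 := by
        have : ContinuousAt (fun r : ℝ => ‖1 - (r : ℂ) * (AddCircle.toCircle (p.1 - p.2) : ℂ)‖) 1 := by
          fun_prop
        exact (((this.log h1).neg).mul_const _).mul_const _
      have h3 := h2.tendsto.mono_left (nhdsWithin_le_nhds (s := Set.Iio 1))
      rwa [Complex.ofReal_one, one_mul, ← logKernel, ← covKernel_eq] at h3
  refine tendsto_nhds_unique hlim1 ?_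
  refine (Real.tendsto_tsum_powerSeries_nhdsWithin_lt hs.hasSum.tendsto_sum_nat).congr' ?_
  filter_upwards [Ioo_mem_nhdsLT (show (0 : ℝ) < 1 by norm_num)] with r hr
  exact (hasSum_integral_dampedKernel hfi hgi hr.1.le hr.2).tsum_eq

end LogKernel

/-! ### Orthogonality of the modes, and their damping by arc averages. -/

section TrigCoeff

lemma integral_fourier_of_ne_zero {n : ℤ} (hn : n ≠ 0) :
    ∫ θ : UnitCircle, (fourier n θ : ℂ) = 0 :=
  integral_eq_zero_of_add_right_eq_neg (fourier_add_half_inv_index hn Real.two_pi_pos)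

lemma integral_fourier_mul_conj (k l : ℕ) :
    ∫ θ : UnitCircle, (fourier (k : ℤ) θ : ℂ) * (starRingEnd ℂ) (fourier (l : ℤ) θ) =
      if k = l then 2 * π else 0 := by
  have h : ∀ θ : UnitCircle, (fourier (k : ℤ) θ : ℂ) * (starRingEnd ℂ) (fourier (l : ℤ) θ) =
      fourier ((k : ℤ) - l) θ := fun θ => by
    rw [sub_eq_add_neg, fourier_add, fourier_neg]
  simp only [h]
  split_ifs with hkl
  · rw [hkl]
    simp only [sub_self, fourier_zero]
    rw [integral_const, measureReal_def, AddCircle.measure_univ,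
      ENNReal.toReal_ofReal Real.two_pi_pos.le]
    simp
  · exact integral_fourier_of_ne_zero (by omega)

lemma integral_fourier_mul {k l : ℕ} (hl : 0 < l) :
    ∫ θ : UnitCircle, (fourier (k : ℤ) θ : ℂ) * fourier (l : ℤ) θ = 0 := by
  simp only [← fourier_add]
  exact integral_fourier_of_ne_zero (by omega)

lemma integrable_of_continuous_circle {f : UnitCircle → ℂ} (hf : Continuous f) : Integrable f :=
  hf.integrable_of_hasCompactSupport (HasCompactSupport.of_compactSpace f)

/-- With e_k = e^{ikθ}, the real and imaginary parts of e_k (conj e_l ± e_l) are ± 2 times the four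
products of sines and cosines. The integral of e_k e_l vanishes because l > 0. -/
lemma trigCoeff_trig (b c : Bool) (k : ℕ) {l : ℕ} (hl : 0 < l) :
    trigCoeff b k (trig c l) = if b = c ∧ k = l then π else 0 := by
  have h1 := integral_fourier_mul_conj k l
  have h2 := integral_fourier_mul (k := k) hl
  have i1 : Integrable fun θ : UnitCircle =>
      (fourier (k : ℤ) θ : ℂ) * (starRingEnd ℂ) (fourier (l : ℤ) θ) :=
    integrable_of_continuous_circle ((fourier (k : ℤ)).continuous.mul
      (Complex.continuous_conj.comp (fourier (l : ℤ)).continuous))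
  have i2 : Integrable fun θ : UnitCircle => (fourier (k : ℤ) θ : ℂ) * fourier (l : ℤ) θ :=
    integrable_of_continuous_circle ((fourier (k : ℤ)).continuous.mul
      (fourier (l : ℤ)).continuous)
  have hadd := integral_add i1 i2
  have hsub := integral_sub i1 i2
  rw [h1, h2] at hadd hsub
  rw [add_zero] at hadd
  rw [sub_zero] at hsub
  have er : ∀ {f : UnitCircle → ℂ}, Integrable f → ∫ θ, (f θ).re = (∫ θ, f θ).re := fun h =>
    integral_re h
  have ei : ∀ {f : UnitCircle → ℂ}, Integrable f → ∫ θ, (f θ).im = (∫ θ, f θ).im := fun h =>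
    integral_im h
  have hadd_re := er (i1.add i2)
  have hadd_im := ei (i1.add i2)
  have hsub_re := er (i1.sub i2)
  have hsub_im := ei (i1.sub i2)
  simp only [Pi.add_apply, Pi.sub_apply] at hadd_re hadd_im hsub_re hsub_im
  rw [hadd] at hadd_re hadd_im
  rw [hsub] at hsub_re hsub_im
  simp only [Complex.add_re, Complex.add_im, Complex.sub_re, Complex.sub_im, Complex.mul_re,
    Complex.mul_im, Complex.conj_re, Complex.conj_im] at hadd_re hadd_im hsub_re hsub_im
  have key : ∀ (a : ℝ) {x : ℝ} {f g : UnitCircle → ℝ}, ∫ θ, f θ = x → (∀ θ, g θ = a * f θ) →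
      ∫ θ, g θ = a * x := fun a x f g h hfg => by
    rw [← h, ← integral_const_mul]
    exact integral_congr_ae (ae_of_all _ hfg)
  rw [trigCoeff]
  cases b <;> cases c
  · rw [key (1 / 2) hadd_re fun θ => by simp only [trig, ContinuousMap.coe_mk]; simp; ring,
      Complex.ofReal_re]
    split_ifs <;> simp_all
  · rw [key (-1 / 2) hsub_im fun θ => by simp only [trig, ContinuousMap.coe_mk]; simp; ring,
      Complex.ofReal_im]
    simp
  · rw [key (1 / 2) hadd_im fun θ => by simp only [trig, ContinuousMap.coe_mk]; simp; ring,
      Complex.ofReal_im]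
    simp
  · rw [key (1 / 2) hsub_re fun θ => by simp only [trig, ContinuousMap.coe_mk]; simp; ring,
      Complex.ofReal_re]
    split_ifs <;> simp_all

lemma intervalIntegral_trig_add (b : Bool) (k : ℕ) (x : ℝ) {ε : ℝ} (hε : 0 < ε) :
    ∫ v in -ε..ε, trig b k ((v + x : ℝ) : UnitCircle) =
      2 * ε * (damping ε k * trig b k (x : UnitCircle)) := by
  cases b
  · simp only [trig_false_coe, add_comm _ x]
    exact intervalIntegral_cos_add k x hε
  · simp only [trig_true_coe]
    rcases Nat.eq_zero_or_pos k with rfl | hk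
    · simp
    have hk' : (k : ℝ) ≠ 0 := by positivity
    have h : ∀ y : ℝ, Real.sin (k * y) = Real.cos (k * (y - π / (2 * k))) := fun y => by
      rw [← Real.cos_sub_pi_div_two]
      congr 1
      field_simp
    simp only [h]
    rw [damping, ← intervalIntegral_cos_add k (x - π / (2 * k)) hε]
    congr 1
    ext v
    congr 2
    ring

/-- The normalized indicator of an arc. -/
noncomputable def arcFun (ε : ℝ) (x : UnitCircle) : UnitCircle → ℝ :=
  (Metric.closedBall x ε).indicator fun _ => (2 * ε)⁻¹

lemma measurable_arcFun (ε : ℝ) (x : UnitCircle) : Measurable (arcFun ε x) :=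
  measurable_const.indicator measurableSet_closedBall

lemma abs_arcFun_le {ε : ℝ} (hε : 0 < ε) (x θ : UnitCircle) : |arcFun ε x θ| ≤ (2 * ε)⁻¹ := by
  have h : 0 ≤ (2 * ε)⁻¹ := by positivity
  by_cases hθ : θ ∈ Metric.closedBall x ε
  · rw [arcFun, Set.indicator_of_mem hθ, abs_of_nonneg h]
  · rw [arcFun, Set.indicator_of_notMem hθ, abs_zero]
    exact h

lemma arcAverage_ae_eq (ε : ℝ) (x : UnitCircle) : arcAverage ε x =ᵐ[volume] arcFun ε x :=
  indicatorConstLp_coeFn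

/-- Averaging over an arc acts diagonally on the modes. The condition ε < π lets the arc lift to an
interval inside one period. -/
lemma trigCoeff_arcFun {ε : ℝ} (hε : 0 < ε) (hεπ : ε < π) (b : Bool) (k : ℕ) (x : UnitCircle) :
    trigCoeff b k (arcFun ε x) = damping ε k * trig b k x := by
  induction x using QuotientAddGroup.induction_on with
  | H t =>
  rw [trigCoeff, ← integral_add_right_eq_self _ ((t : ℝ) : UnitCircle),
    ← AddCircle.intervalIntegral_preimage (2 * π) (-π), show -π + 2 * π = π by ring,
    intervalIntegral.integral_of_le (by linarith)]
  have h1 : ∀ v ∈ Set.Ioc (-π) π,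
      trig b k ((v : UnitCircle) + (t : UnitCircle)) *
        arcFun ε ((t : ℝ) : UnitCircle) ((v : UnitCircle) + (t : UnitCircle)) =
      (Set.Icc (-ε) ε).indicator
        (fun v : ℝ => trig b k ((v + t : ℝ) : UnitCircle) * (2 * ε)⁻¹) v := fun v hv => by
    have hn : ‖(v : UnitCircle)‖ = |v| := by
      rw [AddCircle.norm_coe_eq_abs_iff _ Real.two_pi_pos.ne', abs_of_pos Real.two_pi_pos, abs_le]
      constructor <;> linarith [hv.1, hv.2]
    have hm : ((v : UnitCircle) + (t : UnitCircle)) ∈ Metric.closedBall ((t : ℝ) : UnitCircle) ε ↔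
        v ∈ Set.Icc (-ε) ε := by
      rw [Metric.mem_closedBall, dist_eq_norm, add_sub_cancel_right, hn, Set.mem_Icc, abs_le]
    by_cases h : v ∈ Set.Icc (-ε) ε
    · rw [arcFun, Set.indicator_of_mem (hm.2 h), Set.indicator_of_mem h]
      rfl
    · rw [arcFun, Set.indicator_of_notMem (mt hm.1 h), Set.indicator_of_notMem h, mul_zero]
  have hsub : Set.Icc (-ε) ε ⊆ Set.Ioc (-π) π := fun v hv =>
    ⟨by linarith [hv.1], by linarith [hv.2]⟩
  rw [setIntegral_congr_fun measurableSet_Ioc h1, setIntegral_indicator measurableSet_Icc,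
    Set.inter_eq_self_of_subset_right hsub,
    integral_Icc_eq_integral_Ioc, ← intervalIntegral.integral_of_le (by linarith),
    intervalIntegral.integral_mul_const, intervalIntegral_trig_add b k t hε]
  field_simp

lemma abs_damping_le {ε : ℝ} (hε : 0 < ε) (k : ℕ) : |damping ε k| ≤ ε⁻¹ * (k : ℝ)⁻¹ ∨ k = 0 := by
  rcases Nat.eq_zero_or_pos k with rfl | hk
  · exact Or.inr rfl
  left
  have h : (k : ℝ) * ε ≠ 0 := by positivity
  rw [damping, Real.sinc_of_ne_zero h, abs_div, abs_of_nonneg (by positivity : 0 ≤ (k : ℝ) * ε),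
    div_le_iff₀ (by positivity)]
  refine (Real.abs_sin_le_one _).trans (le_of_eq ?_)
  field_simp

/-- One of the two factors sinc(kε) is bounded by 1/(kε) and the other by 1, so the terms are
O(k^{−2}). -/
lemma summable_damping_sq_div {ε : ℝ} (hε : 0 < ε) :
    Summable fun k : ℕ => damping ε k ^ 2 / k := by
  refine Summable.of_nonneg_of_le (fun k => by positivity) (fun k => ?_)
    ((Real.summable_nat_pow_inv.2 one_lt_two).mul_left ε⁻¹)
  rcases abs_damping_le hε k with h | rfl
  · rw [← sq_abs, sq, div_eq_mul_inv]
    calc |damping ε k| * |damping ε k| * (k : ℝ)⁻¹ ≤ ε⁻¹ * (k : ℝ)⁻¹ * 1 * (k : ℝ)⁻¹ := by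
          gcongr
          exact abs_damping_le_one ε k
      _ = _ := by ring
  · simp

lemma sum_trig_sq (k : ℕ) (x : UnitCircle) : ∑ b, trig b k x * trig b k x = 1 := by
  have := re_toCircle_sub_pow k x x
  simpa using this.symm

end TrigCoeff

/-! ### Centered Gaussian vectors are determined by their covariance. -/

section GaussianLaw

lemma integral_sum_mul_sum_eq {Ω ι : Type*} [Fintype ι] [MeasurableSpace Ω] {P : Measure Ω}
    {X : Ω → ι → ℝ} (hX : ∀ i, MemLp (fun ω => X ω i) 2 P) (c : ι → ℝ) :
    ∫ ω, (∑ i, c i * X ω i) ^ 2 ∂P = ∑ i, ∑ j, c i * c j * ∫ ω, X ω i * X ω j ∂P := by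
  have hint : ∀ i j, Integrable (fun ω => c i * c j * (X ω i * X ω j)) P := fun i j =>
    ((hX i).integrable_mul (hX j)).const_mul _
  have h1 : ∀ ω, (∑ i, c i * X ω i) ^ 2 = ∑ i, ∑ j, c i * c j * (X ω i * X ω j) := fun ω => by
    rw [sq, Finset.sum_mul_sum]
    exact Finset.sum_congr rfl fun i _ => Finset.sum_congr rfl fun j _ => by ring
  simp only [h1]
  rw [integral_finsetSum _ fun i _ => integrable_finsetSum _ fun j _ => hint i j]
  refine Finset.sum_congr rfl fun i _ => ?_
  rw [integral_finsetSum _ fun j _ => hint i j]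
  exact Finset.sum_congr rfl fun j _ => integral_const_mul _ _

lemma apply_eq_sum_single {ι : Type*} [Fintype ι] [DecidableEq ι] (L : StrongDual ℝ (ι → ℝ))
    (x : ι → ℝ) : L x = ∑ i, L (Pi.single i 1) * x i := by
  conv_lhs => rw [pi_eq_sum_univ' x]
  rw [map_sum]
  refine Finset.sum_congr rfl fun i _ => ?_
  rw [map_smul, smul_eq_mul, mul_comm]

lemma charFunDual_map_of_centered {Ω ι : Type*} [Fintype ι] [DecidableEq ι] [MeasurableSpace Ω]
    {P : Measure Ω} {X : Ω → ι → ℝ} (hX : HasGaussianLaw X P)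
    (hX0 : ∀ i, ∫ ω, X ω i ∂P = 0) (L : StrongDual ℝ (ι → ℝ)) :
    charFunDual (P.map X) L = Complex.exp (-((∑ i, ∑ j, L (Pi.single i 1) * L (Pi.single j 1) *
      ∫ ω, X ω i * X ω j ∂P : ℝ) : ℂ) / 2) := by
  have := hX.isProbabilityMeasure
  have hm : ∀ i, MemLp (fun ω => X ω i) 2 P := fun i =>
    (hX.map_fun (ContinuousLinearMap.proj i)).memLp_two
  have hL : L ∘ X = fun ω => ∑ i, L (Pi.single i 1) * X ω i := by
    funext ω
    exact apply_eq_sum_single L (X ω)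
  have h0 : P[L ∘ X] = 0 := by
    rw [hL, integral_finsetSum _ fun i _ => ((hm i).integrable one_le_two).const_mul _]
    simp [integral_const_mul, hX0]
  rw [hX.charFunDual_map_eq, variance_of_integral_eq_zero (hX.map L).aemeasurable h0, h0,
    ← integral_sum_mul_sum_eq hm, hL]
  congr 1
  push_cast
  ring

/-- The law of a centered Gaussian vector is determined by its covariance. -/
lemma map_eq_map_of_integral_mul_eq {Ω Ω' ι : Type*} [Fintype ι] [MeasurableSpace Ω]
    [MeasurableSpace Ω'] {P : Measure Ω} {Q : Measure Ω'} {X : Ω → ι → ℝ} {Y : Ω' → ι → ℝ}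
    (hX : HasGaussianLaw X P) (hY : HasGaussianLaw Y Q)
    (hX0 : ∀ i, ∫ ω, X ω i ∂P = 0) (hY0 : ∀ i, ∫ ω, Y ω i ∂Q = 0)
    (hXY : ∀ i j, ∫ ω, X ω i * X ω j ∂P = ∫ ω, Y ω i * Y ω j ∂Q) :
    P.map X = Q.map Y := by
  classical
  have := hX.isProbabilityMeasure
  have := hY.isProbabilityMeasure
  have : IsProbabilityMeasure (P.map X) := Measure.isProbabilityMeasure_map hX.aemeasurable
  have : IsProbabilityMeasure (Q.map Y) := Measure.isProbabilityMeasure_map hY.aemeasurable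
  refine Measure.ext_of_charFunDual (funext fun L => ?_)
  rw [charFunDual_map_of_centered hX hX0, charFunDual_map_of_centered hY hY0]
  simp only [hXY]

end GaussianLaw

/-! ### The Fourier modes of the series ∑ g_i k_i, and comparison of laws. -/

section Modes

variable {σ : ℕ → ℝ}

/-- The amplitude of the Fourier mode `(b, k)` in the direction `i`. -/
noncomputable def modeWeight (σ : ℕ → ℝ) (b : Bool) (k i : ℕ) : ℝ :=
  frameFun (Pi.single k (fieldCoeff σ k)) (if b then π / 2 else 0) (Nat.log 2 i) i 0

lemma single_fieldCoeff_zero (k : ℕ) :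
    (Pi.single k (fieldCoeff σ k) : ℕ → ℝ) 0 = 0 := by
  rcases Nat.eq_zero_or_pos k with rfl | hk
  · simp [fieldCoeff_zero]
  · rw [Pi.single_eq_of_ne hk.ne]

/-- The frame identity again, for coefficients supported on one frequency and evaluated at the
origin; the phases 0 and π/2 stand for cosine and sine, and their difference makes distinct types
orthogonal. The bound on `k` places it in a band already summed. -/
lemma sum_modeWeight_mul_modeWeight (b c : Bool) {J k l : ℕ} (hk : k < 2 ^ J / 2) :
    ∑ i ∈ Finset.range (2 ^ (J + 1)), modeWeight σ b k i * modeWeight σ c l i =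
      if b = c ∧ k = l then fieldCoeff σ k ^ 2 else 0 := by
  rw [sum_range_two_pow_eq _ (fun j => (Pi.single k (fieldCoeff σ k) : ℕ → ℝ) j *
    (Pi.single l (fieldCoeff σ l) : ℕ → ℝ) j *
    Real.cos (j * (0 - 0) + ((if b then π / 2 else 0) - (if c then π / 2 else 0)))) _ fun J => by
      rw [← sum_frameFun_mul_frameFun (single_fieldCoeff_zero k) (single_fieldCoeff_zero l)]
      refine Finset.sum_congr rfl fun i hi => ?_
      rw [modeWeight, modeWeight, log_eq_of_mem_Ico hi]]
  · rw [Finset.sum_eq_single_of_mem k (Finset.mem_range.2 hk) fun j _ hj => by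
      rw [Pi.single_eq_of_ne hj, zero_mul, zero_mul]]
    rw [Pi.single_eq_same]
    by_cases hkl : k = l
    · subst hkl
      cases b <;> cases c <;> simp [sq]
    · rw [Pi.single_eq_of_ne hkl]
      simp [hkl]
  · rw [modeWeight, frameFun_eq_zero_of_lt (single_fieldCoeff_zero k) _ (by simp), zero_mul]

lemma frameFun_zero_eq (c : ℕ → ℝ) (b : Bool) (L i : ℕ) {k : ℕ} :
    frameFun (Pi.single k (c k)) (if b then π / 2 else 0) L i 0 =
      if k ∈ band L then √(2 / 2 ^ L) * (c k * trig b k ((2 * π * i / 2 ^ L : ℝ) : UnitCircle))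
      else 0 := by
  have ht : Real.cos (k * (0 - 2 * π * i / 2 ^ L) + if b then π / 2 else 0) =
      trig b k ((2 * π * i / 2 ^ L : ℝ) : UnitCircle) := by
    cases b
    · rw [trig_false_coe, ← Real.cos_neg]
      congr 1
      simp
    · rw [trig_true_coe, if_pos rfl, Real.cos_add_pi_div_two, ← Real.sin_neg]
      congr 1
      ring
  rw [frameFun]
  by_cases h : k ∈ band L
  · rw [if_pos h, Finset.sum_eq_single_of_mem k h fun j _ hj => by rw [Pi.single_eq_of_ne hj, zero_mul],
      Pi.single_eq_same, ht]
  · rw [if_neg h, Finset.sum_eq_zero fun j hj => by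
      rw [Pi.single_eq_of_ne (ne_of_mem_of_not_mem hj h), zero_mul], mul_zero]

/-- The addition formula for cos(k(t − x_i)), with x_i the center of the translate. Indices below
2^(J+1) only involve bands below 2^J/2. -/
lemma dir_eq_sum_modeWeight {J i : ℕ} (hi : i < 2 ^ (J + 1)) (t : ℝ) :
    dir σ i t = ∑ p : Bool × Fin (2 ^ J / 2),
      trig p.1 p.2 (t : UnitCircle) * modeWeight σ p.1 p.2 i := by
  have hL : Nat.log 2 i ≤ J := by
    rcases Nat.eq_zero_or_pos i with rfl | h0
    · simp
    · exact Nat.lt_succ_iff.1 (Nat.log_lt_of_lt_pow h0.ne' hi)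
  have hsub : band (Nat.log 2 i) ⊆ Finset.range (2 ^ J / 2) := fun k hk => by
    rw [band, Finset.mem_Ico] at hk
    exact Finset.mem_range.2 (hk.2.trans_le
      (Nat.div_le_div_right (Nat.pow_le_pow_right (by norm_num) hL)))
  simp only [modeWeight, frameFun_zero_eq]
  rw [Fintype.sum_prod_type_right]
  rw [Fin.sum_univ_eq_sum_range (fun k => ∑ b, trig b k (t : UnitCircle) *
    if k ∈ band (Nat.log 2 i) then √(2 / 2 ^ Nat.log 2 i) * (fieldCoeff σ k *
      trig b k ((2 * π * i / 2 ^ Nat.log 2 i : ℝ) : UnitCircle)) else 0),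
    ← Finset.sum_subset hsub fun k _ hk => by simp [hk], dir, frameFun, Finset.mul_sum]
  refine Finset.sum_congr rfl fun k hk => ?_
  simp only [if_pos hk, Fintype.sum_bool, trig_false_coe, trig_true_coe]
  rw [add_zero, mul_sub, Real.cos_sub]
  ring

end Modes

section Series

variable {σ : ℕ → ℝ}

/-- The trigonometric polynomial with the given Fourier modes. -/
noncomputable def modeSum {m : ℕ} (v : Bool × Fin m → ℝ) (θ : UnitCircle) : ℝ :=
  ∑ p : Bool × Fin m, trig p.1 p.2 θ * v p

/-- The Fourier coefficients of the exponential of a trigonometric polynomial. -/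
noncomputable def seriesCoeff (γ a : ℝ) {m : ℕ} (v : Bool × Fin m → ℝ) : ℕ → ℂ :=
  densityCoeff fun t => Real.exp (γ * modeSum v (t : UnitCircle) - γ ^ 2 / 2 * a)

/-- The variance of the field truncated to the frequencies below `m`. -/
noncomputable def truncVariance (σ : ℕ → ℝ) (m : ℕ) : ℝ := ∑ k ∈ Finset.range m, fieldCoeff σ k ^ 2

/-- Over complete scales the normalizing variance does not depend on the angle, and the density
depends on the Gaussians only through the modes. So the law of the modes determines that of the
coefficients. -/
lemma chaosCoeff_eq_seriesCoeff (γ : ℝ) (J : ℕ) (y : ℕ → ℝ) :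
    chaosCoeff γ σ (2 ^ (J + 1)) y = seriesCoeff γ (truncVariance σ (2 ^ J / 2))
      fun p : Bool × Fin (2 ^ J / 2) =>
        ∑ i : Fin (2 ^ (J + 1)), modeWeight σ p.1 p.2 i * y i := by
  rw [chaosCoeff, seriesCoeff]
  congr 1
  funext t
  congr 1
  have hvar : ∑ i ∈ Finset.range (2 ^ (J + 1)), dir σ i t ^ 2 = truncVariance σ (2 ^ J / 2) := by
    have := sum_range_dir_mul_dir (σ := σ) J t t
    simpa [truncVariance, ← sq] using this
  rw [logDensity, Finset.sum_sub_distrib, ← Finset.mul_sum, hvar]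
  congr 1
  rw [modeSum, Finset.mul_sum]
  simp only [Finset.mul_sum]
  rw [Finset.sum_comm, ← Fin.sum_univ_eq_sum_range (fun i => γ * y i * dir σ i t)]
  refine Finset.sum_congr rfl fun i _ => ?_
  rw [dir_eq_sum_modeWeight i.2, Finset.mul_sum]
  exact Finset.sum_congr rfl fun p _ => by ring

lemma measurable_modeSum {α : Type*} [MeasurableSpace α] {m : ℕ} {V : α → Bool × Fin m → ℝ}
    (hV : Measurable V) {T : α → UnitCircle} (hT : Measurable T) :
    Measurable fun a => modeSum (V a) (T a) := by
  unfold modeSum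
  refine Finset.measurable_sum _ fun p _ => ?_
  exact ((trig p.1 p.2).continuous.measurable.comp hT).mul ((measurable_pi_apply p).comp hV)

lemma measurable_seriesCoeff (γ a : ℝ) {m : ℕ} :
    Measurable fun v : Bool × Fin m → ℝ => seriesCoeff γ a v :=
  measurable_densityCoeff (((measurable_modeSum measurable_fst
    (AddCircle.measurable_mk'.comp measurable_snd)).const_mul γ).sub_const _).exp

variable {Ω : Type*} [MeasurableSpace Ω]

lemma hasGaussianLaw_of_isGaussianProcess {ι : Type*} [Fintype ι] {P : Measure Ω}
    {X : ι → Ω → ℝ} (hX : IsGaussianProcess X P) : HasGaussianLaw (fun ω i => X i ω) P :=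
  let L : ({i // i ∈ (Finset.univ : Finset ι)} → ℝ) →L[ℝ] (ι → ℝ) :=
    ContinuousLinearMap.pi fun i =>
      ContinuousLinearMap.proj (⟨i, Finset.mem_univ i⟩ : {i // i ∈ (Finset.univ : Finset ι)})
  (hX.hasGaussianLaw Finset.univ).map_fun L

variable {Q : Measure Ω} {g : ℕ → Ω → ℝ}

lemma IsGaussianSeq.hasGaussianLaw (hg : IsGaussianSeq Q g) (i : ℕ) : HasGaussianLaw (g i) Q :=
  HasLaw.hasGaussianLaw ⟨(hg.measurable i).aemeasurable, hg.law i⟩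

lemma IsGaussianSeq.integral_eq_zero (hg : IsGaussianSeq Q g) (i : ℕ) : ∫ ω, g i ω ∂Q = 0 := by
  have h := integral_map (hg.measurable i).aemeasurable (μ := Q) (f := fun x : ℝ => x)
    aestronglyMeasurable_id
  rw [← h, hg.law i, integral_id_gaussianReal]

lemma IsGaussianSeq.integral_mul [IsProbabilityMeasure Q] (hg : IsGaussianSeq Q g) (i j : ℕ) :
    ∫ ω, g i ω * g j ω ∂Q = if i = j then 1 else 0 := by
  split_ifs with hij
  · subst hij
    have h1 := variance_of_integral_eq_zero (hg.measurable i).aemeasurable (hg.integral_eq_zero i)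
    have h2 := variance_id_map (hg.measurable i).aemeasurable (μ := Q)
    rw [hg.law i, variance_id_gaussianReal] at h2
    simp only [← sq]
    rw [← h1, ← h2]
    simp
  · have h := (hg.indep.indepFun hij).integral_fun_mul_eq_mul_integral
      (hg.measurable i).aestronglyMeasurable (hg.measurable j).aestronglyMeasurable
    rw [h, hg.integral_eq_zero i, zero_mul]

/-- A Gaussian vector with independent modes of the right variances has the law of the modes of
the field `∑ g_i k_i`. -/
lemma IsGaussianSeq.map_modes_eq [IsProbabilityMeasure Q] (hg : IsGaussianSeq Q g) {Ω' : Type*} [MeasurableSpace Ω'] {P : Measure Ω'} {J : ℕ}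
    {V : Ω' → Bool × Fin (2 ^ J / 2) → ℝ} (hV : HasGaussianLaw V P)
    (hV0 : ∀ p, ∫ ω, V ω p ∂P = 0)
    (hVV : ∀ p q, ∫ ω, V ω p * V ω q ∂P = if p = q then fieldCoeff σ p.2 ^ 2 else 0) :
    P.map V = Q.map fun ω p => ∑ i : Fin (2 ^ (J + 1)), modeWeight σ p.1 p.2 i * g i ω := by
  have h1 : HasGaussianLaw (fun ω (i : Fin (2 ^ (J + 1))) => g i ω) Q :=
    (hg.indep.precomp Fin.val_injective).hasGaussianLaw fun i => hg.hasGaussianLaw i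
  have hm : ∀ i, MemLp (g i) 2 Q := fun i => (hg.hasGaussianLaw i).memLp_two
  have h2 : HasGaussianLaw (fun ω (p : Bool × Fin (2 ^ J / 2)) =>
      ∑ i : Fin (2 ^ (J + 1)), modeWeight σ p.1 p.2 i * g i ω) Q := by
    let L : (Fin (2 ^ (J + 1)) → ℝ) →L[ℝ] (Bool × Fin (2 ^ J / 2) → ℝ) :=
      ContinuousLinearMap.pi fun p => ∑ i : Fin (2 ^ (J + 1)),
        modeWeight σ p.1 p.2 i • ContinuousLinearMap.proj i
    refine (h1.map_fun L).congr (ae_of_all _ fun ω => funext fun p => ?_)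
    simp [L]
  refine map_eq_map_of_integral_mul_eq hV h2 hV0 (fun p => ?_) fun p q => ?_
  · rw [integral_finsetSum _ fun (i : Fin (2 ^ (J + 1))) _ =>
      ((hm i).integrable one_le_two).const_mul (modeWeight σ p.1 p.2 i)]
    simp [integral_const_mul, hg.integral_eq_zero]
  · rw [hVV]
    simp only [Finset.sum_mul_sum]
    have hint : ∀ i j : Fin (2 ^ (J + 1)), Integrable (fun ω => modeWeight σ p.1 p.2 i * g i ω *
        (modeWeight σ q.1 q.2 j * g j ω)) Q := fun i j =>
      ((hm i).const_mul _).integrable_mul ((hm j).const_mul _)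
    rw [integral_finsetSum _ fun i _ => integrable_finsetSum _ fun j _ => hint i j]
    have h3 : ∀ i : Fin (2 ^ (J + 1)), ∫ ω, ∑ j : Fin (2 ^ (J + 1)),
        modeWeight σ p.1 p.2 i * g i ω * (modeWeight σ q.1 q.2 j * g j ω) ∂Q =
        modeWeight σ p.1 p.2 i * modeWeight σ q.1 q.2 i := fun i => by
      rw [integral_finsetSum _ fun j _ => hint i j, Finset.sum_eq_single_of_mem i
        (Finset.mem_univ i)]
      · simp only [mul_mul_mul_comm _ (g _ _)]
        rw [integral_const_mul, hg.integral_mul, if_pos rfl, mul_one]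
      · intro j _ hj
        simp only [mul_mul_mul_comm _ (g _ _)]
        rw [integral_const_mul, hg.integral_mul, if_neg fun h => hj (Fin.ext h.symm), mul_zero]
    rw [Finset.sum_congr rfl fun i _ => h3 i,
      Fin.sum_univ_eq_sum_range (fun i => modeWeight σ p.1 p.2 i * modeWeight σ q.1 q.2 i),
      sum_modeWeight_mul_modeWeight _ _ p.2.2]
    simp only [Prod.ext_iff, Fin.ext_iff]

/-- Uniform bound for the chaos of a Gaussian trigonometric polynomial with independent modes. -/
lemma exists_forall_lintegral_seriesCoeff_le {γ b : ℝ} (hγ : 0 ≤ γ) (hγ1 : γ ≤ 1) (hb : 0 ≤ b)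
    (hb' : 4 * b < 1 - 2 * γ ^ 2) : ∃ C : ℝ, ∀ ε > 0, ∀ s : Finset ℕ, 0 ∉ s → ∀ J : ℕ,
      ∀ {Ω : Type*} [MeasurableSpace Ω] (P : Measure Ω) (V : Ω → Bool × Fin (2 ^ J / 2) → ℝ),
      HasGaussianLaw V P → (∀ p, ∫ ω, V ω p ∂P = 0) →
      (∀ p q, ∫ ω, V ω p * V ω q ∂P = if p = q then fieldCoeff (damping ε) p.2 ^ 2 else 0) →
      ∫⁻ ω, ENNReal.ofReal (sqNormL4 s (fun n => (n : ℝ) ^ (4 * b))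
        (seriesCoeff γ (truncVariance (damping ε) (2 ^ J / 2)) (V ω))) ∂P ≤ ENNReal.ofReal C := by
  -- The Gaussian sequence lives on an auxiliary space; equality of the laws of the modes transports
  -- the bound, with a constant independent of `V` and its space.
  obtain ⟨Ω', _, Q, g, hg1, hg2, hg3, _⟩ := exists_iid ℕ (gaussianReal 0 1)
  have hg : IsGaussianSeq Q g := ⟨hg1, fun i => (hg2 i).map_eq, hg3⟩
  obtain ⟨C, hC⟩ := hg.exists_forall_lintegral_chaosCoeff_le hγ hγ1 hb hb'
  refine ⟨C, fun ε hε s hs J Ω _ P V hV hV0 hVV => ?_⟩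
  have hmeas : Measurable fun v : Bool × Fin (2 ^ J / 2) → ℝ =>
      ENNReal.ofReal (sqNormL4 s (fun n => (n : ℝ) ^ (4 * b))
        (seriesCoeff γ (truncVariance (damping ε) (2 ^ J / 2)) v)) :=
    (measurable_seriesCoeff _ _).ofReal_sqNormL4
  have hmodes : Measurable fun ω (p : Bool × Fin (2 ^ J / 2)) =>
      ∑ i : Fin (2 ^ (J + 1)), modeWeight (damping ε) p.1 p.2 i * g i ω :=
    measurable_pi_lambda _ fun p => Finset.measurable_sum _ fun i _ => (hg1 i).const_mul _
  rw [← lintegral_map' hmeas.aemeasurable hV.aemeasurable, hg.map_modes_eq hV hV0 hVV,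
    lintegral_map hmeas hmodes]
  have h := hC ε hε s hs (J + 1)
  simpa only [chaosCoeff_eq_seriesCoeff] using h

end Series

/-! ### Covariances of the field and its truncated Fourier expansion. -/

section Field

variable {Ω : Type*} [MeasurableSpace Ω] {P : Measure Ω} {φ : TestSpace → Ω → ℝ}

lemma IsCircleGFF.integral_mul_eq (hφ : IsCircleGFF P φ) {F G : TestSpace} {f g : UnitCircle → ℝ}
    (hF : F =ᵐ[volume] f) (hG : G =ᵐ[volume] g) (hf : Measurable f) (hg : Measurable g) {A B : ℝ}
    (hA : ∀ θ, |f θ| ≤ A) (hB : ∀ θ, |g θ| ≤ B)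
    (hs : Summable fun k : ℕ => (∑ b, trigCoeff b k f * trigCoeff b k g) / k) :
    ∫ ω, φ F ω * φ G ω ∂P = ∑' k : ℕ, (∑ b, trigCoeff b k f * trigCoeff b k g) / k := by
  rw [hφ.covariance_eq, ← integral_covKernel_mul hf hg hA hB hs]
  refine integral_congr_ae ?_
  filter_upwards [hF] with θ hθ
  refine integral_congr_ae ?_
  filter_upwards [hG] with θ' hθ'
  rw [hθ, hθ']

/-- `cos (kθ)` and `sin (kθ)` as test functions. -/
noncomputable def trigTest (b : Bool) (k : ℕ) : TestSpace :=
  ContinuousMap.toLp 2 volume ℝ (trig b k)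

lemma trigTest_ae_eq (b : Bool) (k : ℕ) : trigTest b k =ᵐ[volume] trig b k :=
  ContinuousMap.coeFn_toLp (p := 2) (𝕜 := ℝ) volume (trig b k)

lemma IsCircleGFF.integral_trigTest_mul_trigTest (hφ : IsCircleGFF P φ) (b c : Bool) {k l : ℕ}
    (hk : 0 < k) (hl : 0 < l) :
    ∫ ω, φ (trigTest b k) ω * φ (trigTest c l) ω ∂P =
      if b = c ∧ k = l then π ^ 2 / k else 0 := by
  have h0 : ∀ j ≠ k, (∑ b', trigCoeff b' j (trig b k) * trigCoeff b' j (trig c l)) / (j : ℝ) = 0 :=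
    fun j hj => by
      rw [Finset.sum_eq_zero fun b' _ => by
        rw [trigCoeff_trig _ _ _ hk, if_neg fun h => hj h.2, zero_mul], zero_div]
  rw [hφ.integral_mul_eq (trigTest_ae_eq b k) (trigTest_ae_eq c l) (trig b k).continuous.measurable
    (trig c l).continuous.measurable (abs_trig_le_one b k) (abs_trig_le_one c l)
    (summable_of_ne_finset_zero (s := {k}) fun j hj => h0 j (by simpa using hj)),
    tsum_eq_single k h0]
  simp only [trigCoeff_trig _ _ _ hk, trigCoeff_trig _ _ _ hl, Fintype.sum_bool]
  by_cases hkl : k = l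
  · subst hkl
    cases b <;> cases c <;> simp [sq]
  · simp [hkl]

lemma IsCircleGFF.integral_arcAverage_mul_trigTest (hφ : IsCircleGFF P φ) {ε : ℝ} (hε : 0 < ε)
    (hεπ : ε < π) (x : UnitCircle) (c : Bool) {l : ℕ} (hl : 0 < l) :
    ∫ ω, φ (arcAverage ε x) ω * φ (trigTest c l) ω ∂P = π / l * (damping ε l * trig c l x) := by
  have h0 : ∀ j ≠ l, (∑ b, trigCoeff b j (arcFun ε x) * trigCoeff b j (trig c l)) / (j : ℝ) = 0 :=
    fun j hj => by
      rw [Finset.sum_eq_zero fun b' _ => by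
        rw [trigCoeff_trig _ _ _ hl, if_neg fun h => hj h.2, mul_zero], zero_div]
  rw [hφ.integral_mul_eq (arcAverage_ae_eq ε x) (trigTest_ae_eq c l) (measurable_arcFun ε x)
    (trig c l).continuous.measurable (abs_arcFun_le hε x) (abs_trig_le_one c l)
    (summable_of_ne_finset_zero (s := {l}) fun j hj => h0 j (by simpa using hj)),
    tsum_eq_single l h0]
  simp only [trigCoeff_trig _ _ _ hl, trigCoeff_arcFun hε hεπ, Fintype.sum_bool]
  cases c <;> simp <;> ring

lemma sum_trigCoeff_arcFun_sq {ε : ℝ} (hε : 0 < ε) (hεπ : ε < π) (x : UnitCircle) (k : ℕ) :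
    (∑ b, trigCoeff b k (arcFun ε x) * trigCoeff b k (arcFun ε x)) / k =
      fieldCoeff (damping ε) k ^ 2 := by
  simp only [trigCoeff_arcFun hε hεπ]
  have h := sum_trig_sq k x
  rw [Fintype.sum_bool] at h ⊢
  rw [fieldCoeff, mul_pow, inv_pow, Real.sq_sqrt (by positivity), ← div_eq_mul_inv]
  congr 1
  linear_combination damping ε k ^ 2 * h

lemma summable_fieldCoeff_sq {ε : ℝ} (hε : 0 < ε) :
    Summable fun k => fieldCoeff (damping ε) k ^ 2 := by
  refine (summable_damping_sq_div hε).congr fun k => ?_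
  rw [fieldCoeff, mul_pow, inv_pow, Real.sq_sqrt (by positivity), ← div_eq_mul_inv]

lemma IsCircleGFF.integral_arcAverage_sq (hφ : IsCircleGFF P φ) {ε : ℝ} (hε : 0 < ε)
    (hεπ : ε < π) (x : UnitCircle) :
    ∫ ω, φ (arcAverage ε x) ω ^ 2 ∂P = ∑' k, fieldCoeff (damping ε) k ^ 2 := by
  simp only [sq (φ _ _)]
  rw [hφ.integral_mul_eq (arcAverage_ae_eq ε x) (arcAverage_ae_eq ε x) (measurable_arcFun ε x)
    (measurable_arcFun ε x) (abs_arcFun_le hε x) (abs_arcFun_le hε x)]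
  · exact tsum_congr fun k => sum_trigCoeff_arcFun_sq hε hεπ x k
  · exact (summable_fieldCoeff_sq hε).congr fun k => (sum_trigCoeff_arcFun_sq hε hεπ x k).symm

lemma integral_exp_of_hasGaussianLaw {Z : Ω → ℝ} (hZ : HasGaussianLaw Z P)
    (h0 : ∫ ω, Z ω ∂P = 0) :
    Integrable (fun ω => Real.exp (Z ω)) P ∧
      ∫ ω, Real.exp (Z ω) ∂P = Real.exp ((∫ ω, Z ω ^ 2 ∂P) / 2) := by
  have hlaw := hZ.map_eq_gaussianReal
  rw [h0] at hlaw
  have hmgf := mgf_gaussianReal hlaw 1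
  have hvar := variance_of_integral_eq_zero hZ.aemeasurable h0
  have hint : Integrable (fun x : ℝ => Real.exp x) (P.map Z) := by
    rw [hlaw]
    simpa using integrable_exp_mul_gaussianReal (μ := 0) (v := Var[Z; P].toNNReal) 1
  refine ⟨hint.comp_aemeasurable hZ.aemeasurable, ?_⟩
  simp only [mgf, one_mul] at hmgf
  rw [hmgf, Real.coe_toNNReal _ (variance_nonneg _ _), hvar]
  congr 1
  ring

/-- Normalized Fourier modes of the field: they are independent with the variances of a field
cut off at the scale `ε`, and their sum approximates the averages of the field over arcs. -/
lemma IsCircleGFF.exists_modes (hφ : IsCircleGFF P φ) {ε : ℝ} (hε : 0 < ε) (hεπ : ε < π) (m : ℕ) :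
    ∃ V : Ω → Bool × Fin m → ℝ, Measurable V ∧ HasGaussianLaw V P ∧ (∀ p, ∫ ω, V ω p ∂P = 0) ∧
      (∀ p q, ∫ ω, V ω p * V ω q ∂P = if p = q then fieldCoeff (damping ε) p.2 ^ 2 else 0) ∧
      ∀ x c d, Integrable
        (fun ω => Real.exp (c * φ (arcAverage ε x) ω + d * modeSum (V ω) x)) P ∧
        ∫ ω, Real.exp (c * φ (arcAverage ε x) ω + d * modeSum (V ω) x) ∂P =
        Real.exp ((c ^ 2 * ∑' k, fieldCoeff (damping ε) k ^ 2 +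
          (2 * c * d + d ^ 2) * truncVariance (damping ε) m) / 2) := by
  -- The field tested against a mode of frequency k > 0 has variance π²/k; this factor turns it into
  -- `fieldCoeff (damping ε) k ^ 2`. At k = 0 it vanishes.
  set a : ℕ → ℝ := fun k => fieldCoeff (damping ε) k * (√k / π) with ha
  set U : Bool × Fin m → Ω → ℝ := fun p ω => a p.2 * φ (trigTest p.1 p.2) ω with hU
  have hUU : ∀ p q, ∫ ω, U p ω * U q ω ∂P = if p = q then fieldCoeff (damping ε) p.2 ^ 2 else 0 := by
    rintro ⟨b, k⟩ ⟨c, l⟩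
    simp only [hU, mul_mul_mul_comm _ (φ _ _), integral_const_mul]
    rcases Nat.eq_zero_or_pos (k : ℕ) with hk | hk
    · simp [ha, hk, fieldCoeff_zero]
    rcases Nat.eq_zero_or_pos (l : ℕ) with hl | hl
    · have hkl : (b, k) ≠ (c, l) := fun h => by
        rw [Prod.mk.injEq] at h
        rw [h.2] at hk
        omega
      simp [ha, hl, fieldCoeff_zero, hkl]
    rw [hφ.integral_trigTest_mul_trigTest b c hk hl]
    simp only [Prod.mk.injEq, Fin.ext_iff]
    split_ifs with h
    · rw [← h.2]
      have hk' : (0 : ℝ) < (k : ℕ) := by exact_mod_cast hk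
      have hs : √((k : ℕ) : ℝ) * √((k : ℕ) : ℝ) = (k : ℕ) := Real.mul_self_sqrt hk'.le
      simp only [ha]
      field_simp
      rw [sq (√_), hs]
    · rw [mul_zero]
  -- These covariances make the mode sum the orthogonal projection of the arc average on the modes:
  -- its covariance with the average equals its own variance. Hence `truncVariance` multiplies both
  -- 2cd and d².
  have hXU : ∀ x p, ∫ ω, φ (arcAverage ε x) ω * U p ω ∂P =
      fieldCoeff (damping ε) p.2 ^ 2 * trig p.1 p.2 x := by
    rintro x ⟨b, k⟩
    simp only [hU, mul_left_comm (φ _ _), integral_const_mul]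
    rcases Nat.eq_zero_or_pos (k : ℕ) with hk | hk
    · simp [ha, hk, fieldCoeff_zero]
    rw [hφ.integral_arcAverage_mul_trigTest hε hεπ x b hk]
    have hk' : (0 : ℝ) < (k : ℕ) := by exact_mod_cast hk
    have hs : √((k : ℕ) : ℝ) * √((k : ℕ) : ℝ) = (k : ℕ) := Real.mul_self_sqrt hk'.le
    simp only [ha, fieldCoeff]
    field_simp
    rw [sq (√_), hs]
  have hproc := hφ.isGaussianProcess
  have hUm : ∀ p, AEMeasurable (U p) P := fun p => (hproc.aemeasurable _).const_mul _
  -- The field is only almost everywhere measurable, and joint measurability in the angle will be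
  -- needed, so a measurable version is chosen.
  set V : Ω → Bool × Fin m → ℝ := fun ω p => (hUm p).mk (U p) ω with hV
  have hVm : Measurable V := measurable_pi_lambda _ fun p => (hUm p).measurable_mk
  have hUV : ∀ᵐ ω ∂P, ∀ p, U p ω = V ω p := ae_all_iff.2 fun p => (hUm p).ae_eq_mk
  have hUg : HasGaussianLaw (fun ω p => U p ω) P :=
    hasGaussianLaw_of_isGaussianProcess ((hproc.comp_right
      fun p : Bool × Fin m => trigTest p.1 p.2).smul fun p => a p.2)
  refine ⟨V, hVm, hUg.congr (hUV.mono fun ω h => funext h), fun p => ?_, fun p q => ?_,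
    fun x c d => ?_⟩
  · rw [← integral_congr_ae (hUV.mono fun ω h => h p)]
    simp only [hU, integral_const_mul, hφ.centered, mul_zero]
  · rw [← hUU, integral_congr_ae (hUV.mono fun ω h => by
      simp only [h p, h q] : (fun ω => U p ω * U q ω) =ᵐ[P] fun ω => V ω p * V ω q)]
  -- The arc average, indexed by `none`, and the modes form one Gaussian vector, so every linear
  -- combination of them is Gaussian.
  set W : Option (Bool × Fin m) → Ω → ℝ := fun i ω =>
    (i.elim 1 fun p => a p.2) • φ (i.elim (arcAverage ε x) fun p => trigTest p.1 p.2) ω with hW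
  set κ : Option (Bool × Fin m) → ℝ := fun i => i.elim c fun p => d * trig p.1 p.2 x with hκ
  have hWg : HasGaussianLaw (fun ω i => W i ω) P :=
    hasGaussianLaw_of_isGaussianProcess ((hproc.comp_right
      fun i : Option (Bool × Fin m) => i.elim (arcAverage ε x) fun p => trigTest p.1 p.2).smul
        fun i => i.elim 1 fun p => a p.2)
  have hWs : ∀ i, W (some i) = U i := fun i => rfl
  have hWn : W none = φ (arcAverage ε x) := by funext ω; simp [hW]
  have hWm : ∀ i, MemLp (fun ω => W i ω) 2 P := fun i =>
    (hWg.map_fun (ContinuousLinearMap.proj i)).memLp_two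
  let L : (Option (Bool × Fin m) → ℝ) →L[ℝ] ℝ := ∑ i, κ i • ContinuousLinearMap.proj i
  have hZg : HasGaussianLaw (fun ω => ∑ i, κ i * W i ω) P :=
    (hWg.map_fun L).congr (ae_of_all _ fun ω => by simp [L])
  have hZ0 : ∫ ω, ∑ i, κ i * W i ω ∂P = 0 := by
    have := hφ.isGaussianProcess.isProbabilityMeasure
    rw [integral_finsetSum _ fun i _ => ((hWm i).integrable one_le_two).const_mul _]
    simp only [hW, smul_eq_mul, integral_const_mul, hφ.centered, mul_zero, Finset.sum_const_zero]
  have hZ := integral_exp_of_hasGaussianLaw hZg hZ0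
  have hvar : ∫ ω, (∑ i, κ i * W i ω) ^ 2 ∂P = c ^ 2 * ∑' k, fieldCoeff (damping ε) k ^ 2 +
      (2 * c * d + d ^ 2) * truncVariance (damping ε) m := by
    have htv : ∑ p : Bool × Fin m, fieldCoeff (damping ε) p.2 ^ 2 *
        (trig p.1 p.2 x * trig p.1 p.2 x) = truncVariance (damping ε) m := by
      rw [Fintype.sum_prod_type_right, truncVariance, ← Fin.sum_univ_eq_sum_range
        fun k => fieldCoeff (damping ε) k ^ 2]
      refine Finset.sum_congr rfl fun k _ => ?_
      simp only [← Finset.mul_sum, sum_trig_sq, mul_one]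
    have hXX : ∫ ω, φ (arcAverage ε x) ω * φ (arcAverage ε x) ω ∂P =
        ∑' k, fieldCoeff (damping ε) k ^ 2 := by
      rw [← hφ.integral_arcAverage_sq hε hεπ x]
      simp only [sq]
    rw [integral_sum_mul_sum_eq hWm]
    simp only [Fintype.sum_option, hWs, hWn, hXX, hXU, hUU, mul_comm (U _ _) (φ _ _)]
    simp only [hκ, Option.elim_none, Option.elim_some, mul_ite, mul_zero, Finset.sum_ite_eq,
      Finset.mem_univ, if_true]
    rw [Finset.sum_add_distrib, ← htv, Finset.mul_sum, ← add_assoc, add_assoc, add_assoc,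
      ← Finset.sum_add_distrib, ← Finset.sum_add_distrib]
    congr 1
    · ring
    · exact Finset.sum_congr rfl fun p _ => by ring
  have hexp : (fun ω => Real.exp (∑ i, κ i * W i ω)) =ᵐ[P]
      fun ω => Real.exp (c * φ (arcAverage ε x) ω + d * modeSum (V ω) x) := by
    filter_upwards [hUV] with ω h
    rw [Fintype.sum_option, hWn, modeSum, Finset.mul_sum]
    simp only [hWs, h, hκ, Option.elim_none, Option.elim_some, mul_assoc]
  rw [hvar] at hZ
  exact ⟨hZ.1.congr hexp, by rw [← integral_congr_ae hexp, hZ.2]⟩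

end Field

/-! ### Fatou's lemma along convergence in measure. -/

section Fatou

variable {Ω : Type*} [MeasurableSpace Ω] {P : Measure Ω}

lemma tendstoInMeasure_pi {ι κ : Type*} [Fintype κ] {E : Type*} [PseudoEMetricSpace E]
    {u : Filter ι} {X : ι → Ω → κ → E} {Y : Ω → κ → E}
    (h : ∀ k, TendstoInMeasure P (fun i ω => X i ω k) u fun ω => Y ω k) :
    TendstoInMeasure P X u Y := by
  intro δ hδ
  have h1 : Tendsto (fun i => ∑ k, P {ω | δ ≤ edist (X i ω k) (Y ω k)}) u (𝓝 0) := by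
    simpa using tendsto_finsetSum Finset.univ fun k _ => h k δ hδ
  refine tendsto_of_tendsto_of_tendsto_of_le_of_le tendsto_const_nhds h1 (fun _ => zero_le)
    fun i => ?_
  refine (measure_mono fun ω hω => ?_).trans (measure_biUnion_finset_le Finset.univ
    fun k => {ω | δ ≤ edist (X i ω k) (Y ω k)})
  by_contra hc
  simp only [Set.mem_iUnion, not_exists, Set.mem_ofPred_eq, Finset.mem_univ, exists_prop, true_and,
    not_le] at hc
  have : edist (X i ω) (Y ω) < δ := by
    rw [edist_pi_def, Finset.sup_lt_iff (by simpa using hδ)]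
    exact fun k _ => hc k
  exact absurd hω (not_le.2 this)

/-- Fatou's lemma for convergence in measure. -/
lemma lintegral_le_of_tendstoInMeasure {ι E : Type*} [PseudoEMetricSpace E] [MeasurableSpace E]
    [BorelSpace E] {u : Filter ι} [NeBot u] [IsCountablyGenerated u] {X : ι → Ω → E} {Y : Ω → E}
    (h : TendstoInMeasure P X u Y) {F : E → ℝ≥0∞} (hF : Continuous F)
    {C : ℝ≥0∞} (hX : ∀ᶠ i in u, AEMeasurable (X i) P ∧ ∫⁻ ω, F (X i ω) ∂P ≤ C) :
    ∫⁻ ω, F (Y ω) ∂P ≤ C := by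
  -- Convergence in measure yields almost everywhere convergence along a sequence; the shift by `k₀`
  -- discards the terms for which `hX` is not yet known.
  obtain ⟨ns, hns, hae⟩ := h.exists_seq_tendsto_ae'
  obtain ⟨k₀, hk₀⟩ := eventually_atTop.1 (hns.eventually hX)
  have h1 : ∫⁻ ω, F (Y ω) ∂P ≤ ∫⁻ ω, liminf (fun k => F (X (ns (k + k₀)) ω)) atTop ∂P := by
    refine lintegral_mono_ae ?_
    filter_upwards [hae] with ω hω
    exact ((hF.tendsto _).comp (hω.comp (tendsto_add_atTop_nat k₀))).liminf_eq.ge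
  refine h1.trans ((lintegral_liminf_le' fun k =>
    hF.measurable.comp_aemeasurable (hk₀ _ (Nat.le_add_left k₀ k)).1).trans ?_)
  refine liminf_le_of_le ⟨0, by simp⟩ fun c hc => ?_
  obtain ⟨k, hk⟩ := hc.exists
  exact hk.trans (hk₀ _ (Nat.le_add_left k₀ k)).2

end Fatou

/-! ### Densities of the regularized and truncated chaos. -/

section CutoffLimit

variable {Ω : Type*} [MeasurableSpace Ω] {P : Measure Ω} {φ : TestSpace → Ω → ℝ}
  {φreg : ℝ → UnitCircle → Ω → ℝ}

/-- The density of the regularized measure, with the variance of the field made explicit. -/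
noncomputable def regDensity (φreg : ℝ → UnitCircle → Ω → ℝ) (γ ε : ℝ) (ω : Ω) (θ : UnitCircle) :
    ℝ :=
  Real.exp (γ * φreg ε θ ω - γ ^ 2 / 2 * ∑' k, fieldCoeff (damping ε) k ^ 2)

lemma measurable_regDensity (hφreg : IsCutoff P φ φreg) {ε : ℝ} (hε : ε ∈ Set.Ioo 0 π) (γ : ℝ) :
    Measurable fun p : Ω × UnitCircle => regDensity φreg γ ε p.1 p.2 :=
  ((((hφreg.measurable ε hε).comp measurable_swap).const_mul γ).sub_const _).exp

/-- The variance of the averaged field is the same at every angle, so the normalization of the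
density is a constant. -/
lemma integral_regMeasure (hφ : IsCircleGFF P φ) (hφreg : IsCutoff P φ φreg) {ε : ℝ}
    (hε : ε ∈ Set.Ioo 0 π) (γ : ℝ) (ω : Ω) (f : UnitCircle → ℝ) :
    ∫ θ, f θ ∂(regMeasure P φreg γ ε ω) = ∫ θ, f θ * regDensity φreg γ ε ω θ := by
  have hvar : ∀ θ, ∫ ω', φreg ε θ ω' ^ 2 ∂P = ∑' k, fieldCoeff (damping ε) k ^ 2 := fun θ => by
    rw [← hφ.integral_arcAverage_sq hε.1 hε.2 θ]
    exact integral_congr_ae ((hφreg.version ε hε θ).mono fun ω h => by simp only [h])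
  have hm : Measurable (regDensity φreg γ ε ω) :=
    (measurable_regDensity hφreg hε γ).comp measurable_prodMk_left
  simp only [regMeasure, hvar]
  change ∫ θ, f θ ∂(volume.withDensity fun θ => ENNReal.ofReal (regDensity φreg γ ε ω θ)) = _
  rw [integral_withDensity_eq_integral_toReal_smul hm.ennreal_ofReal
    (ae_of_all _ fun _ => ENNReal.ofReal_lt_top)]
  refine integral_congr_ae (ae_of_all _ fun θ => ?_)
  simp only [smul_eq_mul]
  rw [ENNReal.toReal_ofReal (by unfold regDensity; positivity), mul_comm]

/-- The density of the exponential of a trigonometric polynomial. -/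
noncomputable def seriesDensity (γ a : ℝ) {m : ℕ} (v : Bool × Fin m → ℝ) (θ : UnitCircle) : ℝ :=
  Real.exp (γ * modeSum v θ - γ ^ 2 / 2 * a)

lemma continuous_seriesDensity (γ a : ℝ) {m : ℕ} (v : Bool × Fin m → ℝ) :
    Continuous (seriesDensity γ a v) := by
  unfold seriesDensity modeSum
  fun_prop

lemma seriesCoeff_eq (γ a : ℝ) {m : ℕ} (v : Bool × Fin m → ℝ) (n : ℕ) :
    seriesCoeff γ a v n = ⟨∫ θ, trig false n θ * seriesDensity γ a v θ,
      ∫ θ, trig true n θ * seriesDensity γ a v θ⟩ := by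
  have h1 : seriesCoeff γ a v n =
      ∫ θ : UnitCircle, (fourier (n : ℤ) θ : ℂ) * (seriesDensity γ a v θ : ℂ) := by
    rw [seriesCoeff, densityCoeff, ← AddCircle.intervalIntegral_preimage (2 * π) 0, zero_add]
    refine intervalIntegral.integral_congr fun t _ => ?_
    simp only [fourier_coe_apply]
    congr 2
    push_cast
    field_simp
  have hi : Integrable fun θ : UnitCircle =>
      (fourier (n : ℤ) θ : ℂ) * (seriesDensity γ a v θ : ℂ) :=
    integrable_of_continuous_circle ((fourier (n : ℤ)).continuous.mul
      (Complex.continuous_ofReal.comp (continuous_seriesDensity γ a v)))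
  rw [h1]
  apply Complex.ext
  · refine (integral_re hi).symm.trans (integral_congr_ae (ae_of_all _ fun θ => ?_))
    simp [trig]
  · refine (integral_im hi).symm.trans (integral_congr_ae (ae_of_all _ fun θ => ?_))
    simp [trig]

end CutoffLimit

/-! ### Removing the truncation of the regularized field. -/

section Approximation

variable {Ω : Type*} [MeasurableSpace Ω] {P : Measure Ω} {φ : TestSpace → Ω → ℝ}
  {φreg : ℝ → UnitCircle → Ω → ℝ}

lemma lintegral_enorm_le_sqrt [IsProbabilityMeasure P] {D : Ω → ℝ}
    (hD : AEStronglyMeasurable D P) (hi : Integrable (fun ω => D ω ^ 2) P) :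
    ∫⁻ ω, ‖D ω‖ₑ ∂P ≤ ENNReal.ofReal √(∫ ω, D ω ^ 2 ∂P) := by
  have h1 := eLpNorm_le_eLpNorm_of_exponent_le (μ := P) one_le_two hD
  have h2 : ∫⁻ ω, ‖D ω‖ₑ ^ 2 ∂P = ENNReal.ofReal (∫ ω, D ω ^ 2 ∂P) := by
    rw [ofReal_integral_eq_lintegral_ofReal hi (ae_of_all _ fun ω => sq_nonneg _)]
    refine lintegral_congr fun ω => ?_
    rw [← Real.enorm_eq_ofReal (sq_nonneg _), enorm_pow]
  rw [eLpNorm_one_eq_lintegral_enorm, eLpNorm_eq_lintegral_rpow_enorm_toReal (by norm_num)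
    (by norm_num)] at h1
  refine h1.trans (le_of_eq ?_)
  simp only [ENNReal.toReal_ofNat, ENNReal.rpow_ofNat, h2]
  rw [ENNReal.ofReal_rpow_of_nonneg (integral_nonneg fun _ => sq_nonneg _) (by norm_num),
    Real.sqrt_eq_rpow]

/-- Mean square distance between the densities of the regularized chaos and of the chaos of the
truncated field, from the joint exponential moments. -/
lemma integral_exp_sub_exp_sq [IsProbabilityMeasure P] {X Y : Ω → ℝ} {γ v w : ℝ}
    (h : ∀ c d : ℝ, Integrable (fun ω => Real.exp (c * X ω + d * Y ω)) P ∧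
      ∫ ω, Real.exp (c * X ω + d * Y ω) ∂P =
        Real.exp ((c ^ 2 * v + (2 * c * d + d ^ 2) * w) / 2)) :
    Integrable (fun ω => (Real.exp (γ * Y ω - γ ^ 2 / 2 * w) -
        Real.exp (γ * X ω - γ ^ 2 / 2 * v)) ^ 2) P ∧
      ∫ ω, (Real.exp (γ * Y ω - γ ^ 2 / 2 * w) - Real.exp (γ * X ω - γ ^ 2 / 2 * v)) ^ 2 ∂P =
        Real.exp (γ ^ 2 * v) - Real.exp (γ ^ 2 * w) := by
  have e : ∀ ω, (Real.exp (γ * Y ω - γ ^ 2 / 2 * w) - Real.exp (γ * X ω - γ ^ 2 / 2 * v)) ^ 2 =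
      Real.exp (-(γ ^ 2 * w)) * Real.exp (0 * X ω + (2 * γ) * Y ω) -
      2 * Real.exp (-(γ ^ 2 / 2 * (v + w))) * Real.exp (γ * X ω + γ * Y ω) +
      Real.exp (-(γ ^ 2 * v)) * Real.exp ((2 * γ) * X ω + 0 * Y ω) := fun ω => by
    have e1 : Real.exp (-(γ ^ 2 * w)) * Real.exp (0 * X ω + (2 * γ) * Y ω) =
        Real.exp (γ * Y ω - γ ^ 2 / 2 * w) * Real.exp (γ * Y ω - γ ^ 2 / 2 * w) := by
      rw [← Real.exp_add, ← Real.exp_add]; ring_nf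
    have e2 : Real.exp (-(γ ^ 2 / 2 * (v + w))) * Real.exp (γ * X ω + γ * Y ω) =
        Real.exp (γ * Y ω - γ ^ 2 / 2 * w) * Real.exp (γ * X ω - γ ^ 2 / 2 * v) := by
      rw [← Real.exp_add, ← Real.exp_add]; ring_nf
    have e3 : Real.exp (-(γ ^ 2 * v)) * Real.exp ((2 * γ) * X ω + 0 * Y ω) =
        Real.exp (γ * X ω - γ ^ 2 / 2 * v) * Real.exp (γ * X ω - γ ^ 2 / 2 * v) := by
      rw [← Real.exp_add, ← Real.exp_add]; ring_nf
    linear_combination -e1 + 2 * e2 - e3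
  have i1 := ((h 0 (2 * γ)).1.const_mul (Real.exp (-(γ ^ 2 * w))))
  have i2 := ((h γ γ).1.const_mul (2 * Real.exp (-(γ ^ 2 / 2 * (v + w)))))
  have i3 := ((h (2 * γ) 0).1.const_mul (Real.exp (-(γ ^ 2 * v))))
  simp only [e]
  refine ⟨(i1.sub i2).add i3, ?_⟩
  refine (integral_add (i1.sub i2) i3).trans
    ((congrArg (· + _) (integral_sub i1 i2)).trans ?_)
  simp only [integral_const_mul, (h 0 (2 * γ)).2, (h γ γ).2, (h (2 * γ) 0).2]
  -- The covariance of `X` and `Y` equals the variance w of `Y`, so the mixed expectation is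
  -- exp(γ²w), the same as the second moment of the truncated density; only one of the three copies
  -- survives, with a minus sign.
  have f1 : Real.exp (-(γ ^ 2 * w)) *
      Real.exp ((0 ^ 2 * v + (2 * 0 * (2 * γ) + (2 * γ) ^ 2) * w) / 2) = Real.exp (γ ^ 2 * w) := by
    rw [← Real.exp_add]; ring_nf
  have f2 : Real.exp (-(γ ^ 2 / 2 * (v + w))) *
      Real.exp ((γ ^ 2 * v + (2 * γ * γ + γ ^ 2) * w) / 2) = Real.exp (γ ^ 2 * w) := by
    rw [← Real.exp_add]; ring_nf
  have f3 : Real.exp (-(γ ^ 2 * v)) *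
      Real.exp (((2 * γ) ^ 2 * v + (2 * (2 * γ) * 0 + 0 ^ 2) * w) / 2) = Real.exp (γ ^ 2 * v) := by
    rw [← Real.exp_add]; ring_nf
  linear_combination f1 - 2 * f2 + f3

lemma enorm_integral_trig_mul_sub_le {f g : UnitCircle → ℝ} (hf : Continuous f)
    (hg : Measurable g) (b : Bool) (n : ℕ) :
    ‖(∫ θ, trig b n θ * f θ) - ∫ θ, trig b n θ * g θ‖ₑ ≤ ∫⁻ θ, ‖f θ - g θ‖ₑ := by
  have ht : ∀ {h : UnitCircle → ℝ}, Integrable h → Integrable fun θ => trig b n θ * h θ := fun hh =>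
    hh.bdd_mul (trig b n).continuous.aestronglyMeasurable
      (ae_of_all _ fun θ => abs_trig_le_one b n θ)
  by_cases hfin : ∫⁻ θ, ‖f θ - g θ‖ₑ = ∞
  · rw [hfin]; exact le_top
  have hfi : Integrable f := hf.integrable_of_hasCompactSupport (HasCompactSupport.of_compactSpace f)
  have hd : Integrable fun θ => f θ - g θ :=
    ⟨(hf.measurable.sub hg).aestronglyMeasurable, lt_top_iff_ne_top.2 hfin⟩
  have hgi : Integrable g := (hfi.sub hd).congr (ae_of_all _ fun θ => by simp)
  rw [← integral_sub (ht hfi) (ht hgi)]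
  refine (enorm_integral_le_lintegral_enorm _).trans (lintegral_mono fun θ => ?_)
  rw [← mul_sub, enorm_mul]
  refine mul_le_of_le_one_left (zero_le) ?_
  rw [← ofReal_norm, ← ENNReal.ofReal_one]
  exact ENNReal.ofReal_le_ofReal (abs_trig_le_one b n θ)

/-- The vector of the first Fourier coefficients of a density, in real form. -/
noncomputable def densityModes (N : ℕ) (f : UnitCircle → ℝ) (p : Bool × Fin N) : ℝ :=
  ∫ θ, trig p.1 p.2 θ * f θ

/-- The complex Fourier coefficients with the given real modes. -/
noncomputable def toCoeff {N : ℕ} (v : Bool × Fin N → ℝ) (n : ℕ) : ℂ :=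
  if h : n < N then v (false, ⟨n, h⟩) + v (true, ⟨n, h⟩) * Complex.I else 0

lemma continuous_toCoeff {N : ℕ} : Continuous (toCoeff : (Bool × Fin N → ℝ) → ℕ → ℂ) := by
  refine continuous_pi fun n => ?_
  unfold toCoeff
  split_ifs with h <;> fun_prop

lemma measurable_densityModes {α : Type*} [MeasurableSpace α] {f : α → UnitCircle → ℝ}
    (hf : Measurable fun q : α × UnitCircle => f q.1 q.2) (N : ℕ) :
    Measurable fun a => densityModes N (f a) := by
  refine measurable_pi_lambda _ fun p => ?_
  have hm : Measurable fun q : α × UnitCircle => trig p.1 p.2 q.2 * f q.1 q.2 :=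
    ((trig p.1 p.2).continuous.measurable.comp measurable_snd).mul hf
  exact (hm.stronglyMeasurable.integral_prod_right' (ν := volume)).measurable

lemma measurable_seriesDensity (γ a : ℝ) {m : ℕ} {V : Ω → Bool × Fin m → ℝ} (hV : Measurable V) :
    Measurable fun q : Ω × UnitCircle => seriesDensity γ a (V q.1) q.2 :=
  (((measurable_modeSum (hV.comp measurable_fst) measurable_snd).const_mul γ).sub_const _).exp

/-- Uniform bound for the Fourier coefficients of the regularized measures. -/
lemma IsCircleGFF.lintegral_sqNormL4_regDensity_le [IsProbabilityMeasure P]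
    (hφ : IsCircleGFF P φ) (hφreg : IsCutoff P φ φreg) {γ b : ℝ}
    {C : ℝ} {N : ℕ} {s : Finset ℕ} (hsN : ∀ n ∈ s, n < N) {ε : ℝ}
    (hε : ε ∈ Set.Ioo 0 π)
    (hC : ∀ (J : ℕ) (V : Ω → Bool × Fin (2 ^ J / 2) → ℝ),
      HasGaussianLaw V P → (∀ p, ∫ ω, V ω p ∂P = 0) →
      (∀ p q, ∫ ω, V ω p * V ω q ∂P = if p = q then fieldCoeff (damping ε) p.2 ^ 2 else 0) →
      ∫⁻ ω, ENNReal.ofReal (sqNormL4 s (fun n => (n : ℝ) ^ (4 * b))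
        (seriesCoeff γ (truncVariance (damping ε) (2 ^ J / 2)) (V ω))) ∂P ≤ ENNReal.ofReal C) :
    ∫⁻ ω, ENNReal.ofReal (sqNormL4 s (fun n => (n : ℝ) ^ (4 * b))
      (toCoeff (densityModes N (regDensity φreg γ ε ω)))) ∂P ≤ ENNReal.ofReal C := by
  choose V hVm hVg hV0 hVV hVX using fun J : ℕ => hφ.exists_modes hε.1 hε.2 (2 ^ J / 2)
  set v : ℝ := ∑' k, fieldCoeff (damping ε) k ^ 2 with hv
  set w : ℕ → ℝ := fun J => truncVariance (damping ε) (2 ^ J / 2) with hw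
  have hwv : Tendsto w atTop (𝓝 v) := by
    have h1 := (summable_fieldCoeff_sq hε.1).hasSum.tendsto_sum_nat
    have h2 : Tendsto (fun J : ℕ => 2 ^ J / 2) atTop atTop := by
      refine (tendsto_add_atTop_iff_nat 1).1 ?_
      simp only [pow_succ, Nat.mul_div_cancel _ (show 0 < 2 by norm_num)]
      exact tendsto_pow_atTop_atTop_of_one_lt one_lt_two
    exact h1.comp h2
  set A : Ω → UnitCircle → ℝ := fun ω => regDensity φreg γ ε ω with hA
  set B : ℕ → Ω → UnitCircle → ℝ := fun J ω => seriesDensity γ (w J) (V J ω) with hB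
  have hAm : Measurable fun q : Ω × UnitCircle => A q.1 q.2 := measurable_regDensity hφreg hε γ
  have hBm : ∀ J, Measurable fun q : Ω × UnitCircle => B J q.1 q.2 := fun J =>
    measurable_seriesDensity _ _ (hVm J)
  -- The mean square distance at a fixed angle depends only on the two variances, so it vanishes as
  -- the truncated variance tends to the full one, uniformly in θ.
  have hpt : ∀ J θ, ∫⁻ ω, ‖B J ω θ - A ω θ‖ₑ ∂P ≤
      ENNReal.ofReal √(Real.exp (γ ^ 2 * v) - Real.exp (γ ^ 2 * w J)) := by
    intro J θ
    have h1 := integral_exp_sub_exp_sq (γ := γ) (hVX J θ)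
    have hae : ∀ᵐ ω ∂P, B J ω θ - A ω θ = Real.exp (γ * modeSum (V J ω) θ - γ ^ 2 / 2 * w J) -
        Real.exp (γ * φ (arcAverage ε θ) ω - γ ^ 2 / 2 * v) := by
      filter_upwards [hφreg.version ε hε θ] with ω hω
      simp only [hA, hB, regDensity, seriesDensity, hω, ← hv]
    have hae2 : (fun ω => (B J ω θ - A ω θ) ^ 2) =ᵐ[P] fun ω =>
        (Real.exp (γ * modeSum (V J ω) θ - γ ^ 2 / 2 * w J) -
        Real.exp (γ * φ (arcAverage ε θ) ω - γ ^ 2 / 2 * v)) ^ 2 := hae.mono fun ω h => by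
      simp only [h]
    have h2 := lintegral_enorm_le_sqrt (P := P) (D := fun ω => B J ω θ - A ω θ)
      (((hBm J).sub hAm).comp measurable_prodMk_right).aestronglyMeasurable (h1.1.congr hae2.symm)
    rwa [integral_congr_ae hae2, h1.2] at h2
  have hL1 : ∀ J p, ∫⁻ ω, ‖densityModes N (B J ω) p - densityModes N (A ω) p‖ₑ ∂P ≤
      ENNReal.ofReal √(Real.exp (γ ^ 2 * v) - Real.exp (γ ^ 2 * w J)) *
        (volume (Set.univ : Set UnitCircle)) := by
    intro J p
    calc _ ≤ ∫⁻ ω, (∫⁻ θ, ‖B J ω θ - A ω θ‖ₑ) ∂P :=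
          lintegral_mono fun ω => enorm_integral_trig_mul_sub_le (continuous_seriesDensity _ _ _)
            (hAm.comp measurable_prodMk_left) p.1 p.2
      _ = ∫⁻ θ, (∫⁻ ω, ‖B J ω θ - A ω θ‖ₑ ∂P) :=
          lintegral_lintegral_swap ((hBm J).sub hAm).enorm.aemeasurable
      _ ≤ ∫⁻ _ : UnitCircle, ENNReal.ofReal √(Real.exp (γ ^ 2 * v) - Real.exp (γ ^ 2 * w J)) :=
          lintegral_mono fun θ => hpt J θ
      _ = _ := lintegral_const _
  have hlim : Tendsto (fun J => ENNReal.ofReal √(Real.exp (γ ^ 2 * v) - Real.exp (γ ^ 2 * w J)) *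
      (volume (Set.univ : Set UnitCircle))) atTop (𝓝 0) := by
    have h1 : Tendsto (fun J => √(Real.exp (γ ^ 2 * v) - Real.exp (γ ^ 2 * w J))) atTop
        (𝓝 √(Real.exp (γ ^ 2 * v) - Real.exp (γ ^ 2 * v))) :=
      (tendsto_const_nhds.sub (Real.continuous_exp.continuousAt.tendsto.comp
        (hwv.const_mul _))).sqrt
    rw [sub_self, Real.sqrt_zero] at h1
    have h2 := ENNReal.Tendsto.mul_const (ENNReal.tendsto_ofReal h1)
      (Or.inr (measure_ne_top volume (Set.univ : Set UnitCircle)))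
    simpa using h2
  have hmeas : ∀ J, Measurable fun ω => densityModes N (B J ω) := fun J =>
    measurable_densityModes (hBm J) N
  have hmeasA : Measurable fun ω => densityModes N (A ω) := measurable_densityModes hAm N
  -- The Fourier modes converge in `L¹` of the probability as J grows, hence in measure, and the
  -- uniform bound survives by Fatou.
  refine lintegral_le_of_tendstoInMeasure (X := fun J ω => densityModes N (B J ω))
    (Y := fun ω => densityModes N (A ω)) (u := atTop)
    (F := fun x => ENNReal.ofReal (sqNormL4 s (fun n => (n : ℝ) ^ (4 * b)) (toCoeff x)))
    (tendstoInMeasure_pi fun p => ?_)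
    (ENNReal.continuous_ofReal.comp (continuous_sqNormL4.comp continuous_toCoeff))
    (Eventually.of_forall fun J => ⟨(hmeas J).aemeasurable, ?_⟩)
  · refine tendstoInMeasure_of_tendsto_eLpNorm one_ne_zero
      (fun J => ((measurable_pi_apply p).comp (hmeas J)).aestronglyMeasurable)
      ((measurable_pi_apply p).comp hmeasA).aestronglyMeasurable ?_
    simp only [eLpNorm_one_eq_lintegral_enorm]
    exact tendsto_of_tendsto_of_tendsto_of_le_of_le tendsto_const_nhds hlim
      (fun _ => zero_le) fun J => hL1 J p
  · refine le_trans (le_of_eq ?_) (hC J (V J) (hVg J) (hV0 J) (hVV J))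
    refine lintegral_congr fun ω => ?_
    congr 1
    rw [sqNormL4, sqNormL4]
    congr 1
    refine Finset.sum_congr rfl fun n hn => ?_
    rw [seriesCoeff_eq, toCoeff, dif_pos (hsN n hn), Complex.mk_eq_add_mul_I]
    rfl

end Approximation

/-! ### Passage to the chaos measure and almost sure decay. -/

section Coefficients

variable {Ω : Type*} [MeasurableSpace Ω] {P : Measure Ω} {φ : TestSpace → Ω → ℝ}
  {φreg : ℝ → UnitCircle → Ω → ℝ} {γ : ℝ} {M : Ω → Measure UnitCircle}

lemma coeff_eq (μ : Measure UnitCircle) [IsFiniteMeasure μ] (n : ℕ) :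
    coeff μ n = (∫ θ, trig false n θ ∂μ : ℝ) + (∫ θ, trig true n θ ∂μ : ℝ) * Complex.I := by
  have hi : Integrable (fun θ : UnitCircle => (fourier (n : ℤ) θ : ℂ)) μ :=
    (fourier (n : ℤ)).continuous.integrable_of_hasCompactSupport
      (HasCompactSupport.of_compactSpace _)
  rw [← Complex.mk_eq_add_mul_I]
  apply Complex.ext
  · exact (integral_re hi).symm
  · exact (integral_im hi).symm

lemma measurable_coeff (hM : IsGMC P φreg γ M) (n : ℕ) : Measurable fun ω => coeff (M ω) n := by
  have := hM.isFiniteMeasure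
  have h : ∀ f : C(UnitCircle, ℝ), Measurable fun ω => ∫ θ, f θ ∂(M ω) := fun f => by
    have hi : ∀ ω, Integrable f (M ω) := fun ω =>
      f.continuous.integrable_of_hasCompactSupport (HasCompactSupport.of_compactSpace _)
    simp only [fun ω => integral_eq_lintegral_pos_part_sub_lintegral_neg_part (hi ω)]
    exact ((Measure.measurable_lintegral f.continuous.measurable.ennreal_ofReal).comp
      hM.measurable).ennreal_toReal.sub ((Measure.measurable_lintegral
      f.continuous.measurable.neg.ennreal_ofReal).comp hM.measurable).ennreal_toReal
  simp only [coeff_eq]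
  exact (Complex.measurable_ofReal.comp (h _)).add
    ((Complex.measurable_ofReal.comp (h _)).mul_const _)

/-- Uniform bound for the weighted `ℓ⁴` norms of the Fourier coefficients of the chaos. -/
lemma IsGMC.exists_forall_lintegral_sqNormL4_le [IsProbabilityMeasure P] (hφ : IsCircleGFF P φ)
    (hφreg : IsCutoff P φ φreg) (hγ : 0 ≤ γ) (hγ1 : γ ≤ 1) (hM : IsGMC P φreg γ M) {b : ℝ}
    (hb : 0 ≤ b) (hb' : 4 * b < 1 - 2 * γ ^ 2) : ∃ C : ℝ, ∀ N : ℕ,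
      ∫⁻ ω, ENNReal.ofReal (sqNormL4 (Finset.Icc 1 N) (fun n => (n : ℝ) ^ (4 * b))
        (coeff (M ω))) ∂P ≤ ENNReal.ofReal C := by
  obtain ⟨C, hC⟩ := exists_forall_lintegral_seriesCoeff_le hγ hγ1 hb hb'
  refine ⟨C, fun N => ?_⟩
  have := hM.isFiniteMeasure
  -- Only the frequencies up to N enter, so weak convergence in probability is needed for finitely
  -- many trigonometric test functions.
  have h1 : ∀ ω, sqNormL4 (Finset.Icc 1 N) (fun n => (n : ℝ) ^ (4 * b)) (coeff (M ω)) =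
      sqNormL4 (Finset.Icc 1 N) (fun n => (n : ℝ) ^ (4 * b))
        (toCoeff fun p : Bool × Fin (N + 1) => ∫ θ, trig p.1 p.2 θ ∂(M ω)) := fun ω => by
    rw [sqNormL4, sqNormL4]
    congr 1
    refine Finset.sum_congr rfl fun n hn => ?_
    rw [coeff_eq, toCoeff, dif_pos (Nat.lt_succ_of_le (Finset.mem_Icc.1 hn).2)]
  simp only [h1]
  refine lintegral_le_of_tendstoInMeasure (u := 𝓝[>] (0 : ℝ))
    (X := fun ε ω (p : Bool × Fin (N + 1)) => ∫ θ, trig p.1 p.2 θ ∂(regMeasure P φreg γ ε ω))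
    (Y := fun ω (p : Bool × Fin (N + 1)) => ∫ θ, trig p.1 p.2 θ ∂(M ω))
    (F := fun x => ENNReal.ofReal (sqNormL4 (Finset.Icc 1 N) (fun n => (n : ℝ) ^ (4 * b))
      (toCoeff x)))
    (tendstoInMeasure_pi fun p => hM.tendsto (trig p.1 p.2))
    (ENNReal.continuous_ofReal.comp (continuous_sqNormL4.comp continuous_toCoeff)) ?_
  filter_upwards [Ioo_mem_nhdsGT Real.pi_pos] with ε hε
  have h2 : ∀ ω, (fun p : Bool × Fin (N + 1) => ∫ θ, trig p.1 p.2 θ ∂(regMeasure P φreg γ ε ω)) =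
      densityModes (N + 1) (regDensity φreg γ ε ω) := fun ω => by
    funext p
    exact integral_regMeasure hφ hφreg hε γ ω _
  refine ⟨(measurable_densityModes (measurable_regDensity hφreg hε γ)
    (N + 1)).aemeasurable.congr (ae_of_all _ fun ω => (h2 ω).symm), ?_⟩
  simp only [h2]
  exact hφ.lintegral_sqNormL4_regDensity_le hφreg
    (fun n hn => Nat.lt_succ_of_le (Finset.mem_Icc.1 hn).2) hε
    fun J V => hC ε hε.1 (Finset.Icc 1 N) (by simp) J P V

lemma sqNormL4_mono_set {w : ℕ → ℝ} (hw : ∀ n, 0 ≤ w n) {s t : Finset ℕ} (hst : s ⊆ t)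
    (x : ℕ → ℂ) : sqNormL4 s w x ≤ sqNormL4 t w x :=
  Real.sqrt_le_sqrt (Finset.sum_le_sum_of_subset_of_nonneg hst fun n _ _ =>
    mul_nonneg (hw n) (by positivity))

/-- A single coefficient is controlled by the weighted `ℓ⁴` norm. -/
lemma norm_le_sqrt_sqNormL4_div {b : ℝ} {N n : ℕ} (hn : n ∈ Finset.Icc 1 N) (x : ℕ → ℂ) :
    ‖x n‖ ≤ √(sqNormL4 (Finset.Icc 1 N) (fun n => (n : ℝ) ^ (4 * b)) x) / (n : ℝ) ^ b := by
  have hn0 : (0 : ℝ) < n := by exact_mod_cast (Finset.mem_Icc.1 hn).1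
  have hw : ∀ n : ℕ, 0 ≤ (n : ℝ) ^ (4 * b) := fun n => by positivity
  rw [le_div_iff₀ (by positivity)]
  refine Real.le_sqrt_of_sq_le (Real.le_sqrt_of_sq_le ?_)
  have h := Finset.single_le_sum (f := fun n : ℕ => (n : ℝ) ^ (4 * b) * ‖x n‖ ^ 4)
    (fun n _ => mul_nonneg (hw n) (by positivity)) hn
  refine le_trans (le_of_eq ?_) h
  rw [mul_comm 4 b, Real.rpow_mul hn0.le, Real.rpow_ofNat]
  ring

/-- Almost sure decay of the Fourier coefficients of the chaos. -/
lemma IsGMC.exists_norm_coeff_le [IsProbabilityMeasure P] (hφ : IsCircleGFF P φ)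
    (hφreg : IsCutoff P φ φreg) (hγ : 0 ≤ γ) (hγ1 : γ ≤ 1) (hM : IsGMC P φreg γ M) {b : ℝ}
    (hb : 0 ≤ b) (hb' : 4 * b < 1 - 2 * γ ^ 2) : ∃ C : Ω → ℝ, Measurable C ∧
      ∀ᵐ ω ∂P, ∀ n : ℕ, 1 ≤ n → ‖coeff (M ω) n‖ ≤ C ω / (n : ℝ) ^ b := by
  obtain ⟨C, hC⟩ := hM.exists_forall_lintegral_sqNormL4_le hφ hφreg hγ hγ1 hb hb'
  set T : ℕ → Ω → ℝ≥0∞ := fun N ω => ENNReal.ofReal (sqNormL4 (Finset.Icc 1 N)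
    (fun n => (n : ℝ) ^ (4 * b)) (coeff (M ω))) with hT
  have hTm : ∀ N, Measurable (T N) := fun N =>
    (measurable_pi_lambda _ fun n => measurable_coeff hM n).ofReal_sqNormL4
  have hmono : Monotone T := fun N N' h ω => ENNReal.ofReal_le_ofReal
    (sqNormL4_mono_set (fun n => by positivity) (Finset.Icc_subset_Icc_right h) _)
  -- By monotone convergence the supremum over N has finite expectation, hence is finite almost
  -- surely; its square root, the full weighted `ℓ⁴` norm, is the random constant.
  have hsup : ∫⁻ ω, ⨆ N, T N ω ∂P ≤ ENNReal.ofReal C := by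
    rw [lintegral_iSup hTm hmono]
    exact iSup_le hC
  have hsupm : Measurable fun ω => ⨆ N, T N ω := Measurable.iSup hTm
  refine ⟨fun ω => √(⨆ N, T N ω).toReal, hsupm.ennreal_toReal.sqrt, ?_⟩
  filter_upwards [ae_lt_top hsupm (hsup.trans_lt ENNReal.ofReal_lt_top).ne] with ω hω n hn
  refine (norm_le_sqrt_sqNormL4_div (b := b) (Finset.mem_Icc.2 ⟨hn, le_rfl⟩) (coeff (M ω))).trans ?_
  gcongr
  exact (ENNReal.ofReal_le_iff_le_toReal hω.ne).1 (le_iSup (fun N => T N ω) n)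

lemma ofReal_le_fourierDim {μ : Measure UnitCircle} {C b : ℝ} (hb : 0 ≤ b)
    (h : ∀ n : ℕ, 1 ≤ n → ‖coeff μ n‖ ≤ C / (n : ℝ) ^ b) :
    ENNReal.ofReal (2 * b) ≤ fourierDim μ := by
  refine le_sSup ⟨2 * b, by positivity, rfl, Asymptotics.IsBigO.of_bound C ?_⟩
  filter_upwards [eventually_ge_atTop 1] with n hn
  have hn0 : (0 : ℝ) ≤ n := Nat.cast_nonneg n
  rw [norm_norm, Real.norm_of_nonneg (by positivity), show -(2 * b) / 2 = -b by ring,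
    Real.rpow_neg hn0, ← div_eq_mul_inv]
  exact h n hn

end Coefficients

end CircleGMC

theorem theorem1p2 {Ω : Type*} [MeasurableSpace Ω] (P : Measure Ω) [IsProbabilityMeasure P]
    (φ : CircleGMC.TestSpace → Ω → ℝ) (hφ : CircleGMC.IsCircleGFF P φ)
    (φreg : ℝ → CircleGMC.UnitCircle → Ω → ℝ) (hφreg : CircleGMC.IsCutoff P φ φreg)
    (γ : ℝ) (hγ0 : 0 ≤ γ) (hγ : γ < 1 / Real.sqrt 2)
    (M : Ω → Measure CircleGMC.UnitCircle) (hM : CircleGMC.IsGMC P φreg γ M) :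
    (∀ β ∈ Set.Ioo (0 : ℝ) ((1 - 2 * γ ^ 2) / 4),
      ∃ C : Ω → ℝ, Measurable C ∧
        ∀ᵐ ω ∂P, ∀ n : ℕ, 1 ≤ n → ‖CircleGMC.coeff (M ω) n‖ ≤ C ω / (n : ℝ) ^ β) ∧
    ∀ᵐ ω ∂P, ENNReal.ofReal ((1 - 2 * γ ^ 2) / 2) ≤ CircleGMC.fourierDim (M ω) := by
  have hγ2 : γ ^ 2 < 1 / 2 := by
    have h := pow_lt_pow_left₀ hγ hγ0 two_ne_zero
    rwa [div_pow, one_pow, Real.sq_sqrt (by norm_num)] at h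
  have hγ1 : γ ≤ 1 := by nlinarith
  have main : ∀ β ∈ Set.Ioo (0 : ℝ) ((1 - 2 * γ ^ 2) / 4),
      ∃ C : Ω → ℝ, Measurable C ∧
        ∀ᵐ ω ∂P, ∀ n : ℕ, 1 ≤ n → ‖CircleGMC.coeff (M ω) n‖ ≤ C ω / (n : ℝ) ^ β := fun β hβ =>
    hM.exists_norm_coeff_le hφ hφreg hγ0 hγ1 hβ.1.le (by linarith [hβ.2])
  refine ⟨main, ?_⟩
  -- The exceptional null set depends on β. A sequence of exponents tending to the endpoint needs
  -- only countably many of them, and the dimension bound passes to the limit.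
  obtain ⟨u, -, hu, hlim⟩ := exists_seq_strictMono_tendsto'
    (show (0 : ℝ) < (1 - 2 * γ ^ 2) / 4 by linarith)
  choose C _ hC using fun k => main (u k) (hu k)
  filter_upwards [ae_all_iff.2 hC] with ω hω
  have h1 : Tendsto (fun k => ENNReal.ofReal (2 * u k)) atTop
      (𝓝 (ENNReal.ofReal (2 * ((1 - 2 * γ ^ 2) / 4)))) :=
    ENNReal.tendsto_ofReal (hlim.const_mul 2)
  rw [show 2 * ((1 - 2 * γ ^ 2) / 4) = (1 - 2 * γ ^ 2) / 2 by ring] at h1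
  exact le_of_tendsto' h1 fun k => CircleGMC.ofReal_le_fourierDim (hu k).1.le (hω k)
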